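/- **Proposition 3.4.** Let $q>0$ and $\alpha>4$, and put $r=\alpha+2$, $p=\frac{2\alpha(\alpha+2)}{\alpha+4}$. Let $H_q=-\frac12\partial_{xx}+q\delta$ be the self-adjoint operator on $L^2(\mathbb R)$ with domain $$\mathcal D(H_q)=\{f\in C(\mathbb R)\cap H^2(\mathbb R\setminus\{0\}) : f'(0^+)-f'(0^-)=2q f(0)\},\qquad H_qf=-\tfrac12 f'' \text{ on } \mathbb R\setminus\{0\},$$ let $H_0=-\frac12\partial_{xx}$ with domain $H^2(\mathbb R)$, and let $e^{-itH_q}$, $e^{-itH_0}$ be the unitary groups they generate on $L^2(\mathbb R)$. Let $(x^n)_{n\in\mathbb N}$ be real numbers with $|x^n|\to+\infty$, let $\psi\in H^1(\mathbb R)$, and let $U\in C(\mathbb R;H^1(\mathbb R))\cap L^p(\mathbb R;L^r(\mathbb R))$ be the solution of $i\partial_tU+\frac12\partial_{xx}U-U|U|^\alpha=0$, $U(0)=\psi$, that is, $$U(t)=e^{-itH_0}\psi-i\int_0^te^{-i(t-s)H_0}\big(U(s)|U(s)|^\alpha\big)\,ds\qquad(t\in\mathbb R).$$ Put $\psi_n(x)=\psi(x-x^n)$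 and $U_n(t,x)=U(t,x-x^n)$. Then $$U_n(t)=e^{-itH_q}\psi_n-i\int_0^te^{-i(t-s)H_q}\big(U_n(s)|U_n(s)|^\alpha\big)\,ds+g_n(t)\qquad(t\in\mathbb R,\ n\in\mathbb N),$$ where $\|g_n\|_{L^p(\mathbb R;L^r(\mathbb R))}\to0$ as $n\to\infty$. -/

import Mathlib

open MeasureTheory Filter Topology
open scoped ContDiff ENNReal

/-- The Hilbert space `L²(ℝ; ℂ)`. -/
abbrev L2 : Type := Lp ℂ 2 (volume : Measure ℝ)

/-- `g` is the weak derivative of `f` on the open set `Ω ⊆ ℝ`. -/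
def HasWeakDerivOn (Ω : Set ℝ) (f g : ℝ → ℂ) : Prop :=
  ∀ φ : ℝ → ℝ, ContDiff ℝ ∞ φ → HasCompactSupport φ → tsupport φ ⊆ Ω →
    ∫ x, deriv φ x • f x = - ∫ x, φ x • g x

/-- `f ∈ H¹(ℝ)`: the class `f ∈ L²` has a weak derivative in `L²`. -/
def MemH1 (f : L2) : Prop :=
  ∃ g : L2, HasWeakDerivOn Set.univ f g

/-- `U ∈ C(ℝ; H¹(ℝ))`: every `U t` has a weak derivative `V t` in `L²`, and both `t ↦ U t` and
`t ↦ V t` are continuous into `L²`, that is, `U` is continuous for the norm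
`(‖u‖² + ‖u'‖²)^(1/2)` of `H¹`. -/
def ContinuousInH1 (U : ℝ → L2) : Prop :=
  ∃ V : ℝ → L2, (∀ t, HasWeakDerivOn Set.univ (U t) (V t)) ∧ Continuous U ∧ Continuous V

/-- The graph of `H_q = -½ ∂ₓₓ + q δ`: `DeltaHamiltonian q f h` says that `f` lies in
`D(H_q) = {f ∈ C(ℝ) ∩ H²(ℝ ∖ {0}) : f'(0⁺) - f'(0⁻) = 2 q f(0)}` and that `H_q f = h`, where
`H_q f = -½ f''` on `ℝ ∖ {0}`. Here `F` is the continuous representative of `f`; `f₁` and `f₂` are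
the first two weak derivatives of `f` on `ℝ ∖ {0}`, both in `L²`; `F₁` is the representative of `f₁`
that is continuous on `ℝ ∖ {0}`, and `a`, `b` are its one-sided limits `f'(0⁺)`, `f'(0⁻)`. -/
def DeltaHamiltonian (q : ℝ) (f h : L2) : Prop :=
  ∃ (F F₁ : ℝ → ℂ) (f₁ f₂ : L2) (a b : ℂ),
    (Continuous F ∧ f =ᵐ[volume] F) ∧
    HasWeakDerivOn {0}ᶜ f f₁ ∧ HasWeakDerivOn {0}ᶜ f₁ f₂ ∧
    (ContinuousOn F₁ {0}ᶜ ∧ f₁ =ᵐ[volume] F₁) ∧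
    (Tendsto F₁ (𝓝[>] 0) (𝓝 a) ∧ Tendsto F₁ (𝓝[<] 0) (𝓝 b)) ∧
    a - b = 2 * (q : ℂ) * F 0 ∧
    h = (-(1 / 2) : ℂ) • f₂

/-- `S` is the strongly continuous one-parameter unitary group `t ↦ e^{-itA}` on `L²`, where the
operator `A` is given through its graph (`A f h` means `f ∈ D(A)` and `A f = h`): the
infinitesimal generator of `S` is exactly `-iA`. -/
structure IsUnitaryGroupOf (A : L2 → L2 → Prop) (S : ℝ → L2 →L[ℂ] L2) : Prop where
  zero : ∀ f, S 0 f = f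
  add : ∀ s t f, S (s + t) f = S s (S t f)
  norm_map : ∀ t f, ‖S t f‖ = ‖f‖
  continuous : ∀ f, Continuous fun t => S t f
  generator : ∀ f h, A f h ↔ HasDerivAt (fun t => S t f) (-Complex.I • h) 0

namespace IsUnitaryGroupOf

variable {A : L2 → L2 → Prop} {S T : ℝ → L2 →L[ℂ] L2}

theorem inner_map (hS : IsUnitaryGroupOf A S) (t : ℝ) (f g : L2) :
    inner ℂ (S t f) (S t g) = inner ℂ f g :=
  (LinearMap.norm_map_iff_inner_map_map (S t)).1 (hS.norm_map t) f g

theorem hasDerivAt (hS : IsUnitaryGroupOf A S) {f h : L2} (hf : A f h) (t : ℝ) :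
    HasDerivAt (fun s => S s f) (-Complex.I • S t h) t := by
  have h0 := (hS.generator f h).1 hf
  have h1 : HasDerivAt (fun s => S (s - t) f) (-Complex.I • h) t := by
    have h0' : HasDerivAt (fun t => S t f) (-Complex.I • h) (t - t) := by simpa using h0
    exact h0'.comp_sub_const t t
  have h2 := ((S t).restrictScalars ℝ).hasFDerivAt.comp_hasDerivAt t h1
  have h3 : (fun s => S s f) = ((S t).restrictScalars ℝ) ∘ fun s => S (s - t) f := by
    funext s
    simp [← hS.add]
  rw [h3]
  simpa using h2

theorem map_graph (hS : IsUnitaryGroupOf A S) {f h : L2} (hf : A f h) (t : ℝ) :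
    A (S t f) (S t h) := by
  rw [hS.generator]
  have h1 : HasDerivAt (fun s => S s f) (-Complex.I • S t h) (0 + t) := by
    simpa using hS.hasDerivAt hf t
  have h2 := h1.comp_add_const 0 t
  simpa only [hS.add] using h2

theorem symmetric (hS : IsUnitaryGroupOf A S) {f h g k : L2} (hf : A f h) (hg : A g k) :
    inner ℂ f (-Complex.I • k) + inner ℂ (-Complex.I • h) g = 0 := by
  have h1 := HasDerivAt.inner ℂ ((hS.generator f h).1 hf) ((hS.generator g k).1 hg)
  simp only [hS.inner_map, hS.zero] at h1
  exact h1.unique (hasDerivAt_const _ _)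

/-- The domain of the generator is dense. -/
theorem dense_domain (hS : IsUnitaryGroupOf A S) : Dense {f | ∃ h, A f h} := by
  intro f
  have hc := hS.continuous f
  have hint : ∀ a b : ℝ, IntervalIntegrable (fun s => S s f) volume a b :=
    fun a b => hc.intervalIntegrable a b
  let G : ℝ → L2 := fun ε => ε⁻¹ • ∫ s in (0 : ℝ)..ε, S s f
  have hG : Tendsto G (𝓝[≠] 0) (𝓝 f) := by
    have hd : HasDerivAt (fun ε => ∫ s in (0 : ℝ)..ε, S s f) (S 0 f) 0 :=
      intervalIntegral.integral_hasDerivAt_right (hint 0 0)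
        hc.aestronglyMeasurable.stronglyMeasurableAtFilter hc.continuousAt
    have := hasDerivAt_iff_tendsto_slope.1 hd
    rw [hS.zero] at this
    refine this.congr fun ε => ?_
    simp [G, slope]
  refine mem_closure_of_tendsto hG (Eventually.of_forall fun ε => ?_)
  refine ⟨Complex.I • ε⁻¹ • (S ε f - f), (hS.generator _ _).2 ?_⟩
  have h1 : (fun t => S t (G ε)) =
      fun t => ε⁻¹ • ((∫ s in (0 : ℝ)..(ε + t), S s f) - ∫ s in (0 : ℝ)..t, S s f) := by
    funext t
    have e1 : S t (∫ s in (0 : ℝ)..ε, S s f) = ∫ s in (0 : ℝ)..ε, S (s + t) f := by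
      rw [← ContinuousLinearMap.intervalIntegral_comp_comm _ (hint 0 ε)]
      simp only [← hS.add, add_comm]
    rw [intervalIntegral.integral_interval_sub_left (hint _ _) (hint _ _)]
    simp only [G]
    have e2 := ((S t).restrictScalars ℝ).map_smul ε⁻¹ (∫ s in (0 : ℝ)..ε, S s f)
    rw [ContinuousLinearMap.coe_restrictScalars'] at e2
    rw [e2, e1, intervalIntegral.integral_comp_add_right (fun s => S s f), zero_add]
  rw [h1]
  have hd : ∀ t, HasDerivAt (fun b => ∫ s in (0 : ℝ)..b, S s f) (S t f) t := fun t =>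
    intervalIntegral.integral_hasDerivAt_right (hint 0 t)
      hc.aestronglyMeasurable.stronglyMeasurableAtFilter hc.continuousAt
  have hd1 : HasDerivAt (fun t => ∫ s in (0 : ℝ)..(ε + t), S s f) (S ε f) 0 := by
    have := hd (ε + 0)
    rw [add_zero] at this
    exact HasDerivAt.comp_const_add ε 0 (by simpa using this)
  have := (hd1.sub (hd 0)).const_smul ε⁻¹
  rw [hS.zero] at this
  have e3 : -Complex.I • Complex.I • ε⁻¹ • (S ε f - f) = ε⁻¹ • (S ε f - f) := by
    rw [smul_smul]
    simp
  rw [e3]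
  exact this

/-- The unitary group of `A` is unique. -/
theorem unique (hS : IsUnitaryGroupOf A S) (hT : IsUnitaryGroupOf A T) : S = T := by
  have key : ∀ f h g k : L2, A f h → A g k → ∀ t,
      inner ℂ (S t f) (T t g) = inner ℂ f g := by
    intro f h g k hf hg t
    have hd : ∀ t, HasDerivAt (fun t => inner ℂ (S t f) (T t g)) 0 t := by
      intro t
      have h1 := HasDerivAt.inner ℂ (hS.hasDerivAt hf t) (hT.hasDerivAt hg t)
      rwa [hS.symmetric (hS.map_graph hf t) (hT.map_graph hg t)] at h1
    have := is_const_of_deriv_eq_zero (fun t => (hd t).differentiableAt) (fun t => (hd t).deriv) t 0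
    simpa [hS.zero, hT.zero] using this
  funext t
  have hdom : ∀ g, (∃ k, A g k) → S t g = T t g := by
    rintro g ⟨k, hg⟩
    refine hS.dense_domain.eq_of_inner_left (𝕜 := ℂ) ?_
    rintro f ⟨h, hf⟩
    have hf' := hS.map_graph hf (-t)
    have e : S t (S (-t) f) = f := by rw [← hS.add]; simp [hS.zero]
    have h1 := key _ _ _ _ hf' hg t
    have h2 := hS.inner_map t (S (-t) f) g
    rw [e] at h1 h2
    rw [← inner_conj_symm, ← inner_conj_symm (T t g), h1, h2]
  ext1 g
  exact congrFun (Continuous.ext_on hS.dense_domain (S t).continuous (T t).continuous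
    (fun g hg => hdom g hg)) g

end IsUnitaryGroupOf

open Classical in
/-- `deltaGroup q t = e^{-itH_q}`, the unitary group of `H_q` (it is unique by
`IsUnitaryGroupOf.unique`, and exists since `H_q` is self-adjoint; the value in the other case is
never taken). For `q = 0` it is the free group `e^{-itH_0}` of `H_0 = -½ ∂ₓₓ` on `H²(ℝ)`. -/
noncomputable def deltaGroup (q : ℝ) : ℝ → L2 →L[ℂ] L2 :=
  if h : ∃ S, IsUnitaryGroupOf (DeltaHamiltonian q) S then h.choose else fun _ => 0

open Classical in
/-- The nonlinearity `u ↦ u |u|^α`, with values in `L²`; for `u ∈ H¹ ⊆ L² ∩ L^∞` and `α ≥ 0` the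
function `u |u|^α` is always in `L²`, so that the second case does not occur. -/
noncomputable def nonlinearity (α : ℝ) (u : L2) : L2 :=
  if h : MemLp (fun x => u x * ((‖u x‖ ^ α : ℝ) : ℂ)) 2 (volume : Measure ℝ) then h.toLp else 0

/-- The right-hand side of the Duhamel equation of `i ∂ₜu - H_q u - u|u|^α = 0`, `u(0) = φ`:
`e^{-itH_q} φ - i ∫₀ᵗ e^{-i(t-s)H_q} (u(s)|u(s)|^α) ds`, the integral being a Bochner integral
in `L²`. -/
noncomputable def duhamel (q α : ℝ) (φ : L2) (u : ℝ → L2) (t : ℝ) : L2 :=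
  deltaGroup q t φ - Complex.I • ∫ s in (0 : ℝ)..t, deltaGroup q (t - s) (nonlinearity α (u s))

/-- Translation `(τ_y f)(x) = f(x - y)` on `L²`. -/
noncomputable def translateL2 (y : ℝ) (f : L2) : L2 :=
  Lp.compMeasurePreserving (fun x => x - y) (measurePreserving_sub_right volume y) f

/-- The mixed norm `‖g‖_{L^p L^r} = ‖ t ↦ ‖g(t)‖_{L^r(ℝ)} ‖_{L^p(ℝ)}`, possibly infinite. -/
noncomputable def mixedNorm (p r : ℝ) (g : ℝ → L2) : ℝ≥0∞ :=
  eLpNorm (fun t => eLpNorm (g t) (ENNReal.ofReal r) volume) (ENNReal.ofReal p) volume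

/-! For $q>0$ the group $e^{-itH_q}$ is explicit. Odd functions in the domain vanish at the origin
and do not feel the delta, so odd data evolve freely. Even functions are functions on the half-line
with the Robin condition $w'(0^+)=q\,w(0)$. Let $C=q(q+\partial_x)^{-1}$, which is convolution with
$q e^{-qu}1_{u>0}$, and let $R$ be $2C-1$ followed by reflection. Then $R$ is a unitary involution
commuting with the free group, and $Rw=-w$ says that $w'-qw$ is odd, which contains the Robin
condition. Moreover every $f\in L^2(0,\infty)$ has exactly one extension to a $w$ with $Rw=-w$,
namely $f-Rf$: it extends $f$ because $C$ is causal, that is, $Cf(x)$ only sees $f$ on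
$(-\infty,x)$. Hence $e^{-itH_q}$ extends the even part in this way, evolves it freely, restricts to
$x>0$ and reflects; this is `robinGroup`. Its generator is $-iH_q$ because it is contained in
$-iH_q$, $H_q$ is symmetric (`DeltaHamiltonian.symmetric`), and the generator of a unitary group
admits no proper extension of the form $-iA$ with $A$ symmetric (`IsUnitaryGroupOf.of_symmetric`).

The payoff is `freeGroup_sub_robinGroup`: $e^{-itH_0}-e^{-itH_q}=B\,e^{-itH_0}P$, where $P$
(`foldOp`) folds the line onto $x>0$ and $B$ (`scatterOp`) is $C$ followed by a reflected
restriction. By causality $\|Bf\|_r\le 2\|f1_{x<0}\|_r$. Also $P=1-D$, where $D$ (`foldDefect`) only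
sees $x<0$. In the Duhamel formula the identity part of $P$ reassembles $U$ itself, and the error
becomes $$BU(t)-Be^{-itH_0}D\psi+iB\int_0^te^{-i(t-s)H_0}D(U|U|^\alpha)\,ds$$
(`IsFreeSolution.sub_duhamel_eq_foldDefect`). Everything is thus governed by what lies on the
negative half-line.

The first term is bounded pointwise in time. The third is bounded by the $L^{r'}\to L^r$ dispersive
estimate and the Hardy–Littlewood–Sobolev inequality, for which $p$ is exactly the right exponent.
For the second, $(p,r)$ is not an $L^2$-admissible pair, but the factor $C$ inside $B$ maps $L^2$
into $L^r$; a $TT^*$ argument for $e^{-itH_0}C$ gives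
`exists_lintegral_rNorm_rpow_freeGroup_causalOp_le`. After translation by $y\to+\infty$ all masses
on $x<0$ vanish by dominated convergence. Since $P$ does not distinguish a function from its
reflection, the error does not change when the solution is reflected, and this settles
$y\to-\infty$. -/

open scoped FourierTransform SchwartzMap

/-! ### Fourier transform, reflection and translation on $L^2$ -/

/-- The Plancherel transform on `L²(ℝ)`. -/
noncomputable def fourierL2 : L2 ≃ₗᵢ[ℂ] L2 := Lp.fourierTransformₗᵢ ℝ ℂ

theorem L2.locallyIntegrable (f : L2) : LocallyIntegrable f volume :=
  (Lp.memLp f).locallyIntegrable (by norm_num)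

theorem L2.inner_eq (f g : L2) : inner ℂ f g = ∫ x, g x * (starRingEnd ℂ) (f x) := by
  rw [L2.inner_def]; rfl

/-- The Plancherel transform is the restriction of the transform of tempered distributions, so it
can be moved onto the test function. -/
theorem schwartz_pairing_fourierL2 (f : L2) (φ : 𝓢(ℝ, ℂ)) :
    ∫ x, φ x * (fourierL2 f) x = ∫ x, 𝓕 (φ : ℝ → ℂ) x * f x := by
  have h := congrArg (fun T => T φ) (Lp.fourier_toTemperedDistribution_eq (E := ℝ) (F := ℂ) f)
  simp only [TemperedDistribution.fourier_apply, Lp.toTemperedDistribution_apply,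
    smul_eq_mul] at h
  exact h.symm

theorem schwartz_pairing_fourierL2_symm (f : L2) (φ : 𝓢(ℝ, ℂ)) :
    ∫ x, φ x * (fourierL2.symm f) x = ∫ x, 𝓕⁻ (φ : ℝ → ℂ) x * f x := by
  have h := congrArg (fun T => T φ) (Lp.fourierInv_toTemperedDistribution_eq (E := ℝ) (F := ℂ) f)
  simp only [TemperedDistribution.fourierInv_apply, Lp.toTemperedDistribution_apply,
    smul_eq_mul, SchwartzMap.fourierInv_coe] at h
  exact h.symm

theorem ae_eq_of_schwartz_pairing {f g : ℝ → ℂ} (hf : LocallyIntegrable f volume)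
    (hg : LocallyIntegrable g volume)
    (h : ∀ φ : 𝓢(ℝ, ℂ), ∫ x, φ x * f x = ∫ x, φ x * g x) : f =ᵐ[volume] g := by
  refine ae_eq_of_integral_contDiff_smul_eq hf hg fun φ h1 h2 => ?_
  have hs : HasCompactSupport (fun x => (φ x : ℂ)) := h2.comp_left (g := fun y : ℝ => (y : ℂ)) rfl
  have hd : ContDiff ℝ ∞ (fun x => (φ x : ℂ)) := Complex.ofRealCLM.contDiff.comp h1
  have := h (hs.toSchwartzMap hd)
  simpa using this

/-- Both transforms have the same pairing with Schwartz functions, by Fubini for the integral one.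
This is the only bridge from the abstract isometry to a formula. -/
theorem fourierL2_ae_eq (f : L2) (hf : Integrable f volume) :
    fourierL2 f =ᵐ[volume] 𝓕 (f : ℝ → ℂ) := by
  have hc : Continuous (𝓕 (f : ℝ → ℂ)) :=
    VectorFourier.fourierIntegral_continuous Real.continuous_fourierChar
      (by exact continuous_inner) hf
  refine ae_eq_of_schwartz_pairing (L2.locallyIntegrable _) hc.locallyIntegrable fun φ => ?_
  rw [schwartz_pairing_fourierL2]
  have := VectorFourier.integral_bilin_fourierIntegral_eq_flip (μ := volume) (ν := volume)
    (f := (φ : ℝ → ℂ)) (g := (f : ℝ → ℂ)) (L := innerₗ ℝ)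
    (ContinuousLinearMap.mul ℂ ℂ) Real.continuous_fourierChar continuous_inner
    φ.integrable hf
  simp only [flip_innerₗ] at this
  exact this

/-- Schwartz functions are dense and integrable, so identities between continuous operators may be
checked where the Fourier integral converges. -/
theorem L2.dense_induction {p : L2 → Prop} (hc : IsClosed {f | p f})
    (h : ∀ f : L2, Integrable f volume → p f) (f : L2) : p f := by
  refine DenseRange.induction_on (p := p)
    (SchwartzMap.denseRange_toLpCLM (E := ℝ) (F := ℂ) (μ := volume) (p := 2)
      ENNReal.ofNat_ne_top) f hc fun φ => h _ ?_
  exact φ.integrable.congr (φ.coeFn_toLp 2 volume).symm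

/-- Reflection `f ↦ f(-·)` on `L²`. -/
noncomputable def reflectL2 : L2 →ₗᵢ[ℂ] L2 :=
  Lp.compMeasurePreservingₗᵢ ℂ (fun x : ℝ => -x) (Measure.measurePreserving_neg volume)

/-- Translation as a linear isometry. -/
noncomputable def translateₗᵢ (y : ℝ) : L2 →ₗᵢ[ℂ] L2 :=
  Lp.compMeasurePreservingₗᵢ ℂ (fun x : ℝ => x - y) (measurePreserving_sub_right volume y)

theorem translateₗᵢ_apply (y : ℝ) (f : L2) : translateₗᵢ y f = translateL2 y f := rfl

theorem reflectL2_ae (f : L2) : reflectL2 f =ᵐ[volume] fun x => f (-x) :=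
  Lp.coeFn_compMeasurePreserving f _

theorem translateL2_ae (y : ℝ) (f : L2) : translateL2 y f =ᵐ[volume] fun x => f (x - y) :=
  Lp.coeFn_compMeasurePreserving f _

theorem ae_comp_neg {P : ℝ → Prop} (h : ∀ᵐ x, P x) : ∀ᵐ x : ℝ, P (-x) :=
  (Measure.measurePreserving_neg volume).quasiMeasurePreserving.ae h

theorem ae_comp_sub (y : ℝ) {P : ℝ → Prop} (h : ∀ᵐ x, P x) : ∀ᵐ x : ℝ, P (x - y) :=
  (measurePreserving_sub_right volume y).quasiMeasurePreserving.ae h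

theorem reflectL2_reflectL2 (f : L2) : reflectL2 (reflectL2 f) = f := by
  refine Lp.ext ?_
  filter_upwards [reflectL2_ae (reflectL2 f), ae_comp_neg (reflectL2_ae f)] with x h1 h2
  rw [h1, h2, neg_neg]

theorem reflectL2_translateL2 (y : ℝ) (f : L2) :
    reflectL2 (translateL2 y f) = translateL2 (-y) (reflectL2 f) := by
  refine Lp.ext ?_
  filter_upwards [reflectL2_ae (translateL2 y f), ae_comp_neg (translateL2_ae y f),
    translateL2_ae (-y) (reflectL2 f), ae_comp_sub (-y) (reflectL2_ae f)] with x h1 h2 h3 h4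
  rw [h1, h2, h3, h4]; ring_nf

theorem fourierL2_reflectL2 (f : L2) : fourierL2 (reflectL2 f) = reflectL2 (fourierL2 f) := by
  refine L2.dense_induction (p := fun f => fourierL2 (reflectL2 f) = reflectL2 (fourierL2 f))
    (isClosed_eq (fourierL2.continuous.comp reflectL2.continuous)
      (reflectL2.continuous.comp fourierL2.continuous)) (fun f hf => ?_) f
  have hi : Integrable (reflectL2 f) volume := hf.comp_neg.congr (reflectL2_ae f).symm
  refine Lp.ext ?_
  filter_upwards [fourierL2_ae_eq _ hi, reflectL2_ae (fourierL2 f),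
    ae_comp_neg (fourierL2_ae_eq f hf)] with x h1 h2 h3
  rw [h1, h2, h3, Real.fourier_congr_ae (reflectL2_ae f), Real.fourier_real_eq, Real.fourier_real_eq,
    ← integral_neg_eq_self]
  simp

theorem fourierL2_symm_eq (f : L2) : fourierL2.symm f = fourierL2 (reflectL2 f) := by
  refine Lp.ext (ae_eq_of_schwartz_pairing (L2.locallyIntegrable _) (L2.locallyIntegrable _)
    fun φ => ?_)
  rw [schwartz_pairing_fourierL2, schwartz_pairing_fourierL2_symm,
    ← integral_neg_eq_self]
  refine integral_congr_ae ?_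
  filter_upwards [reflectL2_ae f] with x hx
  rw [hx, Real.fourierInv_eq_fourier_neg, neg_neg]

theorem fourierL2_symm_ae_eq (f : L2) (hf : Integrable f volume) :
    fourierL2.symm f =ᵐ[volume] 𝓕⁻ (f : ℝ → ℂ) := by
  have hi : Integrable (reflectL2 f) volume := hf.comp_neg.congr (reflectL2_ae f).symm
  rw [fourierL2_symm_eq]
  refine (fourierL2_ae_eq _ hi).trans (Eventually.of_forall fun x => ?_)
  rw [Real.fourier_congr_ae (reflectL2_ae f), Real.fourierInv_eq_fourier_comp_neg]

theorem fourierL2_symm_reflectL2 (f : L2) :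
    fourierL2.symm (reflectL2 f) = reflectL2 (fourierL2.symm f) := by
  rw [fourierL2_symm_eq, fourierL2_symm_eq, fourierL2_reflectL2]

theorem fourierL2_translateL2 (y : ℝ) (f : L2) :
    fourierL2 (translateL2 y f) =ᵐ[volume]
      fun x => Complex.exp (-(2 * Real.pi * y * x : ℝ) * Complex.I) * fourierL2 f x := by
  -- Tested against a Schwartz function, both sides become scalar functions of `f` that are
  -- continuous on $L^2$, so the density argument applies. The factor `m` covers the phase and the
  -- constant 1 at once.
  have key : ∀ m : ℝ → ℂ, (∀ x, ‖m x‖ = 1) → Continuous m → 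
      ∀ φ : 𝓢(ℝ, ℂ), Continuous fun f : L2 => ∫ x, φ x * (m x * f x) := by
    intro m hm hmc φ
    have hφ : MemLp (fun x => (starRingEnd ℂ) (φ x * m x)) 2 volume := by
      have h0 : MemLp (fun x => φ x) 2 volume := φ.memLp 2 volume
      refine h0.of_le ?_ (Eventually.of_forall fun x => by simp [hm])
      exact (Complex.continuous_conj.comp (φ.continuous.mul hmc)).aestronglyMeasurable
    have : (fun f : L2 => ∫ x, φ x * (m x * f x)) = fun f : L2 => inner ℂ (hφ.toLp _) f := by
      ext f
      rw [L2.inner_eq]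
      refine integral_congr_ae ?_
      filter_upwards [hφ.coeFn_toLp] with x hx
      rw [hx]; simp; ring
    rw [this]
    exact continuous_const.inner continuous_id
  set m : ℝ → ℂ := fun x => Complex.exp (-(2 * Real.pi * y * x : ℝ) * Complex.I) with hm
  have hm1 : ∀ x, ‖m x‖ = 1 := fun x => by
    rw [hm]; simp only; rw [← Complex.ofReal_neg, Complex.norm_exp_ofReal_mul_I]
  have hmc : Continuous m := by rw [hm]; fun_prop
  have hml : ∀ g : L2, LocallyIntegrable (fun x => m x * g x) volume := fun g => by
    have : MemLp (fun x => m x * g x) 2 volume :=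
      (Lp.memLp g).of_le (hmc.aestronglyMeasurable.mul (Lp.aestronglyMeasurable g))
        (Eventually.of_forall fun x => by simp [hm1])
    exact this.locallyIntegrable (by norm_num)
  refine ae_eq_of_schwartz_pairing (L2.locallyIntegrable _) (hml _) fun φ => ?_
  refine L2.dense_induction (p := fun f => ∫ x, φ x * fourierL2 (translateL2 y f) x =
    ∫ x, φ x * (m x * fourierL2 f x)) (isClosed_eq ?_ ?_) (fun f hf => ?_) f
  · have := (key (fun _ => 1) (by simp) continuous_const φ).comp
      (fourierL2.continuous.comp (translateₗᵢ y).continuous)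
    simpa [Function.comp_def, translateₗᵢ_apply] using! this
  · exact (key m hm1 hmc φ).comp fourierL2.continuous
  · have hi : Integrable (translateL2 y f) volume := (hf.comp_sub_right y).congr
      (translateL2_ae y f).symm
    refine integral_congr_ae ?_
    filter_upwards [fourierL2_ae_eq _ hi, fourierL2_ae_eq f hf] with x h1 h2
    rw [h1, h2, Real.fourier_congr_ae (translateL2_ae y f), Real.fourier_real_eq,
      Real.fourier_real_eq, ← integral_add_right_eq_self (μ := volume) _ y]
    congr 1
    rw [← integral_const_mul]
    refine integral_congr_ae (Eventually.of_forall fun v => ?_)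
    simp only
    rw [add_sub_cancel_right, Circle.smul_def, Circle.smul_def, Real.fourierChar_apply,
      Real.fourierChar_apply, smul_eq_mul, smul_eq_mul, hm, ← mul_assoc, ← Complex.exp_add]
    congr 2
    push_cast
    ring

/-! ### Fourier multipliers on $L^2$ -/

/-- Bounded measurable multipliers. -/
def BddMeas (m : ℝ → ℂ) : Prop := Measurable m ∧ ∃ K : ℝ, ∀ x, ‖m x‖ ≤ K

theorem BddMeas.memLp_mul {m : ℝ → ℂ} (hm : BddMeas m) {f : ℝ → ℂ} {s : ℝ≥0∞}
    (hf : MemLp f s volume) : MemLp (fun x => m x * f x) s volume := by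
  obtain ⟨K, hK⟩ := hm.2
  refine hf.of_le_mul (c := K) (hm.1.aestronglyMeasurable.mul hf.1) (Eventually.of_forall fun x => ?_)
  rw [norm_mul]
  exact mul_le_mul_of_nonneg_right (hK x) (norm_nonneg _)

theorem BddMeas.mul {m n : ℝ → ℂ} (hm : BddMeas m) (hn : BddMeas n) :
    BddMeas fun x => m x * n x := by
  obtain ⟨hm, K, hK⟩ := hm
  obtain ⟨hn, L, hL⟩ := hn
  refine ⟨hm.mul hn, K * L, fun x => ?_⟩
  rw [norm_mul]
  exact mul_le_mul (hK x) (hL x) (norm_nonneg _) ((norm_nonneg _).trans (hK x))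

theorem BddMeas.comp_neg {m : ℝ → ℂ} (hm : BddMeas m) : BddMeas fun x => m (-x) :=
  ⟨hm.1.comp measurable_neg, hm.2.imp fun _ h x => h (-x)⟩

open Classical in
/-- Multiplication by a bounded measurable function on `L²`. -/
noncomputable def mulOp (m : ℝ → ℂ) : L2 →L[ℂ] L2 :=
  if hm : BddMeas m then
    LinearMap.mkContinuousOfExistsBound
      { toFun := fun f => (hm.memLp_mul (Lp.memLp f)).toLp
        map_add' := fun f g => by
          refine Lp.ext ?_
          filter_upwards [(hm.memLp_mul (Lp.memLp (f + g))).coeFn_toLp,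
            (hm.memLp_mul (Lp.memLp f)).coeFn_toLp, (hm.memLp_mul (Lp.memLp g)).coeFn_toLp,
            Lp.coeFn_add f g, Lp.coeFn_add (hm.memLp_mul (Lp.memLp f)).toLp
              (hm.memLp_mul (Lp.memLp g)).toLp] with x h1 h2 h3 h4 h5
          rw [h1, h5, Pi.add_apply, h2, h3, h4, Pi.add_apply, mul_add]
        map_smul' := fun c f => by
          refine Lp.ext ?_
          filter_upwards [(hm.memLp_mul (Lp.memLp (c • f))).coeFn_toLp,
            (hm.memLp_mul (Lp.memLp f)).coeFn_toLp, Lp.coeFn_smul c f,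
            Lp.coeFn_smul c (hm.memLp_mul (Lp.memLp f)).toLp] with x h1 h2 h3 h4
          rw [h1, RingHom.id_apply, h4, Pi.smul_apply, h2, h3, Pi.smul_apply, smul_eq_mul,
            smul_eq_mul]
          ring }
      (by
        obtain ⟨K, hK⟩ := hm.2
        refine ⟨K, fun f => Lp.norm_le_mul_norm_of_ae_le_mul ?_⟩
        filter_upwards [(hm.memLp_mul (Lp.memLp f)).coeFn_toLp] with x hx
        simp only [LinearMap.coe_mk, AddHom.coe_mk]
        rw [hx, norm_mul]
        exact mul_le_mul_of_nonneg_right (hK x) (norm_nonneg _))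
  else 0

theorem mulOp_ae {m : ℝ → ℂ} (hm : BddMeas m) (f : L2) :
    mulOp m f =ᵐ[volume] fun x => m x * f x := by
  rw [mulOp, dif_pos hm]
  exact (hm.memLp_mul (Lp.memLp f)).coeFn_toLp

theorem mulOp_mulOp {m n : ℝ → ℂ} (hm : BddMeas m) (hn : BddMeas n) (f : L2) :
    mulOp m (mulOp n f) = mulOp (fun x => m x * n x) f := by
  refine Lp.ext ?_
  filter_upwards [mulOp_ae hm (mulOp n f), mulOp_ae hn f, mulOp_ae (hm.mul hn) f] with x h1 h2 h3
  rw [h1, h2, h3, mul_assoc]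

theorem norm_mulOp {m : ℝ → ℂ} (hm : Measurable m) (h1 : ∀ x, ‖m x‖ = 1) (f : L2) :
    ‖mulOp m f‖ = ‖f‖ := by
  have hb : BddMeas m := ⟨hm, 1, fun x => (h1 x).le⟩
  have e : ∀ᵐ x, ‖mulOp m f x‖ = ‖f x‖ := by
    filter_upwards [mulOp_ae hb f] with x hx
    rw [hx, norm_mul, h1, one_mul]
  exact le_antisymm (Lp.norm_le_norm_of_ae_le (e.mono fun x hx => hx.le))
    (Lp.norm_le_norm_of_ae_le (e.mono fun x hx => hx.ge))

theorem norm_mulOp_le {m : ℝ → ℂ} (hm : Measurable m) {K : ℝ} (h1 : ∀ x, ‖m x‖ ≤ K) (f : L2) :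
    ‖mulOp m f‖ ≤ K * ‖f‖ := by
  have hb : BddMeas m := ⟨hm, K, h1⟩
  refine Lp.norm_le_mul_norm_of_ae_le_mul ?_
  filter_upwards [mulOp_ae hb f] with x hx
  rw [hx, norm_mul]
  exact mul_le_mul_of_nonneg_right (h1 x) (norm_nonneg _)

theorem reflectL2_mulOp {m : ℝ → ℂ} (hm : BddMeas m) (f : L2) :
    reflectL2 (mulOp m f) = mulOp (fun x => m (-x)) (reflectL2 f) := by
  refine Lp.ext ?_
  filter_upwards [reflectL2_ae (mulOp m f), ae_comp_neg (mulOp_ae hm f), reflectL2_ae f,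
    mulOp_ae hm.comp_neg (reflectL2 f)] with x h1 h2 h3 h4
  rw [h1, h2, h4, h3]

/-- The Fourier multiplier with symbol `m`. -/
noncomputable def fourierMul (m : ℝ → ℂ) : L2 →L[ℂ] L2 :=
  (fourierL2.symm.toContinuousLinearEquiv : L2 →L[ℂ] L2) ∘L mulOp m ∘L
    (fourierL2.toContinuousLinearEquiv : L2 →L[ℂ] L2)

theorem fourierMul_apply (m : ℝ → ℂ) (f : L2) :
    fourierMul m f = fourierL2.symm (mulOp m (fourierL2 f)) := rfl

theorem fourierL2_fourierMul (m : ℝ → ℂ) (f : L2) :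
    fourierL2 (fourierMul m f) = mulOp m (fourierL2 f) := by
  rw [fourierMul_apply, LinearIsometryEquiv.apply_symm_apply]

theorem fourierMul_fourierMul {m n : ℝ → ℂ} (hm : BddMeas m) (hn : BddMeas n) (f : L2) :
    fourierMul m (fourierMul n f) = fourierMul (fun x => m x * n x) f := by
  rw [fourierMul_apply, fourierL2_fourierMul, mulOp_mulOp hm hn, fourierMul_apply]

theorem fourierMul_comm {m n : ℝ → ℂ} (hm : BddMeas m) (hn : BddMeas n) (f : L2) :
    fourierMul m (fourierMul n f) = fourierMul n (fourierMul m f) := by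
  rw [fourierMul_fourierMul hm hn, fourierMul_fourierMul hn hm]
  simp only [mul_comm]

theorem norm_fourierMul {m : ℝ → ℂ} (hm : Measurable m) (h1 : ∀ x, ‖m x‖ = 1) (f : L2) :
    ‖fourierMul m f‖ = ‖f‖ := by
  rw [fourierMul_apply, LinearIsometryEquiv.norm_map, norm_mulOp hm h1,
    LinearIsometryEquiv.norm_map]

theorem norm_fourierMul_le {m : ℝ → ℂ} (hm : Measurable m) {K : ℝ} (h1 : ∀ x, ‖m x‖ ≤ K) (f : L2) :
    ‖fourierMul m f‖ ≤ K * ‖f‖ := by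
  rw [fourierMul_apply, LinearIsometryEquiv.norm_map]
  exact (norm_mulOp_le hm h1 _).trans_eq (by rw [LinearIsometryEquiv.norm_map])

theorem reflectL2_fourierMul {m : ℝ → ℂ} (hm : BddMeas m) (f : L2) :
    reflectL2 (fourierMul m f) = fourierMul (fun x => m (-x)) (reflectL2 f) := by
  rw [fourierMul_apply, fourierMul_apply, ← fourierL2_symm_reflectL2, reflectL2_mulOp hm,
    fourierL2_reflectL2]

/-- The symbol of the translation by `y`. -/
noncomputable def translateSymbol (y x : ℝ) : ℂ :=
  Complex.exp (-(2 * Real.pi * y * x : ℝ) * Complex.I)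

theorem norm_translateSymbol (y x : ℝ) : ‖translateSymbol y x‖ = 1 := by
  rw [translateSymbol, ← Complex.ofReal_neg, Complex.norm_exp_ofReal_mul_I]

theorem bddMeas_translateSymbol (y : ℝ) : BddMeas (translateSymbol y) :=
  ⟨by unfold translateSymbol; fun_prop, 1, fun x => (norm_translateSymbol y x).le⟩

/-- As a multiplier, translation commutes with every other multiplier, and averages of translations
become averages of symbols. -/
theorem translateL2_eq_fourierMul (y : ℝ) (f : L2) :
    translateL2 y f = fourierMul (translateSymbol y) f := by
  apply fourierL2.injective
  rw [fourierL2_fourierMul]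
  exact Lp.ext ((fourierL2_translateL2 y f).trans (mulOp_ae (bddMeas_translateSymbol y) _).symm)

theorem translateL2_fourierMul (y : ℝ) {m : ℝ → ℂ} (hm : BddMeas m) (f : L2) :
    translateL2 y (fourierMul m f) = fourierMul m (translateL2 y f) := by
  rw [translateL2_eq_fourierMul, translateL2_eq_fourierMul,
    fourierMul_comm (bddMeas_translateSymbol y) hm]

/-- A matrix coefficient is the integral of the symbol against a fixed $L^1$ function. Continuity in
a parameter and averaging over one thereby reduce to dominated convergence and Fubini. -/
theorem inner_fourierMul {m : ℝ → ℂ} (hm : BddMeas m) (f g : L2) :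
    inner ℂ f (fourierMul m g) =
      ∫ x, m x * (fourierL2 g x * (starRingEnd ℂ) (fourierL2 f x)) := by
  rw [← fourierL2.inner_map_map, fourierL2_fourierMul, L2.inner_eq]
  refine integral_congr_ae ?_
  filter_upwards [mulOp_ae hm (fourierL2 g)] with x hx
  rw [hx, mul_assoc]

theorem integrable_mul_conj (f g : L2) :
    Integrable (fun x => g x * (starRingEnd ℂ) (f x)) volume := by
  have := MeasureTheory.L2.integrable_inner (𝕜 := ℂ) f g
  exact this

/-! ### The free group and the regularity of its domain -/

/-- The symbol `e^{-2π² i t x²}` of `e^{-itH₀}`. -/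
noncomputable def freeSymbol (t x : ℝ) : ℂ :=
  Complex.exp (-(2 * Real.pi ^ 2 * x ^ 2 * t : ℝ) * Complex.I)

theorem norm_freeSymbol (t x : ℝ) : ‖freeSymbol t x‖ = 1 := by
  rw [freeSymbol, ← Complex.ofReal_neg, Complex.norm_exp_ofReal_mul_I]

theorem measurable_freeSymbol (t : ℝ) : Measurable (freeSymbol t) := by
  unfold freeSymbol; fun_prop

theorem continuous_freeSymbol_time (x : ℝ) : Continuous fun t => freeSymbol t x := by
  unfold freeSymbol; fun_prop

theorem bddMeas_freeSymbol (t : ℝ) : BddMeas (freeSymbol t) :=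
  ⟨measurable_freeSymbol t, 1, fun x => (norm_freeSymbol t x).le⟩

theorem freeSymbol_add (s t x : ℝ) : freeSymbol (s + t) x = freeSymbol s x * freeSymbol t x := by
  rw [freeSymbol, freeSymbol, freeSymbol, ← Complex.exp_add]
  congr 1; push_cast; ring

theorem hasDerivAt_freeSymbol (x : ℝ) :
    HasDerivAt (fun t => freeSymbol t x) (-(2 * Real.pi ^ 2 * x ^ 2 : ℝ) * Complex.I) 0 := by
  have h : HasDerivAt (fun t : ℝ => (-(2 * Real.pi ^ 2 * x ^ 2 : ℝ) * Complex.I) * (t : ℂ))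
      (-(2 * Real.pi ^ 2 * x ^ 2 : ℝ) * Complex.I) 0 := by
    have := (Complex.ofRealCLM.hasDerivAt (x := (0 : ℝ))).const_mul
      (-(2 * Real.pi ^ 2 * x ^ 2 : ℝ) * Complex.I)
    simp only [Complex.ofRealCLM_apply, Complex.ofReal_one, mul_one] at this
    exact this
  have h2 := h.cexp
  simp only [Complex.ofReal_zero, mul_zero, Complex.exp_zero, one_mul] at h2
  refine h2.congr_of_eventuallyEq (Eventually.of_forall fun t => ?_)
  simp only [freeSymbol]
  congr 1; push_cast; ring

/-- The free Schrödinger group. -/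
noncomputable def freeGroup (t : ℝ) : L2 →L[ℂ] L2 := fourierMul (freeSymbol t)

theorem freeGroup_zero (f : L2) : freeGroup 0 f = f := by
  apply fourierL2.injective
  rw [freeGroup, fourierL2_fourierMul]
  refine Lp.ext ?_
  filter_upwards [mulOp_ae (bddMeas_freeSymbol 0) (fourierL2 f)] with x hx
  rw [hx]; simp [freeSymbol]

theorem freeGroup_add (s t : ℝ) (f : L2) : freeGroup (s + t) f = freeGroup s (freeGroup t f) := by
  rw [freeGroup, freeGroup, freeGroup,
    fourierMul_fourierMul (bddMeas_freeSymbol s) (bddMeas_freeSymbol t)]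
  simp only [← freeSymbol_add]

theorem norm_freeGroup (t : ℝ) (f : L2) : ‖freeGroup t f‖ = ‖f‖ :=
  norm_fourierMul (measurable_freeSymbol t) (norm_freeSymbol t) f

theorem inner_freeGroup_freeGroup (t : ℝ) (f g : L2) :
    inner ℂ (freeGroup t f) (freeGroup t g) = inner ℂ f g :=
  (LinearMap.norm_map_iff_inner_map_map (freeGroup t)).1 (norm_freeGroup t) f g

theorem inner_freeGroup_right (t : ℝ) (f g : L2) :
    inner ℂ f (freeGroup t g) = inner ℂ (freeGroup (-t) f) g := by
  rw [← inner_freeGroup_freeGroup t (freeGroup (-t) f), ← freeGroup_add, add_neg_cancel,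
    freeGroup_zero]

/-- Weak continuity comes from dominated convergence for the symbol; since the norm is preserved, it
upgrades to strong continuity. -/
theorem continuous_freeGroup (f : L2) : Continuous fun t => freeGroup t f := by
  have hw : ∀ g : L2, Continuous fun t => inner ℂ g (freeGroup t f) := fun g => by
    simp only [freeGroup, inner_fourierMul (bddMeas_freeSymbol _)]
    refine continuous_of_dominated
      (bound := fun x => ‖fourierL2 f x * (starRingEnd ℂ) (fourierL2 g x)‖) (fun t => ?_)
      (fun t => Eventually.of_forall fun x => ?_) (integrable_mul_conj _ _).norm
      (Eventually.of_forall fun x => ?_)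
    · exact (measurable_freeSymbol t).aestronglyMeasurable.mul (integrable_mul_conj _ _).1
    · rw [norm_mul, norm_freeSymbol, one_mul]
    · exact (continuous_freeSymbol_time x).mul continuous_const
  rw [continuous_iff_continuousAt]
  intro s
  have h1 : ∀ t, ‖freeGroup t f - freeGroup s f‖ ^ 2 =
      2 * ‖f‖ ^ 2 - 2 * RCLike.re (inner ℂ (freeGroup s f) (freeGroup t f)) := fun t => by
    rw [← norm_neg, neg_sub, @norm_sub_sq ℂ, norm_freeGroup, norm_freeGroup]; ring
  have h2 : Tendsto (fun t => ‖freeGroup t f - freeGroup s f‖ ^ 2) (𝓝 s) (𝓝 0) := by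
    simp only [h1]
    have := ((RCLike.continuous_re.comp (hw (freeGroup s f))).tendsto s).const_mul 2 |>.const_sub
      (2 * ‖f‖ ^ 2)
    simp only [Function.comp_apply, inner_self_eq_norm_sq, norm_freeGroup, sub_self] at this
    exact this
  rw [ContinuousAt, tendsto_iff_norm_sub_tendsto_zero]
  have h3 := h2.sqrt
  simpa [Real.sqrt_sq] using h3

theorem freeGroup_reflectL2 (t : ℝ) (f : L2) :
    freeGroup t (reflectL2 f) = reflectL2 (freeGroup t f) := by
  rw [freeGroup, reflectL2_fourierMul (bddMeas_freeSymbol t)]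
  simp only [freeSymbol, neg_sq]
  rfl

theorem freeGroup_translateL2 (t y : ℝ) (f : L2) :
    freeGroup t (translateL2 y f) = translateL2 y (freeGroup t f) :=
  (translateL2_fourierMul y (bddMeas_freeSymbol t) f).symm

theorem freeGroup_fourierMul (t : ℝ) {m : ℝ → ℂ} (hm : BddMeas m) (f : L2) :
    freeGroup t (fourierMul m f) = fourierMul m (freeGroup t f) :=
  fourierMul_comm (bddMeas_freeSymbol t) hm f

/-- The difference quotients converge in $L^2$ on the Fourier side, hence almost everywhere along a
sequence of times, where the limit is the pointwise derivative of the symbol. Only this direction is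
needed; the converse inclusion for the generator comes from symmetry. -/
theorem fourierL2_of_hasDerivAt_freeGroup {f h : L2}
    (hd : HasDerivAt (fun t => freeGroup t f) (-Complex.I • h) 0) :
    fourierL2 h =ᵐ[volume] fun x => (2 * Real.pi ^ 2 * x ^ 2 : ℝ) * fourierL2 f x := by
  have h1 : Tendsto (slope (fun t => freeGroup t f) 0) (𝓝[≠] 0) (𝓝 (-Complex.I • h)) :=
    hasDerivAt_iff_tendsto_slope.1 hd
  have h2 := (fourierL2.continuous.tendsto _).comp h1
  obtain ⟨ns, hns, hae⟩ := (tendstoInMeasure_of_tendsto_Lp h2).exists_seq_tendsto_ae'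
  have h3 : ∀ᵐ x, ∀ i, (fourierL2 (slope (fun t => freeGroup t f) 0 (ns i))) x =
      (ns i)⁻¹ • (freeSymbol (ns i) x - freeSymbol 0 x) * fourierL2 f x := by
    rw [ae_all_iff]
    intro i
    have e : fourierL2 (slope (fun t => freeGroup t f) 0 (ns i)) =
        (((ns i)⁻¹ : ℝ) : ℂ) • (mulOp (freeSymbol (ns i)) (fourierL2 f) - fourierL2 f) := by
      rw [slope, vsub_eq_sub, freeGroup_zero, sub_zero, ← fourierL2_fourierMul, ← map_sub,
        ← map_smul]
      congr 1
    rw [e]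
    filter_upwards [Lp.coeFn_smul (((ns i)⁻¹ : ℝ) : ℂ)
      (mulOp (freeSymbol (ns i)) (fourierL2 f) - fourierL2 f),
      Lp.coeFn_sub (mulOp (freeSymbol (ns i)) (fourierL2 f)) (fourierL2 f),
      mulOp_ae (bddMeas_freeSymbol (ns i)) (fourierL2 f)] with x e1 e2 e3
    rw [e1, Pi.smul_apply, e2, Pi.sub_apply, e3]
    simp [freeSymbol]
    ring
  have h4 : fourierL2 (-Complex.I • h) =ᵐ[volume] fun x => -Complex.I * fourierL2 h x := by
    rw [map_smul]
    exact Lp.coeFn_smul _ _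
  filter_upwards [hae, h3, h4] with x e1 e2 e4
  simp only [Function.comp_apply, e2] at e1
  have e5 := ((hasDerivAt_iff_tendsto_slope.1 (hasDerivAt_freeSymbol x)).comp hns).mul_const
    (fourierL2 f x)
  have e6 : (fun i => (ns i)⁻¹ • (freeSymbol (ns i) x - freeSymbol 0 x) * fourierL2 f x) =
      fun i => (slope (fun t => freeSymbol t x) 0 ∘ ns) i * fourierL2 f x := by
    ext i; simp [slope]
  rw [e6] at e1
  have e7 := tendsto_nhds_unique e1 e5
  rw [e4] at e7
  have e8 : -Complex.I * (fourierL2 h x - (2 * Real.pi ^ 2 * x ^ 2 : ℝ) * fourierL2 f x) = 0 := by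
    rw [mul_sub, e7]; ring
  rcases mul_eq_zero.1 e8 with e | e
  · simp at e
  · exact sub_eq_zero.1 e

/-- By completing the square, $|g|\le(1+x^2)^{-1}+(1+x^2)|g|^2$. -/
theorem integrable_of_memLp_mul_id {g : ℝ → ℂ} (h0 : MemLp g 2 volume)
    (h1 : MemLp (fun x : ℝ => (x : ℂ) * g x) 2 volume) : Integrable g volume := by
  have i0 := h0.integrable_norm_pow (by norm_num)
  have i1 := h1.integrable_norm_pow (by norm_num)
  refine ((integrable_inv_one_add_sq.add i0).add i1).mono' h0.1 (Eventually.of_forall fun x => ?_)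
  simp only [Pi.add_apply, norm_mul, Complex.norm_real, mul_pow, 
    Real.norm_eq_abs, sq_abs]
  have hx : 0 < 1 + x ^ 2 := by positivity
  have e : (1 + x ^ 2)⁻¹ + ‖g x‖ ^ 2 + x ^ 2 * ‖g x‖ ^ 2 - ‖g x‖ =
      ((1 + x ^ 2)⁻¹ - ‖g x‖ / 2) ^ 2 * (1 + x ^ 2) + (3 / 4) * ‖g x‖ ^ 2 * (1 + x ^ 2) := by
    field_simp; ring
  have : 0 ≤ (1 + x ^ 2)⁻¹ + ‖g x‖ ^ 2 + x ^ 2 * ‖g x‖ ^ 2 - ‖g x‖ := by rw [e]; positivity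
  linarith

/-- Moved to the test function, the multiplier $2\pi i x$ is minus the derivative, because the
inverse transform of $\varphi'$ is $-2\pi i x$ times that of $\varphi$. -/
theorem hasWeakDerivOn_of_fourierL2 {f g : L2}
    (h : fourierL2 g =ᵐ[volume] fun x => 2 * Real.pi * Complex.I * x * fourierL2 f x) :
    HasWeakDerivOn Set.univ f g := by
  intro φ h1 h2 _
  have hs : HasCompactSupport (fun x => (φ x : ℂ)) := h2.comp_left (g := fun y : ℝ => (y : ℂ)) rfl
  have hd : ContDiff ℝ ∞ (fun x => (φ x : ℂ)) := Complex.ofRealCLM.contDiff.comp h1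
  set Φ : 𝓢(ℝ, ℂ) := hs.toSchwartzMap hd with hΦ
  have hΦc : ∀ x, Φ x = (φ x : ℂ) := fun x => rfl
  have hderiv : ∀ x, deriv Φ x = ((deriv φ x : ℝ) : ℂ) := fun x => by
    have : HasDerivAt (fun x => (φ x : ℂ)) ((deriv φ x : ℝ) : ℂ) x :=
      ((h1.differentiable (by simp)) x).hasDerivAt.ofReal_comp
    exact this.deriv
  have e1 := schwartz_pairing_fourierL2_symm (fourierL2 f) (SchwartzMap.derivCLM ℂ ℂ Φ)
  have e2 := schwartz_pairing_fourierL2_symm (fourierL2 g) Φ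
  rw [LinearIsometryEquiv.symm_apply_apply] at e1 e2
  have e3 : ∀ x, 𝓕⁻ (SchwartzMap.derivCLM ℂ ℂ Φ : ℝ → ℂ) x =
      -(2 * Real.pi * Complex.I * x) * 𝓕⁻ (Φ : ℝ → ℂ) x := fun x => by
    have : (SchwartzMap.derivCLM ℂ ℂ Φ : ℝ → ℂ) = deriv Φ := by
      ext y; simp
    rw [Real.fourierInv_eq_fourier_neg, this, Real.fourier_deriv Φ.integrable
      Φ.differentiable (by rw [← this]; exact (SchwartzMap.derivCLM ℂ ℂ Φ).integrable)]
    simp only [smul_eq_mul]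
    rw [← Real.fourierInv_eq_fourier_neg]
    push_cast; ring
  simp only [e3] at e1
  have e4 : ∫ x, 𝓕⁻ (Φ : ℝ → ℂ) x * fourierL2 g x =
      -∫ x, -(2 * Real.pi * Complex.I * x) * 𝓕⁻ (Φ : ℝ → ℂ) x * fourierL2 f x := by
    rw [← integral_neg]
    refine integral_congr_ae ?_
    filter_upwards [h] with x hx
    rw [hx]; ring
  rw [e4, ← e1] at e2
  simp only [hΦc, SchwartzMap.derivCLM_apply, hderiv] at e2
  simp only [Complex.real_smul]
  rw [e2, neg_neg]

/-- `w ∈ H²(ℝ)` with `-½ w'' = k`, together with the continuous representatives of `w` and `w'`. -/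
def IsSobolevTwo (w k : L2) (W W₁ : ℝ → ℂ) : Prop :=
  (∀ x, HasDerivAt W (W₁ x) x) ∧ Continuous W₁ ∧ w =ᵐ[volume] W ∧
    ∃ w₁ : L2, w₁ =ᵐ[volume] W₁ ∧ HasWeakDerivOn Set.univ w w₁ ∧
      HasWeakDerivOn Set.univ w₁ (-(2 : ℂ) • k : L2)

theorem hasDerivAt_fourierInv {f : ℝ → ℂ} (hf : Integrable f)
    (hf' : Integrable (fun x : ℝ => (x : ℂ) * f x)) (w : ℝ) :
    HasDerivAt (𝓕⁻ f) (𝓕⁻ (fun x : ℝ => 2 * Real.pi * Complex.I * x * f x) w) w := by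
  have h := (Real.hasDerivAt_fourier hf (by simpa using hf') (-w)).scomp w (hasDerivAt_neg w)
  have e : 𝓕⁻ f = 𝓕 f ∘ Neg.neg := by
    ext x; exact Real.fourierInv_eq_fourier_neg f x
  rw [e]
  refine h.congr_deriv ?_
  rw [Real.fourierInv_eq_fourier_neg, Real.fourier_real_eq, Real.fourier_real_eq, ← integral_smul]
  congr 1
  ext v
  simp only [Circle.smul_def, smul_eq_mul, Complex.real_smul]
  push_cast; ring

theorem continuous_fourierInv {f : ℝ → ℂ} (hf : Integrable f) : Continuous (𝓕⁻ f) := by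
  have e : 𝓕⁻ f = 𝓕 f ∘ Neg.neg := by
    ext x; exact Real.fourierInv_eq_fourier_neg f x
  rw [e]
  exact (VectorFourier.fourierIntegral_continuous Real.continuous_fourierChar
      (by exact continuous_inner) hf).comp continuous_neg

/-- The generator gives $x^2\hat f\in L^2$, so $\hat f$ and $x\hat f$ are integrable. Their inverse
Fourier integrals are the continuous representatives of $f$ and, up to a constant factor, of $f'$.
-/
theorem isSobolevTwo_of_hasDerivAt_freeGroup {f h : L2}
    (hd : HasDerivAt (fun t => freeGroup t f) (-Complex.I • h) 0) :
    ∃ W W₁, IsSobolevTwo f h W W₁ := by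
  have hh := fourierL2_of_hasDerivAt_freeGroup hd
  have m0 : MemLp (fourierL2 f) 2 volume := Lp.memLp _
  have mh : MemLp (fourierL2 h) 2 volume := Lp.memLp _
  have mx : Measurable (fun x : ℝ => (x : ℂ)) := Complex.measurable_ofReal
  have m2 : MemLp (fun x : ℝ => (x : ℂ) * ((x : ℂ) * fourierL2 f x)) 2 volume := by
    refine mh.of_le (mx.aestronglyMeasurable.mul (mx.aestronglyMeasurable.mul m0.1)) ?_
    filter_upwards [hh] with x hx
    have e1 : ‖(x : ℂ) * ((x : ℂ) * fourierL2 f x)‖ = x ^ 2 * ‖fourierL2 f x‖ := by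
      rw [← mul_assoc, norm_mul, ← Complex.ofReal_mul, Complex.norm_real, Real.norm_eq_abs,
        abs_of_nonneg (mul_self_nonneg x), sq]
    have e2 : (0 : ℝ) ≤ 2 * Real.pi ^ 2 - 1 := by nlinarith [Real.pi_gt_three]
    rw [e1, hx, norm_mul, Complex.norm_real, Real.norm_eq_abs, abs_of_nonneg (by positivity)]
    refine mul_le_mul_of_nonneg_right ?_ (norm_nonneg (fourierL2 f x))
    nlinarith [mul_nonneg (sq_nonneg x) e2]
  -- From $|x|\le 1+x^2$.
  have m1 : MemLp (fun x : ℝ => (x : ℂ) * fourierL2 f x) 2 volume := by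
    refine (m0.norm.add m2.norm).of_le (mx.aestronglyMeasurable.mul m0.1)
      (Eventually.of_forall fun x => ?_)
    simp only [norm_mul, Complex.norm_real, Real.norm_eq_abs, Pi.add_apply]
    refine le_trans ?_ (le_abs_self _)
    nlinarith [mul_nonneg (norm_nonneg (fourierL2 f x)) (sq_nonneg (|x| - 1)),
      mul_nonneg (norm_nonneg (fourierL2 f x)) (abs_nonneg x), norm_nonneg (fourierL2 f x)]
  have i0 := integrable_of_memLp_mul_id m0 m1
  have i1 := integrable_of_memLp_mul_id m1 m2
  have mg : MemLp (fun x : ℝ => 2 * Real.pi * Complex.I * x * fourierL2 f x) 2 volume := by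
    simpa [mul_assoc] using m1.const_mul (2 * Real.pi * Complex.I)
  have ig : Integrable (fun x : ℝ => 2 * Real.pi * Complex.I * x * fourierL2 f x) volume := by
    simpa [mul_assoc] using i1.const_mul (2 * Real.pi * Complex.I)
  set w₁ : L2 := fourierL2.symm mg.toLp with hw₁
  have hFw : fourierL2 w₁ =ᵐ[volume] fun x : ℝ => 2 * Real.pi * Complex.I * x * fourierL2 f x := by
    rw [hw₁, LinearIsometryEquiv.apply_symm_apply]
    exact mg.coeFn_toLp
  refine ⟨𝓕⁻ (fourierL2 f : ℝ → ℂ), 𝓕⁻ (fun x : ℝ => 2 * Real.pi * Complex.I * x * fourierL2 f x),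
    fun x => hasDerivAt_fourierInv i0 i1 x, continuous_fourierInv ig, ?_, w₁, ?_,
    hasWeakDerivOn_of_fourierL2 hFw, hasWeakDerivOn_of_fourierL2 ?_⟩
  · have := fourierL2_symm_ae_eq (fourierL2 f) i0
    rwa [LinearIsometryEquiv.symm_apply_apply] at this
  · have := fourierL2_symm_ae_eq (mg.toLp) (ig.congr mg.coeFn_toLp.symm)
    refine this.trans (Eventually.of_forall fun x => ?_)
    rw [Real.fourierInv_eq_fourier_neg, Real.fourierInv_eq_fourier_neg]
    exact Real.fourier_congr_ae mg.coeFn_toLp _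
  · rw [map_smul]
    filter_upwards [Lp.coeFn_smul (-(2 : ℂ)) (fourierL2 h), hh, hFw] with x e1 e2 e3
    rw [e1, Pi.smul_apply, e2, e3]
    simp only [smul_eq_mul]
    push_cast
    linear_combination (-4 * (Real.pi : ℂ) ^ 2 * (x : ℂ) ^ 2 * fourierL2 f x) * Complex.I_sq

/-! ### Weak derivatives and Green's formula on the half-line -/

/-- The product rule for primitives of integrable functions. -/
theorem integral_mul_primitive_add {a b : ℝ} (hab : a ≤ b) {u v : ℝ → ℂ} (U₀ V₀ : ℂ)
    (hu : IntegrableOn u (Set.Ioc a b)) (hv : IntegrableOn v (Set.Ioc a b)) :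
    ∫ x in a..b, (u x * (V₀ + ∫ s in a..x, v s) + (U₀ + ∫ s in a..x, u s) * v x) =
      (U₀ + ∫ s in a..b, u s) * (V₀ + ∫ s in a..b, v s) - U₀ * V₀ := by
  set μ := volume.restrict (Set.Ioc a b) with hμ
  have hu' : Integrable u μ := hu
  have hv' : Integrable v μ := hv
  have conv : ∀ w : ℝ → ℂ, ∀ x ∈ Set.Ioc a b,
      ∫ s in a..x, w s = ∫ s, (if s ≤ x then w s else 0) ∂μ := fun w x hx => by
    rw [intervalIntegral.integral_of_le hx.1.le, hμ, ← integral_indicator measurableSet_Ioc,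
      ← integral_indicator measurableSet_Ioc]
    congr 1
    ext s
    by_cases h1 : s ∈ Set.Ioc a x
    · rw [Set.indicator_of_mem h1, Set.indicator_of_mem (show s ∈ Set.Ioc a b from ⟨h1.1, h1.2.trans hx.2⟩), if_pos h1.2]
    · rw [Set.indicator_of_notMem h1]
      by_cases h2 : s ∈ Set.Ioc a b
      · rw [Set.indicator_of_mem h2, if_neg fun h => h1 ⟨h2.1, h⟩]
      · rw [Set.indicator_of_notMem h2]
  have mle : MeasurableSet {p : ℝ × ℝ | p.2 ≤ p.1} := measurableSet_le measurable_snd measurable_fst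
  have hprod : ∀ w z : ℝ → ℂ, Integrable w μ → Integrable z μ →
      Integrable (Function.uncurry fun x s => if s ≤ x then w x * z s else 0) (μ.prod μ) :=
    fun w z hw hz => by
      have := (hw.mul_prod hz).indicator mle
      refine this.congr (Eventually.of_forall fun p => ?_)
      simp only [Set.indicator, Set.mem_ofPred_eq, Function.uncurry]
  have hcurry : ∀ w z : ℝ → ℂ, ∀ x ∈ Set.Ioc a b, w x * ∫ s in a..x, z s =
      ∫ s, (if s ≤ x then w x * z s else 0) ∂μ := fun w z x hx => by
    rw [conv z x hx, ← integral_const_mul]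
    simp only [mul_ite, mul_zero]
  have hI : ∀ w z : ℝ → ℂ, Integrable w μ → Integrable z μ →
      Integrable (fun x => w x * ∫ s in a..x, z s) μ := fun w z hw hz => by
    refine (hprod w z hw hz).integral_prod_left.congr ?_
    filter_upwards [ae_restrict_mem measurableSet_Ioc] with x hx
    exact (hcurry w z x hx).symm
  -- The product of the two integrals is the integral of $u(x)v(s)$ over the square. The diagonal
  -- cuts it into the two triangles on the left, and the diagonal itself is null.
  have core : (∫ x, u x * (∫ s in a..x, v s) ∂μ) + ∫ x, v x * (∫ s in a..x, u s) ∂μ =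
      (∫ x, u x ∂μ) * ∫ x, v x ∂μ := by
    have e1 : ∫ x, v x * (∫ s in a..x, u s) ∂μ =
        ∫ x, ∫ s, (if x ≤ s then u x * v s else 0) ∂μ ∂μ := by
      rw [integral_integral_swap]
      · refine integral_congr_ae ?_
        filter_upwards [ae_restrict_mem measurableSet_Ioc] with x hx
        rw [hcurry v u x hx]
        simp only [mul_comm]
      · have := (hprod v u hv' hu').swap
        refine this.congr (Eventually.of_forall fun p => ?_)
        simp [Function.uncurry, mul_comm]
    have e2 : ∫ x, u x * (∫ s in a..x, v s) ∂μ =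
        ∫ x, ∫ s, (if s ≤ x then u x * v s else 0) ∂μ ∂μ := by
      refine integral_congr_ae ?_
      filter_upwards [ae_restrict_mem measurableSet_Ioc] with x hx
      exact hcurry u v x hx
    have hp2 : Integrable (Function.uncurry fun x s => if x ≤ s then u x * v s else 0)
        (μ.prod μ) := by
      have := (hprod v u hv' hu').swap
      refine this.congr (Eventually.of_forall fun p => ?_)
      simp [Function.uncurry, mul_comm]
    have j1 : Integrable (fun x => ∫ s, (if s ≤ x then u x * v s else 0) ∂μ) μ :=
      (hprod u v hu' hv').integral_prod_left
    have j2 : Integrable (fun x => ∫ s, (if x ≤ s then u x * v s else 0) ∂μ) μ :=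
      hp2.integral_prod_left
    rw [e1, e2, ← integral_add j1 j2,
      ← integral_mul_const]
    refine integral_congr_ae ?_
    filter_upwards [(hprod u v hu' hv').prod_right_ae, hp2.prod_right_ae] with x i1 i2
    simp only [Function.uncurry] at i1 i2
    rw [← integral_add i1 i2, ← integral_const_mul]
    refine integral_congr_ae ?_
    have hne : ∀ᵐ s ∂μ, s ≠ x := by
      refine ae_restrict_of_ae ?_
      simp [ae_iff]
    filter_upwards [hne] with s hs
    rcases lt_or_gt_of_ne hs with h | h
    · rw [if_pos h.le, if_neg (not_le.2 h), add_zero]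
    · rw [if_neg (not_le.2 h), if_pos h.le, zero_add]
  rw [intervalIntegral.integral_of_le hab, intervalIntegral.integral_of_le hab,
    intervalIntegral.integral_of_le hab]
  have e3 : ∀ x, u x * (V₀ + ∫ s in a..x, v s) + (U₀ + ∫ s in a..x, u s) * v x =
      (u x * V₀ + U₀ * v x) + ((u x * ∫ s in a..x, v s) + v x * ∫ s in a..x, u s) := fun x => by
    ring
  simp only [e3]
  have j1 : Integrable (fun x => u x * V₀ + U₀ * v x) μ := (hu'.mul_const _).add (hv'.const_mul _)
  have j2 : Integrable (fun x => (u x * ∫ s in a..x, v s) + v x * ∫ s in a..x, u s) μ :=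
    (hI u v hu' hv').add (hI v u hv' hu')
  rw [← hμ, integral_add j1 j2, integral_add (hu'.mul_const _) (hv'.const_mul _),
    integral_add (hI u v hu' hv') (hI v u hv' hu'),
    core, integral_mul_const, integral_const_mul]
  ring

/-- Write $\varphi$ as the primitive of $\varphi'$ from a point left of its support and apply the
product rule on an interval containing the support; the boundary terms vanish. -/
theorem integral_deriv_smul_primitive {g : ℝ → ℂ} (hg : LocallyIntegrable g volume) {φ : ℝ → ℝ}
    (h1 : ContDiff ℝ ∞ φ) (h2 : HasCompactSupport φ) :
    ∫ x, deriv φ x • (∫ s in (0 : ℝ)..x, g s) = - ∫ x, φ x • g x := by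
  obtain ⟨R, hR⟩ := h2.isBounded.subset_closedBall (0 : ℝ)
  have hz : ∀ x, R < |x| → φ x = 0 := fun x hx => image_eq_zero_of_notMem_tsupport fun h => by
    have := hR h
    rw [Metric.mem_closedBall, dist_zero_right, Real.norm_eq_abs] at this
    linarith
  set b := |R| + 1 with hb
  have hb0 : 0 < b := by positivity
  have hz' : ∀ x, x ∉ Set.Ioc (-b) b → φ x = 0 ∧ deriv φ x = 0 := fun x hx => by
    have hx' : R < |x| := by
      by_contra! h
      have := abs_le.1 (h.trans (le_abs_self R))
      exact hx ⟨by linarith [this.1], by linarith [this.2]⟩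
    refine ⟨hz x hx', ?_⟩
    have : φ =ᶠ[𝓝 x] fun _ => 0 := by
      filter_upwards [(isOpen_lt continuous_const continuous_abs).mem_nhds hx'] with y hy
      exact hz y hy
    rw [this.deriv_eq]; simp
  have hint : ∀ x y, IntervalIntegrable g volume x y := fun x y =>
    (hg.integrableOn_isCompact isCompact_uIcc).intervalIntegrable
  have hdc : Continuous (deriv φ) := h1.continuous_deriv (by simp)
  have hφ : ∀ x, ((φ x : ℝ) : ℂ) = 0 + ∫ s in (-b)..x, ((deriv φ s : ℝ) : ℂ) := fun x => by
    rw [intervalIntegral.integral_ofReal, intervalIntegral.integral_deriv_eq_sub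
      (fun y _ => (h1.differentiable (by simp)) y) (hdc.intervalIntegrable _ _),
      (hz' (-b) (by simp)).1]
    simp
  have key := integral_mul_primitive_add (a := -b) (b := b) (by linarith)
    (u := fun s => ((deriv φ s : ℝ) : ℂ)) (v := g) 0 (∫ s in (0 : ℝ)..(-b), g s)
    (by exact (intervalIntegrable_iff_integrableOn_Ioc_of_le (by linarith)).1
          ((Complex.continuous_ofReal.comp hdc).intervalIntegrable _ _))
    ((intervalIntegrable_iff_integrableOn_Ioc_of_le (by linarith)).1 (hint _ _))
  simp only [← hφ, intervalIntegral.integral_add_adjacent_intervals (hint _ _) (hint _ _)] at key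
  have hb' : φ b = 0 := hz _ (by rw [abs_of_pos hb0]; linarith [le_abs_self R])
  rw [hb', Complex.ofReal_zero, zero_mul, zero_mul, sub_zero,
    intervalIntegral.integral_of_le (by linarith), integral_add] at key
  · rw [setIntegral_eq_integral_of_forall_compl_eq_zero,
      setIntegral_eq_integral_of_forall_compl_eq_zero] at key
    · simp only [Complex.real_smul]
      exact eq_neg_of_add_eq_zero_left key
    · intro x hx; rw [(hz' x hx).1]; simp
    · intro x hx; rw [(hz' x hx).2]; simp
  · have hc : Continuous fun x => ((deriv φ x : ℝ) : ℂ) * ∫ s in (0 : ℝ)..x, g s :=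
      (Complex.continuous_ofReal.comp hdc).mul (intervalIntegral.continuous_primitive hint 0)
    exact (intervalIntegrable_iff_integrableOn_Ioc_of_le (by linarith)).1
      (hc.intervalIntegrable _ _)
  · have := (hint (-b) b).continuousOn_mul (g := fun x => ((φ x : ℝ) : ℂ))
      (Complex.continuous_ofReal.comp h1.continuous).continuousOn
    exact (intervalIntegrable_iff_integrableOn_Ioc_of_le (by linarith)).1 this

theorem integrable_testFunction_smul {f : ℝ → ℂ} (hf : LocallyIntegrable f volume) {φ : ℝ → ℝ}
    (h1 : Continuous φ) (h2 : HasCompactSupport φ) : Integrable (fun x => φ x • f x) volume :=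
  hf.integrable_smul_left_of_hasCompactSupport h1 h2

/-- A test function of integral zero is the derivative of a test function. -/
theorem exists_testFunction_deriv_eq {I : Set ℝ} (hc : I.OrdConnected) {θ : ℝ → ℝ}
    (h1 : ContDiff ℝ ∞ θ) (h2 : HasCompactSupport θ) (h3 : tsupport θ ⊆ I) (h0 : ∫ x, θ x = 0) :
    ∃ φ : ℝ → ℝ, ContDiff ℝ ∞ φ ∧ HasCompactSupport φ ∧ tsupport φ ⊆ I ∧ deriv φ = θ := by
  rcases (tsupport θ).eq_empty_or_nonempty with he | hne
  · refine ⟨0, contDiff_const, HasCompactSupport.zero, by simp, ?_⟩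
    rw [tsupport_eq_empty_iff] at he
    rw [he]; ext x; simp
  set m := sInf (tsupport θ)
  set M := sSup (tsupport θ)
  have hm : m ∈ tsupport θ := h2.isCompact.sInf_mem hne
  have hM : M ∈ tsupport θ := h2.isCompact.sSup_mem hne
  have hsub : tsupport θ ⊆ Set.Icc m M := fun x hx =>
    ⟨csInf_le h2.isCompact.bddBelow hx, le_csSup h2.isCompact.bddAbove hx⟩
  have hz : ∀ x, x ∉ Set.Icc m M → θ x = 0 := fun x hx =>
    image_eq_zero_of_notMem_tsupport fun h => hx (hsub h)
  set φ : ℝ → ℝ := fun x => ∫ s in m..x, θ s with hφ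
  have hd : ∀ x, HasDerivAt φ (θ x) x := fun x => by
    exact intervalIntegral.integral_hasDerivAt_right (h1.continuous.intervalIntegrable _ _)
      h1.continuous.aestronglyMeasurable.stronglyMeasurableAtFilter h1.continuous.continuousAt
  have hde : deriv φ = θ := funext fun x => (hd x).deriv
  have hsupp : ∀ x, x ∉ Set.Icc m M → φ x = 0 := fun x hx => by
    rcases lt_or_ge x m with hlt | hge
    · simp only [hφ]
      rw [intervalIntegral.integral_symm, intervalIntegral.integral_of_le hlt.le,
        setIntegral_eq_zero_of_forall_eq_zero, neg_zero]
      intro s hs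
      -- The half-open interval contains its right endpoint `m`, the least point of the support;
      -- there $\theta$ vanishes by continuity.
      rcases hs.2.lt_or_eq with h | h
      · exact hz s fun h' => absurd h'.1 (not_le.2 h)
      · have : θ m = 0 := by
          have hcl : IsClosed {y | θ y = 0} := isClosed_eq h1.continuous continuous_const
          have : m ∈ closure (Set.Iio m) := by rw [closure_Iio]; exact Set.mem_Iic.2 le_rfl
          exact (closure_minimal (fun y hy => hz y fun h' => absurd h'.1 (not_le.2 hy)) hcl) this
        rw [h, this]
    · have hxM : M < x := by
        by_contra! h; exact hx ⟨hge, h⟩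
      simp only [hφ]
      rw [intervalIntegral.integral_of_le hge, ← integral_Icc_eq_integral_Ioc,
        setIntegral_eq_integral_of_forall_compl_eq_zero, h0]
      intro y hy
      exact hz y fun h' => hy ⟨h'.1, h'.2.trans hxM.le⟩
  have hts : tsupport φ ⊆ Set.Icc m M :=
    closure_minimal (fun x hx => by by_contra h; exact hx (hsupp x h)) isClosed_Icc
  refine ⟨φ, ?_, isCompact_Icc.of_isClosed_subset (isClosed_tsupport _) hts,
    hts.trans (hc.out (h3 hm) (h3 hM)), hde⟩
  rw [contDiff_infty_iff_deriv, hde]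
  exact ⟨fun x => (hd x).differentiableAt, h1⟩

/-- Du Bois-Reymond: the difference $d$ of $f$ and the primitive of $g$ annihilates derivatives of
test functions. For a fixed bump $\eta$ of integral one, $\theta-(\int\theta)\eta$ is such a
derivative, so $d$ equals the constant $\int\eta d$. -/
theorem HasWeakDerivOn.exists_ae_eq_primitive {Ω I : Set ℝ} {f g : ℝ → ℂ}
    (h : HasWeakDerivOn Ω f g) (hf : LocallyIntegrable f volume) (hg : LocallyIntegrable g volume)
    (hI : IsOpen I) (hc : I.OrdConnected) (hIΩ : I ⊆ Ω) (hne : I.Nonempty) :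
    ∃ c, ∀ᵐ x, x ∈ I → f x = c + ∫ s in (0 : ℝ)..x, g s := by
  have hint : ∀ x y, IntervalIntegrable g volume x y := fun x y =>
    (hg.integrableOn_isCompact isCompact_uIcc).intervalIntegrable
  have hΦ : Continuous fun x => ∫ s in (0 : ℝ)..x, g s := intervalIntegral.continuous_primitive hint 0
  set d : ℝ → ℂ := fun x => f x - ∫ s in (0 : ℝ)..x, g s with hd
  have hdl : LocallyIntegrable d volume := hf.sub hΦ.locallyIntegrable
  have hzero : ∀ φ : ℝ → ℝ, ContDiff ℝ ∞ φ → HasCompactSupport φ → tsupport φ ⊆ I →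
      ∫ x, deriv φ x • d x = 0 := fun φ h1 h2 h3 => by
    have hdc : Continuous (deriv φ) := h1.continuous_deriv (by simp)
    simp only [hd, smul_sub]
    rw [integral_sub (integrable_testFunction_smul hf hdc h2.deriv)
      (integrable_testFunction_smul hΦ.locallyIntegrable hdc h2.deriv),
      h φ h1 h2 (h3.trans hIΩ), integral_deriv_smul_primitive hg h1 h2, sub_self]
  obtain ⟨x₀, hx₀⟩ := hne
  obtain ⟨ε, hε, hball⟩ := Metric.isOpen_iff.1 hI x₀ hx₀
  let B : ContDiffBump x₀ := ⟨ε / 4, ε / 2, by positivity, by linarith⟩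
  set η : ℝ → ℝ := B.normed volume with hη
  have η1 : ContDiff ℝ ∞ η := B.contDiff_normed
  have η2 : HasCompactSupport η := B.hasCompactSupport_normed
  have η3 : tsupport η ⊆ I := by
    rw [hη, B.tsupport_normed_eq]
    exact (Metric.closedBall_subset_ball (by simp only [B]; linarith)).trans hball
  have η0 : ∫ x, η x = 1 := B.integral_normed
  refine ⟨∫ x, η x • d x, ?_⟩
  have hcl : LocallyIntegrable (fun x => d x - ∫ x, η x • d x) volume :=
    hdl.sub (continuous_const).locallyIntegrable
  have := hI.ae_eq_zero_of_integral_contDiff_smul_eq_zero (hcl.locallyIntegrableOn I) ?_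
  · filter_upwards [this] with x hx hxI
    have := hx hxI
    simp only [hd] at this ⊢
    linear_combination this
  intro θ h1 h2 h3
  have i1 := integrable_testFunction_smul hdl h1.continuous h2
  have i2 := integrable_testFunction_smul hdl η1.continuous η2
  have hζ2 : HasCompactSupport fun x => θ x - (∫ y, θ y) * η x := h2.sub (η2.mul_left)
  obtain ⟨φ, p1, p2, p3, p4⟩ := exists_testFunction_deriv_eq hc
    (θ := fun x => θ x - (∫ y, θ y) * η x) (h1.sub (contDiff_const.mul η1)) hζ2
    ((tsupport_sub _ _).trans (Set.union_subset h3 ((tsupport_mul_subset_right).trans η3)))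
    (by
      rw [integral_sub (h1.continuous.integrable_of_hasCompactSupport h2)
        ((η1.continuous.integrable_of_hasCompactSupport η2).const_mul _), integral_const_mul, η0,
        mul_one, sub_self])
  have hk := hzero φ p1 p2 p3
  simp only [p4, sub_smul, mul_smul] at hk
  have i3 : Integrable (fun x => (∫ y, θ y) • η x • d x) volume := by
    exact i2.smul (∫ y, θ y)
  rw [integral_sub i1 i3, integral_smul] at hk
  simp only [smul_sub]
  rw [integral_sub i1 ((h1.continuous.integrable_of_hasCompactSupport h2).smul_const _),
    integral_smul_const]
  exact hk

theorem tendsto_primitive_zero {g : ℝ → ℂ} (hg : LocallyIntegrable g volume) :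
    Tendsto (fun x => ∫ s in (0 : ℝ)..x, g s) (𝓝 0) (𝓝 0) := by
  have hc := intervalIntegral.continuous_primitive (fun x y =>
    (hg.integrableOn_isCompact isCompact_uIcc).intervalIntegrable) 0 (f := g) (μ := volume)
  simpa using hc.tendsto 0

/-- The constant of integration on $x>0$ is the one-sided limit at the origin of the continuous
representative. Left limits are treated by applying this to the reflected function. -/
theorem HasWeakDerivOn.ae_eq_right {f g F : ℝ → ℂ} {a : ℂ} (h : HasWeakDerivOn {0}ᶜ f g)
    (hf : LocallyIntegrable f volume) (hg : LocallyIntegrable g volume)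
    (hF : ContinuousOn F {0}ᶜ) (hfF : f =ᵐ[volume] F) (ha : Tendsto F (𝓝[>] 0) (𝓝 a)) :
    ∀ᵐ x, 0 < x → f x = a + ∫ s in (0 : ℝ)..x, g s := by
  have hsub : Set.Ioi (0 : ℝ) ⊆ {0}ᶜ := fun x hx => ne_of_gt hx
  obtain ⟨c, hc⟩ := h.exists_ae_eq_primitive hf hg isOpen_Ioi Set.ordConnected_Ioi
    hsub ⟨1, Set.mem_Ioi.2 one_pos⟩
  have hcont := intervalIntegral.continuous_primitive (fun x y =>
    (hg.integrableOn_isCompact isCompact_uIcc).intervalIntegrable) 0 (f := g) (μ := volume)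
  have heq : Set.EqOn F (fun x => c + ∫ s in (0 : ℝ)..x, g s) (Set.Ioi 0) := by
    refine Measure.eqOn_open_of_ae_eq (μ := volume) ?_ isOpen_Ioi (hF.mono hsub)
      (continuous_const.add hcont).continuousOn
    rw [Filter.EventuallyEq, ae_restrict_iff' measurableSet_Ioi]
    filter_upwards [hc, hfF] with x h1 h2 hx
    rw [← h2, h1 hx]
  have hlim : Tendsto F (𝓝[>] 0) (𝓝 (c + 0)) :=
    ((tendsto_const_nhds.add (tendsto_primitive_zero hg)).mono_left nhdsWithin_le_nhds).congr'
      (by filter_upwards [self_mem_nhdsWithin] with x hx using (heq hx).symm)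
  rw [add_zero] at hlim
  rwa [tendsto_nhds_unique ha hlim]

theorem HasWeakDerivOn.comp_neg {f g : ℝ → ℂ} (h : HasWeakDerivOn {0}ᶜ f g) :
    HasWeakDerivOn {0}ᶜ (fun x => f (-x)) (fun x => -g (-x)) := by
  intro φ h1 h2 h3
  have hn : ContDiff ℝ ∞ fun x => φ (-x) := h1.comp contDiff_neg
  have hs := h (fun x => φ (-x)) hn (h2.comp_homeomorph (Homeomorph.neg ℝ)) (by
    intro x hx
    have : -x ∈ tsupport φ := tsupport_comp_subset_preimage φ continuous_neg hx
    have := h3 this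
    simpa using this)
  rw [← integral_neg_eq_self, ← integral_neg_eq_self (fun x => φ x • -g (-x))]
  simp only [neg_neg, smul_neg, integral_neg]
  have e : ∀ x, deriv φ (-x) = -deriv (fun x => φ (-x)) x := fun x => by
    rw [deriv_comp_neg, neg_neg]
  simp only [e, neg_smul, integral_neg, hs, neg_neg]

theorem locallyIntegrable_comp_neg {f : ℝ → ℂ} (hf : MemLp f 2 volume) :
    MemLp (fun x => f (-x)) 2 volume :=
  hf.comp_measurePreserving (Measure.measurePreserving_neg volume)

/-- Green's formula on the half-line. -/
theorem green_halfLine {f f₁ f₂ g g₁ g₂ : ℝ → ℂ} {F₀ a G₀ c : ℂ}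
    (hf : MemLp f 2 volume) (hf₁ : MemLp f₁ 2 volume) (hf₂ : MemLp f₂ 2 volume)
    (hg : MemLp g 2 volume) (hg₁ : MemLp g₁ 2 volume) (hg₂ : MemLp g₂ 2 volume)
    (ef : ∀ᵐ x, 0 < x → f x = F₀ + ∫ s in (0 : ℝ)..x, f₁ s)
    (ef₁ : ∀ᵐ x, 0 < x → f₁ x = a + ∫ s in (0 : ℝ)..x, f₂ s)
    (eg : ∀ᵐ x, 0 < x → g x = G₀ + ∫ s in (0 : ℝ)..x, g₁ s)
    (eg₁ : ∀ᵐ x, 0 < x → g₁ x = c + ∫ s in (0 : ℝ)..x, g₂ s) :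
    ∫ x in Set.Ioi 0, (f₂ x * g x - f x * g₂ x) = F₀ * c - a * G₀ := by
  have ii : ∀ {h : ℝ → ℂ}, MemLp h 2 volume → ∀ X : ℝ, IntegrableOn h (Set.Ioc 0 X) volume :=
    fun {h} hh X => ((hh.locallyIntegrable (by norm_num)).integrableOn_isCompact
      (isCompact_Icc (a := 0) (b := X))).mono_set Set.Ioc_subset_Icc_self
  have mi : ∀ {u v : ℝ → ℂ}, MemLp u 2 volume → MemLp v 2 volume →
      Integrable (fun x => u x * v x) volume := fun hu hv => MemLp.integrable_mul hu hv
  have hint : Integrable (fun x => f₂ x * g x - f x * g₂ x) volume :=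
    (mi hf₂ hg).sub (mi hf hg₂)
  -- By the product rule `W` agrees almost everywhere on the half-line with the Wronskian
  -- $f_1g-fg_1$, a sum of products of $L^2$ functions, hence integrable. It also converges at
  -- infinity, so its limit is zero, which is the formula.
  set W : ℝ → ℂ := fun X => a * G₀ - F₀ * c + ∫ x in (0 : ℝ)..X, (f₂ x * g x - f x * g₂ x) with hW
  have hWeq : ∀ᵐ X, 0 < X → W X = f₁ X * g X - f X * g₁ X := by
    filter_upwards [ef, ef₁, eg, eg₁] with X h1 h2 h3 h4 hX
    have k1 := integral_mul_primitive_add hX.le a G₀ (ii hf₂ X) (ii hg₁ X)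
    have k2 := integral_mul_primitive_add hX.le F₀ c (ii hf₁ X) (ii hg₂ X)
    rw [← h1 hX, ← h4 hX, intervalIntegral.integral_of_le hX.le] at k2
    rw [← h2 hX, ← h3 hX, intervalIntegral.integral_of_le hX.le] at k1
    have e1 : ∫ x in Set.Ioc 0 X, (f₂ x * (G₀ + ∫ s in (0 : ℝ)..x, g₁ s) +
        (a + ∫ s in (0 : ℝ)..x, f₂ s) * g₁ x) = ∫ x in Set.Ioc 0 X, (f₂ x * g x + f₁ x * g₁ x) := by
      refine integral_congr_ae ?_
      filter_upwards [ae_restrict_of_ae eg, ae_restrict_of_ae ef₁,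
        ae_restrict_mem measurableSet_Ioc] with x e1 e2 hx
      rw [e1 hx.1, e2 hx.1]
    have e2 : ∫ x in Set.Ioc 0 X, (f₁ x * (c + ∫ s in (0 : ℝ)..x, g₂ s) +
        (F₀ + ∫ s in (0 : ℝ)..x, f₁ s) * g₂ x) = ∫ x in Set.Ioc 0 X, (f₁ x * g₁ x + f x * g₂ x) := by
      refine integral_congr_ae ?_
      filter_upwards [ae_restrict_of_ae eg₁, ae_restrict_of_ae ef,
        ae_restrict_mem measurableSet_Ioc] with x e1 e2 hx
      rw [e1 hx.1, e2 hx.1]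
    rw [e1, integral_add (mi hf₂ hg).integrableOn
      (mi hf₁ hg₁).integrableOn] at k1
    rw [e2, integral_add (mi hf₁ hg₁).integrableOn
      (mi hf hg₂).integrableOn] at k2
    simp only [hW]
    rw [intervalIntegral.integral_of_le hX.le,
      integral_sub (mi hf₂ hg).integrableOn
        (mi hf hg₂).integrableOn]
    linear_combination k1 - k2
  have hlim : Tendsto W atTop (𝓝 (a * G₀ - F₀ * c +
      ∫ x in Set.Ioi 0, (f₂ x * g x - f x * g₂ x))) :=
    tendsto_const_nhds.add
      (intervalIntegral_tendsto_integral_Ioi 0 hint.integrableOn tendsto_id)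
  have hWint : IntegrableOn W (Set.Ioi 0) volume := by
    have : IntegrableOn (fun X => f₁ X * g X - f X * g₁ X) (Set.Ioi 0) volume :=
      ((mi hf₁ hg).sub (mi hf hg₁)).integrableOn
    refine this.congr ?_
    rw [Filter.EventuallyEq, ae_restrict_iff' measurableSet_Ioi]
    filter_upwards [hWeq] with x h1 hx
    exact (h1 hx).symm
  have hat : IntegrableAtFilter W atTop volume := ⟨Set.Ioi 0, Ioi_mem_atTop 0, hWint⟩
  have h0 := hat.eq_zero_of_tendsto (fun s hs => ?_) hlim
  · linear_combination h0
  · obtain ⟨b, hb⟩ := mem_atTop_sets.1 hs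
    rw [← top_le_iff, ← Real.volume_Ici (a := b)]
    exact measure_mono fun x hx => hb x hx

theorem conj_add_primitive {F₀ : ℂ} {g : ℝ → ℂ} (x : ℝ) :
    (starRingEnd ℂ) (F₀ + ∫ s in (0 : ℝ)..x, g s) =
      (starRingEnd ℂ) F₀ + ∫ s in (0 : ℝ)..x, (starRingEnd ℂ) (g s) := by
  rw [map_add, intervalIntegral, intervalIntegral, map_sub, integral_conj, integral_conj]

theorem MemLp.conj {f : ℝ → ℂ} (hf : MemLp f 2 volume) :
    MemLp (fun x => (starRingEnd ℂ) (f x)) 2 volume :=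
  hf.of_le (Complex.continuous_conj.comp_aestronglyMeasurable hf.1)
    (Eventually.of_forall fun x => by simp)

theorem tendsto_comp_neg_right {F : ℝ → ℂ} {b : ℂ} (h : Tendsto F (𝓝[<] 0) (𝓝 b)) :
    Tendsto (fun x => F (-x)) (𝓝[>] 0) (𝓝 b) := by
  refine h.comp ?_
  have := tendsto_neg_nhdsGT (a := (0 : ℝ))
  simpa using this

/-- Green's formula on both half-lines leaves the boundary terms
$F(0)\,\overline{[g']}-[f']\,\overline{G(0)}$, where the bracket is the jump at the origin. The jump
conditions with the same real $q$ make them cancel. -/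
theorem DeltaHamiltonian.symmetric {q : ℝ} {f h g k : L2} (hf : DeltaHamiltonian q f h)
    (hg : DeltaHamiltonian q g k) : inner ℂ h g = inner ℂ f k := by
  obtain ⟨F, F₁, f₁, f₂, a, b, ⟨Fc, fF⟩, wf, wf₁, ⟨F₁c, fF₁⟩, ⟨fa, fb⟩, fj, rfl⟩ := hf
  obtain ⟨G, G₁, g₁, g₂, c, d, ⟨Gc, gG⟩, wg, wg₁, ⟨G₁c, gG₁⟩, ⟨gc, gd⟩, gj, rfl⟩ := hg
  have L : ∀ u : L2, MemLp u 2 volume := fun u => Lp.memLp u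
  have li : ∀ {u : ℝ → ℂ}, MemLp u 2 volume → LocallyIntegrable u volume := fun hu =>
    hu.locallyIntegrable (by norm_num)
  have N : ∀ u : L2, MemLp (fun x => u (-x)) 2 volume := fun u => locallyIntegrable_comp_neg (L u)
  have NN : ∀ u : L2, MemLp (fun x => -u (-x)) 2 volume := fun u => (N u).neg
  have cn : ∀ {H : ℝ → ℂ}, ContinuousOn H {0}ᶜ → ContinuousOn (fun x => H (-x)) {0}ᶜ := fun hH =>
    hH.comp continuous_neg.continuousOn fun x hx => by simpa using hx
  have tz : ∀ {H : ℝ → ℂ}, Continuous H → Tendsto H (𝓝[>] 0) (𝓝 (H 0)) := fun hH =>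
    (hH.tendsto 0).mono_left nhdsWithin_le_nhds
  have tz' : ∀ {H : ℝ → ℂ}, Continuous H → Tendsto (fun x => H (-x)) (𝓝[>] 0) (𝓝 (H 0)) :=
    fun {H} hH => by simpa [Function.comp_def] using tz (hH.comp continuous_neg)
  have conjr : ∀ {u v : ℝ → ℂ} {e : ℂ}, (∀ᵐ x, 0 < x → u x = e + ∫ s in (0 : ℝ)..x, v s) →
      ∀ᵐ x, 0 < x → (starRingEnd ℂ) (u x) = (starRingEnd ℂ) e +
        ∫ s in (0 : ℝ)..x, (starRingEnd ℂ) (v s) := fun h => by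
    filter_upwards [h] with x hx h0
    rw [hx h0, conj_add_primitive]
  have r1 := green_halfLine (L f) (L f₁) (L f₂) (MemLp.conj (L g)) (MemLp.conj (L g₁))
    (MemLp.conj (L g₂))
    (wf.ae_eq_right (li (L f)) (li (L f₁)) Fc.continuousOn fF (tz Fc))
    (wf₁.ae_eq_right (li (L f₁)) (li (L f₂)) F₁c fF₁ fa)
    (conjr (wg.ae_eq_right (li (L g)) (li (L g₁)) Gc.continuousOn gG (tz Gc)))
    (conjr (wg₁.ae_eq_right (li (L g₁)) (li (L g₂)) G₁c gG₁ gc))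
  have neg_weak : ∀ {u v : ℝ → ℂ}, HasWeakDerivOn {0}ᶜ u v →
      HasWeakDerivOn {0}ᶜ (fun x => -u (-x)) (fun x => v (-x)) := fun {u v} hw φ h1 h2 h3 => by
    have := hw.comp_neg φ h1 h2 h3
    simp only [smul_neg, integral_neg, neg_neg] at this ⊢
    rw [this]
  -- The negative half-line after reflection: the first derivative changes sign, so its boundary
  -- value at the origin is `-b`, respectively `-d`, and the second derivative does not.
  have r2 := green_halfLine (N f) (NN f₁) (N f₂) (MemLp.conj (N g)) (MemLp.conj (NN g₁))
    (MemLp.conj (N g₂))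
    (wf.comp_neg.ae_eq_right (li (N f)) (li (NN f₁)) (cn Fc.continuousOn) (ae_comp_neg fF) (tz' Fc))
    ((neg_weak wf₁).ae_eq_right (li (NN f₁)) (li (N f₂)) (cn F₁c).neg
      ((ae_comp_neg fF₁).mono fun x hx => congrArg Neg.neg hx) (tendsto_comp_neg_right fb).neg)
    (conjr (wg.comp_neg.ae_eq_right (li (N g)) (li (NN g₁)) (cn Gc.continuousOn) (ae_comp_neg gG)
      (tz' Gc)))
    (conjr ((neg_weak wg₁).ae_eq_right (li (NN g₁)) (li (N g₂)) (cn G₁c).neg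
      ((ae_comp_neg gG₁).mono fun x hx => congrArg Neg.neg hx) (tendsto_comp_neg_right gd).neg))
  have hint : Integrable (fun x => f₂ x * (starRingEnd ℂ) (g x) - f x * (starRingEnd ℂ) (g₂ x))
      volume := (integrable_mul_conj g f₂).sub (integrable_mul_conj g₂ f)
  have e1 : ∫ x, (f₂ x * (starRingEnd ℂ) (g x) - f x * (starRingEnd ℂ) (g₂ x)) = 0 := by
    rw [← intervalIntegral.integral_Iic_add_Ioi (b := 0) hint.integrableOn hint.integrableOn, r1,
      ← neg_zero, ← integral_comp_neg_Ioi (0 : ℝ) (f := fun x => f₂ x * (starRingEnd ℂ) (g x) -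
        f x * (starRingEnd ℂ) (g₂ x)), r2]
    have gj' := congrArg (starRingEnd ℂ) gj
    simp only [map_sub, map_mul, Complex.conj_ofReal, map_ofNat] at gj'
    simp only [map_neg, neg_zero]
    linear_combination F 0 * gj' - (starRingEnd ℂ) (G 0) * fj
  rw [integral_sub (integrable_mul_conj g f₂) (integrable_mul_conj g₂ f)] at e1
  have e2 : inner ℂ g f₂ = inner ℂ g₂ f := by
    rw [L2.inner_eq, L2.inner_eq]
    exact sub_eq_zero.1 e1
  rw [inner_smul_left, inner_smul_right, ← inner_conj_symm f₂ g, e2, inner_conj_symm]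
  simp only [map_neg, map_div₀, map_one, map_ofNat]

/-! ### Identification of generators; the free group -/

namespace IsUnitaryGroupOf

/-- A unitary group whose generator is contained in `-iA` for a symmetric operator `A` is
generated by `-iA`. -/
theorem of_symmetric {A : L2 → L2 → Prop} {S : ℝ → L2 →L[ℂ] L2} (zero : ∀ f, S 0 f = f)
    (add : ∀ s t f, S (s + t) f = S s (S t f)) (norm_map : ∀ t f, ‖S t f‖ = ‖f‖)
    (cont : ∀ f, Continuous fun t => S t f)
    (gen : ∀ f h, HasDerivAt (fun t => S t f) (-Complex.I • h) 0 → A f h)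
    (symm : ∀ f h g k, A f h → A g k → inner ℂ h g = inner ℂ f k) :
    IsUnitaryGroupOf A S := by
  have hB : IsUnitaryGroupOf (fun f h => HasDerivAt (fun t => S t f) (-Complex.I • h) 0) S :=
    ⟨zero, add, norm_map, cont, fun _ _ => Iff.rfl⟩
  refine ⟨zero, add, norm_map, cont, fun f h => ⟨fun hA => ?_, gen f h⟩⟩
  -- For `f` in the domain of `A`, it suffices that $S_tf=f+Y(t)$, since the right side is
  -- differentiable with the correct derivative. Paired with `g` in the dense domain of the
  -- generator, the difference has derivative zero: there the derivative falls on $S_{-t}g$, and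
  -- symmetry of `A` moves the operator to `f`.
  set Y : ℝ → L2 := fun t => ∫ s in (0 : ℝ)..t, S s (-Complex.I • h) with hY
  have hYd : ∀ t, HasDerivAt Y (S t (-Complex.I • h)) t := fun t =>
    intervalIntegral.integral_hasDerivAt_right ((cont _).intervalIntegrable _ _)
      (cont _).aestronglyMeasurable.stronglyMeasurableAtFilter (cont _).continuousAt
  have adj : ∀ t u v, inner ℂ u (S t v) = inner ℂ (S (-t) u) v := fun t u v => by
    rw [← hB.inner_map t (S (-t) u) v, ← add, add_neg_cancel, zero]
  have key : ∀ t, S t f = f + Y t := fun t => by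
    refine hB.dense_domain.eq_of_inner_right (𝕜 := ℂ) ?_
    rintro g ⟨k, hg⟩
    have hd : ∀ t, HasDerivAt (fun t => inner ℂ g (S t f) - inner ℂ g (Y t)) 0 t := fun t => by
      have h1 : HasDerivAt (fun s => S (-s) g) (Complex.I • S (-t) k) t := by
        have := (hB.hasDerivAt hg (-t)).scomp t (hasDerivAt_neg t)
        simpa [Function.comp_def] using this
      have h2 := HasDerivAt.inner ℂ h1 (hasDerivAt_const t f)
      have h3 := HasDerivAt.inner ℂ (hasDerivAt_const t g) (hYd t)
      have h4 := h2.sub h3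
      have e : ∀ s, inner ℂ g (S s f) = inner ℂ (S (-s) g) f := fun s => adj s g f
      simp only [e]
      refine h4.congr_deriv ?_
      have h5 := symm _ _ _ _ (gen _ _ (hB.map_graph hg (-t))) hA
      simp only [inner_zero_right, inner_zero_left, zero_add, add_zero]
      rw [inner_smul_left, h5, map_smul, inner_smul_right, adj, Complex.conj_I, sub_self]
    have := is_const_of_deriv_eq_zero (fun t => (hd t).differentiableAt) (fun t => (hd t).deriv) t 0
    simp only [zero] at this
    have hY0 : Y 0 = 0 := by simp [hY]
    rw [hY0, inner_zero_right, sub_zero] at this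
    rw [inner_add_right]
    linear_combination this
  have : (fun t => S t f) = fun t => f + Y t := funext key
  rw [this]
  have h0 := (hYd 0).const_add f
  rwa [zero] at h0

end IsUnitaryGroupOf

theorem HasWeakDerivOn.mono {Ω Ω' : Set ℝ} {f g : ℝ → ℂ} (h : HasWeakDerivOn Ω f g)
    (hs : Ω' ⊆ Ω) : HasWeakDerivOn Ω' f g :=
  fun φ h1 h2 h3 => h φ h1 h2 (h3.trans hs)

/-- A function in $H^2(\mathbb R)$ has no jump in its derivative, so it satisfies the point
condition when $q=0$ or when it vanishes at the origin; the two cases serve the free group and the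
odd part. -/
theorem IsSobolevTwo.deltaHamiltonian {q : ℝ} {w k : L2} {W W₁ : ℝ → ℂ}
    (h : IsSobolevTwo w k W W₁) (hq : q * W 0 = 0) : DeltaHamiltonian q w k := by
  obtain ⟨hd, hc, hw, w₁, e₁, d1, d2⟩ := h
  have ht : Tendsto W₁ (𝓝 0) (𝓝 (W₁ 0)) := hc.tendsto 0
  refine ⟨W, W₁, w₁, -(2 : ℂ) • k, W₁ 0, W₁ 0,
    ⟨continuous_iff_continuousAt.2 fun x => (hd x).continuousAt, hw⟩,
    d1.mono (Set.subset_univ _), d2.mono (Set.subset_univ _), ⟨hc.continuousOn, e₁⟩,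
    ⟨ht.mono_left nhdsWithin_le_nhds, ht.mono_left nhdsWithin_le_nhds⟩, ?_, ?_⟩
  · linear_combination -2 * hq
  · rw [smul_smul]; norm_num

theorem isUnitaryGroupOf_freeGroup : IsUnitaryGroupOf (DeltaHamiltonian 0) freeGroup :=
  IsUnitaryGroupOf.of_symmetric freeGroup_zero freeGroup_add norm_freeGroup continuous_freeGroup
    (fun f h hd => by
      obtain ⟨W, W₁, hW⟩ := isSobolevTwo_of_hasDerivAt_freeGroup hd
      exact hW.deltaHamiltonian (by simp))
    (fun f h g k hf hg => hf.symmetric hg)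

theorem IsUnitaryGroupOf.deltaGroup_eq {q : ℝ} {S : ℝ → L2 →L[ℂ] L2}
    (hS : IsUnitaryGroupOf (DeltaHamiltonian q) S) : deltaGroup q = S := by
  have h : ∃ S, IsUnitaryGroupOf (DeltaHamiltonian q) S := ⟨S, hS⟩
  rw [deltaGroup, dif_pos h]
  exact h.choose_spec.unique hS

theorem deltaGroup_zero_eq : deltaGroup 0 = freeGroup := isUnitaryGroupOf_freeGroup.deltaGroup_eq

/-! ### Convolution with the exponential density -/

/-- The exponential probability density with rate `q`. -/
noncomputable def expDensity (q u : ℝ) : ℝ := if 0 < u then q * Real.exp (-q * u) else 0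

theorem expDensity_eq_indicator (q : ℝ) :
    expDensity q = (Set.Ioi 0).indicator fun u => q * Real.exp (-q * u) := by
  ext u; simp [expDensity, Set.indicator]

theorem measurable_expDensity (q : ℝ) : Measurable (expDensity q) := by
  rw [expDensity_eq_indicator]
  exact Measurable.indicator (by fun_prop) measurableSet_Ioi

theorem expDensity_nonneg {q : ℝ} (hq : 0 < q) (u : ℝ) : 0 ≤ expDensity q u := by
  unfold expDensity; split_ifs <;> positivity

theorem expDensity_le {q : ℝ} (hq : 0 < q) (u : ℝ) : expDensity q u ≤ q := by
  unfold expDensity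
  split_ifs with h
  · exact mul_le_of_le_one_right hq.le (Real.exp_le_one_iff.2 (by nlinarith))
  · exact hq.le

theorem integrable_expDensity {q : ℝ} (hq : 0 < q) : Integrable (expDensity q) volume := by
  rw [expDensity_eq_indicator, integrable_indicator_iff measurableSet_Ioi]
  exact (integrableOn_exp_mul_Ioi (by linarith) 0).const_mul q

theorem integral_expDensity {q : ℝ} (hq : 0 < q) : ∫ u, expDensity q u = 1 := by
  rw [expDensity_eq_indicator, integral_indicator measurableSet_Ioi, integral_const_mul,
    integral_exp_mul_Ioi (by linarith)]
  field_simp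
  simp

theorem memLp_expDensity {q : ℝ} (hq : 0 < q) :
    MemLp (fun u => (expDensity q u : ℂ)) 2 volume := by
  have hm : Measurable fun u => (expDensity q u : ℂ) :=
    Complex.measurable_ofReal.comp (measurable_expDensity q)
  rw [memLp_two_iff_integrable_sq_norm hm.aestronglyMeasurable]
  refine ((integrable_expDensity hq).const_mul q).mono'
    (hm.norm.pow_const 2).aestronglyMeasurable
    (Eventually.of_forall fun u => ?_)
  rw [Complex.norm_real, norm_pow, norm_norm, Real.norm_of_nonneg (expDensity_nonneg hq u), sq]
  exact mul_le_mul_of_nonneg_right (expDensity_le hq u) (expDensity_nonneg hq u)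

/-- The Fourier transform of the exponential density. -/
noncomputable def causalSymbol (q x : ℝ) : ℂ := q / (q + 2 * Real.pi * x * Complex.I)

theorem causalSymbol_den_ne {q : ℝ} (hq : 0 < q) (x : ℝ) :
    (q + 2 * Real.pi * x * Complex.I : ℂ) ≠ 0 := fun h => by
  have := congrArg Complex.re h
  simp at this
  linarith

theorem bddMeas_causalSymbol {q : ℝ} (hq : 0 < q) : BddMeas (causalSymbol q) := by
  refine ⟨by unfold causalSymbol; fun_prop, 1, fun x => ?_⟩
  rw [causalSymbol, norm_div, div_le_one (norm_pos_iff.2 (causalSymbol_den_ne hq x))]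
  refine le_trans ?_ (Complex.abs_re_le_norm _)
  simp

theorem integral_expDensity_mul_translateSymbol {q : ℝ} (hq : 0 < q) (x : ℝ) :
    ∫ u, (expDensity q u : ℂ) * translateSymbol u x = causalSymbol q x := by
  have e : (fun u => (expDensity q u : ℂ) * translateSymbol u x) =
      (Set.Ioi 0).indicator fun u : ℝ =>
        (q : ℂ) * Complex.exp (-(q + 2 * Real.pi * x * Complex.I) * u) := by
    ext u
    by_cases h : 0 < u
    · rw [Set.indicator_of_mem (Set.mem_Ioi.2 h), expDensity, if_pos h, translateSymbol]
      push_cast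
      rw [mul_assoc, ← Complex.exp_add]
      congr 2; ring
    · rw [Set.indicator_of_notMem (by simpa using h), expDensity, if_neg h]; simp
  have hre : (-(q + 2 * Real.pi * x * Complex.I) : ℂ).re < 0 := by simpa using hq
  rw [e, integral_indicator measurableSet_Ioi, integral_const_mul,
    integral_exp_mul_complex_Ioi hre, causalSymbol]
  have := causalSymbol_den_ne hq x
  simp only [Complex.ofReal_zero, mul_zero, Complex.exp_zero]
  rw [div_neg, neg_div, neg_neg]
  field_simp

/-- The convolution with the exponential density on `L²`, which is `q (q + ∂ₓ)⁻¹`. -/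
noncomputable def causalOp (q : ℝ) : L2 →L[ℂ] L2 := fourierMul (causalSymbol q)

/-- The operator is an average of translations, in weak form, because its symbol is the average of
their symbols. By duality this also makes it a contraction on $L^r$. -/
theorem inner_causalOp {q : ℝ} (hq : 0 < q) (f g : L2) :
    inner ℂ f (causalOp q g) = ∫ u, (expDensity q u : ℂ) * inner ℂ f (translateL2 u g) := by
  rw [causalOp, inner_fourierMul (bddMeas_causalSymbol hq)]
  simp only [translateL2_eq_fourierMul, inner_fourierMul (bddMeas_translateSymbol _)]
  simp only [← integral_expDensity_mul_translateSymbol hq, ← integral_mul_const,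
    ← integral_const_mul]
  rw [integral_integral_swap]
  · simp only [mul_assoc]
  have hk : Integrable (fun u => (expDensity q u : ℂ)) volume := (integrable_expDensity hq).ofReal
  have h := (integrable_mul_conj (fourierL2 f) (fourierL2 g)).mul_prod hk
  refine h.mono ?_ (Eventually.of_forall fun p => ?_)
  · refine AEStronglyMeasurable.mul ?_ (integrable_mul_conj _ _).1.comp_fst
    refine Measurable.aestronglyMeasurable ?_
    refine (Complex.measurable_ofReal.comp ((measurable_expDensity q).comp measurable_snd)).mul ?_
    unfold translateSymbol; fun_prop
  · simp only [Function.uncurry, norm_mul, norm_translateSymbol]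
    simp [mul_comm]

theorem integrable_expDensity_mul {q : ℝ} (hq : 0 < q) {f g : ℝ → ℂ} (hf : MemLp f 2 volume)
    (hg : MemLp g 2 volume) :
    Integrable (fun p : ℝ × ℝ => (expDensity q p.2 : ℂ) * (f p.1 * g (p.1 - p.2)))
      (volume.prod volume) := by
  have hk : Integrable (fun u => (expDensity q u : ℝ)) volume := integrable_expDensity hq
  have h1 := ((memLp_two_iff_integrable_sq_norm hf.1).1 hf).mul_prod hk
  have h2 := hk.convolution_integrand (ContinuousLinearMap.mul ℝ ℝ)
    ((memLp_two_iff_integrable_sq_norm hg.1).1 hg)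
  refine (h1.add h2).mono' ?_ (Eventually.of_forall fun p => ?_)
  · refine (Complex.measurable_ofReal.comp
      ((measurable_expDensity q).comp measurable_snd)).aestronglyMeasurable.mul
      (hf.1.comp_fst.mul ?_)
    exact hg.1.comp_quasiMeasurePreserving
      (quasiMeasurePreserving_sub_of_right_invariant volume volume)
  · simp only [norm_mul, Complex.norm_real, Pi.add_apply, ContinuousLinearMap.mul_apply',
      Real.norm_of_nonneg (expDensity_nonneg hq _)]
    nlinarith [expDensity_nonneg hq p.2, mul_nonneg (expDensity_nonneg hq p.2)
      (sq_nonneg (‖f p.1‖ - ‖g (p.1 - p.2)‖)), mul_nonneg (expDensity_nonneg hq p.2)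
      (sq_nonneg (‖f p.1‖)), mul_nonneg (expDensity_nonneg hq p.2)
      (sq_nonneg (‖g (p.1 - p.2)‖))]

/-- The pointwise value of the convolution with the exponential density. -/
noncomputable def causalInt (q : ℝ) (g : ℝ → ℂ) (x : ℝ) : ℂ :=
  ∫ u, (expDensity q u : ℂ) * g (x - u)

theorem memLp_comp_sub_left {g : ℝ → ℂ} (hg : MemLp g 2 volume) (x : ℝ) :
    MemLp (fun u => g (x - u)) 2 volume :=
  hg.comp_measurePreserving (Measure.measurePreserving_sub_left volume x)

/-- This form displays the dependence on $(-\infty,x]$ alone, the continuity in $x$, and the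
differential equation with integrating factor $e^{qx}$. -/
theorem causalInt_eq (q : ℝ) (g : ℝ → ℂ) (x : ℝ) : causalInt q g x =
    q * Complex.exp (-q * x) * ∫ s in Set.Iic x, Complex.exp (q * s) * g s := by
  rw [causalInt, ← integral_sub_left_eq_self _ volume x, ← integral_const_mul,
    integral_Iic_eq_integral_Iio, ← integral_indicator measurableSet_Iio]
  congr 1
  ext s
  simp only [sub_sub_cancel]
  by_cases h : s < x
  · rw [Set.indicator_of_mem (Set.mem_Iio.2 h), expDensity, if_pos (by linarith)]
    push_cast
    rw [mul_assoc (q : ℂ), mul_assoc (q : ℂ), ← mul_assoc (Complex.exp _), ← Complex.exp_add]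
    congr 3; ring
  · rw [Set.indicator_of_notMem (by simpa using h), expDensity, if_neg (by linarith)]
    simp

/-- Cauchy–Schwarz, the density being in $L^2$. This $L^2\to L^\infty$ gain is the smoothing that
later replaces admissibility. -/
theorem norm_causalInt_le {q : ℝ} (hq : 0 < q) (g : L2) (x : ℝ) :
    ‖causalInt q g x‖ ≤ ‖(memLp_expDensity hq).toLp‖ * ‖g‖ := by
  set k : L2 := (memLp_expDensity hq).toLp with hk
  set gx : L2 := (memLp_comp_sub_left (Lp.memLp g) x).toLp with hgx
  have e : causalInt q g x = inner ℂ k gx := by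
    rw [L2.inner_eq, causalInt]
    refine integral_congr_ae ?_
    filter_upwards [(memLp_expDensity hq).coeFn_toLp,
      (memLp_comp_sub_left (Lp.memLp g) x).coeFn_toLp] with u h1 h2
    rw [h1, h2, Complex.conj_ofReal, mul_comm]
  have e2 : ‖gx‖ = ‖g‖ := by
    rw [hgx, Lp.norm_toLp, Lp.norm_def]
    congr 1
    exact eLpNorm_comp_measurePreserving (Lp.aestronglyMeasurable g)
      (Measure.measurePreserving_sub_left volume x)
  rw [e, ← e2]
  exact norm_inner_le_norm _ _

theorem integrableOn_exp_mul_Iic_of_memLp {q : ℝ} (hq : 0 < q) {g : ℝ → ℂ} (hg : MemLp g 2 volume)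
    (x : ℝ) : IntegrableOn (fun s : ℝ => Complex.exp (q * s) * g s) (Set.Iic x) volume := by
  have h1 : MemLp (fun s : ℝ => Complex.exp (q * s)) 2 (volume.restrict (Set.Iic x)) := by
    rw [memLp_two_iff_integrable_sq_norm (by fun_prop)]
    have := integrableOn_exp_mul_Iic (a := 2 * q) (by linarith) x
    refine this.congr (Eventually.of_forall fun s => ?_)
    simp only [Complex.norm_exp]
    rw [← Real.exp_nat_mul]
    congr 1
    simp
    ring
  exact MemLp.integrable_mul h1 (hg.restrict (Set.Iic x))

theorem continuous_causalInt {q : ℝ} (hq : 0 < q) {g : ℝ → ℂ} (hg : MemLp g 2 volume) :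
    Continuous (causalInt q g) := by
  have e : causalInt q g = fun x : ℝ => q * Complex.exp (-q * x) *
      ((∫ s in Set.Iic (0 : ℝ), Complex.exp (q * s) * g s) +
        ∫ s in (0 : ℝ)..x, Complex.exp (q * s) * g s) := by
    ext x
    rw [causalInt_eq, ← intervalIntegral.integral_Iic_sub_Iic
      (integrableOn_exp_mul_Iic_of_memLp hq hg 0) (integrableOn_exp_mul_Iic_of_memLp hq hg x)]
    ring
  rw [e]
  have hc : Continuous fun x => ∫ s in (0 : ℝ)..x, Complex.exp (q * s) * g s := by
    refine intervalIntegral.continuous_primitive (fun a b => ?_) 0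
    have hb := (integrableOn_exp_mul_Iic_of_memLp hq hg (max a b)).mono_set
      (show Set.uIcc a b ⊆ Set.Iic (max a b) from fun y hy => hy.2)
    exact hb.intervalIntegrable
  fun_prop

theorem causalOp_ae {q : ℝ} (hq : 0 < q) (g : L2) : causalOp q g =ᵐ[volume] causalInt q g := by
  refine ae_eq_of_integral_contDiff_smul_eq (L2.locallyIntegrable _)
    (continuous_causalInt hq (Lp.memLp g)).locallyIntegrable fun φ h1 h2 => ?_
  have hφ : MemLp (fun x => (φ x : ℂ)) 2 volume :=
    (Complex.continuous_ofReal.comp h1.continuous).memLp_of_hasCompactSupport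
      (h2.comp_left (g := fun y : ℝ => (y : ℂ)) rfl)
  have e : ∀ h : L2, ∫ x, φ x • h x = inner ℂ (hφ.toLp) h := fun h => by
    rw [L2.inner_eq]
    refine integral_congr_ae ?_
    filter_upwards [hφ.coeFn_toLp] with x hx
    rw [hx, Complex.conj_ofReal, mul_comm, Complex.real_smul]
  rw [e, inner_causalOp hq]
  simp only [← e]
  have e2 : ∀ u, ∫ x, φ x • translateL2 u g x = ∫ x, (φ x : ℂ) * g (x - u) := fun u => by
    refine integral_congr_ae ?_
    filter_upwards [translateL2_ae u g] with x hx
    rw [hx, Complex.real_smul]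
  rw [integral_congr_ae (Eventually.of_forall fun u => congrArg _ (e2 u))]
  simp only [causalInt, ← integral_const_mul, Complex.real_smul]
  rw [integral_integral_swap]
  · refine integral_congr_ae (Eventually.of_forall fun x => ?_)
    simp only
    congr 1; ext u; ring
  · have := (integrable_expDensity_mul hq hφ (Lp.memLp g)).swap
    exact this

theorem freeGroup_causalOp {q : ℝ} (hq : 0 < q) (t : ℝ) (f : L2) :
    freeGroup t (causalOp q f) = causalOp q (freeGroup t f) :=
  freeGroup_fourierMul t (bddMeas_causalSymbol hq) f

theorem ae_norm_causalOp_le {q : ℝ} (hq : 0 < q) (g : L2) :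
    ∀ᵐ x, ‖causalOp q g x‖ ≤ ‖(memLp_expDensity hq).toLp‖ * ‖g‖ := by
  filter_upwards [causalOp_ae hq g] with x hx
  rw [hx]
  exact norm_causalInt_le hq g x

/-! ### Half-lines and causality -/

/-- Multiplication by the indicator function of `s` on `L²`. -/
noncomputable def restrictOp (s : Set ℝ) : L2 →L[ℂ] L2 := mulOp (s.indicator fun _ => 1)

theorem bddMeas_indicator {s : Set ℝ} (hs : MeasurableSet s) :
    BddMeas (s.indicator fun _ => (1 : ℂ)) :=
  ⟨measurable_const.indicator hs, 1, fun x => by by_cases h : x ∈ s <;> simp [h]⟩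

theorem restrictOp_ae {s : Set ℝ} (hs : MeasurableSet s) (f : L2) :
    restrictOp s f =ᵐ[volume] s.indicator f := by
  filter_upwards [mulOp_ae (bddMeas_indicator hs) f] with x hx
  rw [restrictOp, hx]
  by_cases h : x ∈ s <;> simp [h]

theorem inner_restrictOp_left {s : Set ℝ} (hs : MeasurableSet s) (f g : L2) :
    inner ℂ (restrictOp s f) g = inner ℂ f (restrictOp s g) := by
  rw [L2.inner_eq, L2.inner_eq]
  refine integral_congr_ae ?_
  filter_upwards [restrictOp_ae hs f, restrictOp_ae hs g] with x h1 h2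
  rw [h1, h2]
  by_cases h : x ∈ s <;> simp [h]

/-- Restriction to the positive half-line. -/
noncomputable abbrev posOp : L2 →L[ℂ] L2 := restrictOp (Set.Ioi 0)

/-- Restriction to the negative half-line. -/
noncomputable abbrev negOp : L2 →L[ℂ] L2 := restrictOp (Set.Iio 0)

theorem posOp_ae (f : L2) : posOp f =ᵐ[volume] (Set.Ioi 0).indicator f :=
  restrictOp_ae measurableSet_Ioi f

theorem negOp_ae (f : L2) : negOp f =ᵐ[volume] (Set.Iio 0).indicator f :=
  restrictOp_ae measurableSet_Iio f

theorem ae_ne_zero : ∀ᵐ x : ℝ, x ≠ 0 := by simp [ae_iff]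

theorem posOp_add_negOp (f : L2) : posOp f + negOp f = f := by
  refine Lp.ext ?_
  filter_upwards [Lp.coeFn_add (posOp f) (negOp f), posOp_ae f, negOp_ae f, ae_ne_zero]
    with x h1 h2 h3 h4
  rw [h1, Pi.add_apply, h2, h3]
  rcases lt_or_gt_of_ne h4 with h | h
  · simp [h, h.le]
  · simp [h, h.le]

theorem posOp_posOp (f : L2) : posOp (posOp f) = posOp f := by
  refine Lp.ext ?_
  filter_upwards [posOp_ae (posOp f), posOp_ae f] with x h1 h2
  rw [h1]
  by_cases h : x ∈ Set.Ioi (0 : ℝ)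
  · rw [Set.indicator_of_mem h]
  · rw [Set.indicator_of_notMem h, h2, Set.indicator_of_notMem h]

theorem reflectL2_posOp (f : L2) : reflectL2 (posOp f) = negOp (reflectL2 f) := by
  refine Lp.ext ?_
  filter_upwards [reflectL2_ae (posOp f), ae_comp_neg (posOp_ae f), negOp_ae (reflectL2 f),
    reflectL2_ae f] with x h1 h2 h3 h4
  rw [h1, h2, h3]
  by_cases h : x < 0
  · rw [Set.indicator_of_mem (by simpa using h), Set.indicator_of_mem (by simpa using h), h4]
  · rw [Set.indicator_of_notMem (by simpa using h), Set.indicator_of_notMem (by simpa using h)]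

theorem reflectL2_negOp (f : L2) : reflectL2 (negOp f) = posOp (reflectL2 f) := by
  rw [← reflectL2_reflectL2 (posOp (reflectL2 f)), reflectL2_posOp, reflectL2_reflectL2]

theorem posOp_negOp (f : L2) : posOp (negOp f) = 0 := by
  have h := congrArg posOp (posOp_add_negOp f)
  rw [map_add, posOp_posOp] at h
  simpa using h

theorem negOp_posOp (f : L2) : negOp (posOp f) = 0 := by
  have h := posOp_add_negOp (posOp f)
  rw [posOp_posOp] at h
  simpa using h

/-- Causality: the value at $x<0$ is an integral over $(-\infty,x]$, where the argument vanishes. -/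
theorem negOp_causalOp_posOp {q : ℝ} (hq : 0 < q) (f : L2) : negOp (causalOp q (posOp f)) = 0 := by
  refine Lp.ext ?_
  filter_upwards [negOp_ae (causalOp q (posOp f)), causalOp_ae hq (posOp f),
    Lp.coeFn_zero ℂ 2 (volume : Measure ℝ)] with x h1 h2 h3
  rw [h1, h3, Pi.zero_apply]
  by_cases h : x < 0
  · rw [Set.indicator_of_mem (by simpa using h), h2, causalInt_eq,
      setIntegral_eq_zero_of_ae_eq_zero, mul_zero]
    filter_upwards [posOp_ae f] with s hs hsx
    rw [hs, Set.indicator_of_notMem, mul_zero]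
    simp only [Set.mem_Iic, Set.mem_Ioi, not_lt] at hsx ⊢
    linarith
  · rw [Set.indicator_of_notMem (by simpa using h)]

theorem negOp_causalOp {q : ℝ} (hq : 0 < q) (f : L2) :
    negOp (causalOp q f) = negOp (causalOp q (negOp f)) := by
  conv_lhs => rw [← posOp_add_negOp f, map_add, map_add, negOp_causalOp_posOp hq, zero_add]

/-! ### The Robin involution -/

/-- The involution `f ↦ ((2C - 1) f)(-·)` with `C = q (q + ∂ₓ)⁻¹`. -/
noncomputable def robinInvolution (q : ℝ) : L2 →L[ℂ] L2 :=
  reflectL2.toContinuousLinearMap ∘L ((2 : ℂ) • causalOp q - 1)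

theorem robinInvolution_apply (q : ℝ) (f : L2) :
    robinInvolution q f = reflectL2 ((2 : ℂ) • causalOp q f - f) := rfl

/-- The symbol of `2C - 1`. -/
noncomputable def blaschkeSymbol (q x : ℝ) : ℂ := 2 * causalSymbol q x - 1

theorem blaschkeSymbol_eq {q : ℝ} (hq : 0 < q) (x : ℝ) : blaschkeSymbol q x =
    (q - 2 * Real.pi * x * Complex.I) / (q + 2 * Real.pi * x * Complex.I) := by
  have := causalSymbol_den_ne hq x
  rw [blaschkeSymbol, causalSymbol]
  field_simp
  ring

theorem norm_blaschkeSymbol {q : ℝ} (hq : 0 < q) (x : ℝ) : ‖blaschkeSymbol q x‖ = 1 := by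
  have h := causalSymbol_den_ne hq x
  rw [blaschkeSymbol_eq hq, norm_div, div_eq_one_iff_eq (norm_ne_zero_iff.2 h),
    ← Complex.norm_conj (q + _)]
  congr 1
  simp only [map_add, map_mul, Complex.conj_ofReal, Complex.conj_I, map_ofNat]
  ring

theorem bddMeas_blaschkeSymbol {q : ℝ} (hq : 0 < q) : BddMeas (blaschkeSymbol q) :=
  ⟨((bddMeas_causalSymbol hq).1.const_mul 2).sub_const 1, 1,
    fun x => (norm_blaschkeSymbol hq x).le⟩

theorem fourierMul_blaschkeSymbol {q : ℝ} (hq : 0 < q) (f : L2) :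
    fourierMul (blaschkeSymbol q) f = (2 : ℂ) • causalOp q f - f := by
  apply fourierL2.injective
  rw [fourierL2_fourierMul, map_sub, map_smul, causalOp, fourierL2_fourierMul]
  refine Lp.ext ?_
  filter_upwards [mulOp_ae (bddMeas_blaschkeSymbol hq) (fourierL2 f),
    mulOp_ae (bddMeas_causalSymbol hq) (fourierL2 f),
    Lp.coeFn_sub ((2 : ℂ) • mulOp (causalSymbol q) (fourierL2 f)) (fourierL2 f),
    Lp.coeFn_smul (2 : ℂ) (mulOp (causalSymbol q) (fourierL2 f))] with x h1 h2 h3 h4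
  rw [h1, h3, Pi.sub_apply, h4, Pi.smul_apply, h2, blaschkeSymbol, smul_eq_mul]
  ring

theorem robinInvolution_eq {q : ℝ} (hq : 0 < q) (f : L2) :
    robinInvolution q f = reflectL2 (fourierMul (blaschkeSymbol q) f) := by
  rw [fourierMul_blaschkeSymbol hq, robinInvolution_apply]

theorem norm_robinInvolution {q : ℝ} (hq : 0 < q) (f : L2) : ‖robinInvolution q f‖ = ‖f‖ := by
  rw [robinInvolution_eq hq, LinearIsometry.norm_map,
    norm_fourierMul (bddMeas_blaschkeSymbol hq).1 (norm_blaschkeSymbol hq)]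

theorem robinInvolution_robinInvolution {q : ℝ} (hq : 0 < q) (f : L2) :
    robinInvolution q (robinInvolution q f) = f := by
  have hb := bddMeas_blaschkeSymbol hq
  rw [robinInvolution_eq hq, robinInvolution_eq hq, reflectL2_fourierMul hb, reflectL2_reflectL2,
    fourierMul_fourierMul hb.comp_neg hb]
  -- The symbol is a quotient of complex conjugates, so its values at $x$ and $-x$ are inverse to
  -- each other. The constant symbol 1 is written as the free symbol at time zero.
  have e : (fun x => blaschkeSymbol q (-x) * blaschkeSymbol q x) = freeSymbol 0 := by
    ext x
    have h := causalSymbol_den_ne hq x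
    have h' := causalSymbol_den_ne hq (-x)
    rw [blaschkeSymbol_eq hq, blaschkeSymbol_eq hq]
    push_cast at h' ⊢
    have h2 : (q + 2 * Real.pi * -x * Complex.I : ℂ) = q - 2 * Real.pi * x * Complex.I := by ring
    have h3 : (q - 2 * Real.pi * -x * Complex.I : ℂ) = q + 2 * Real.pi * x * Complex.I := by ring
    rw [h2] at h' ⊢
    rw [h3]
    field_simp
    simp [freeSymbol]
  rw [e]
  exact freeGroup_zero f

theorem robinInvolution_freeGroup {q : ℝ} (hq : 0 < q) (t : ℝ) (f : L2) :
    robinInvolution q (freeGroup t f) = freeGroup t (robinInvolution q f) := by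
  rw [robinInvolution_eq hq, robinInvolution_eq hq, freeGroup_reflectL2,
    freeGroup_fourierMul t (bddMeas_blaschkeSymbol hq)]

/-- By causality $2C-1$ keeps a function supported in $x>0$ there, and the reflection then carries
it to $x<0$. Hence $f-Rf$ extends any such $f$. -/
theorem posOp_robinInvolution_posOp {q : ℝ} (hq : 0 < q) (f : L2) :
    posOp (robinInvolution q (posOp f)) = 0 := by
  rw [robinInvolution_apply, ← reflectL2_negOp, map_sub, map_smul, negOp_causalOp_posOp hq,
    negOp_posOp, smul_zero, sub_zero, map_zero]

/-- For $x>0$ causality gives $Cy(x)=qe^{-qx}I$ with $I=\int_{-\infty}^0e^{qs}y(s)\,ds$, while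
$2Cy(x)=y(x)-y(-x)=-y(-x)$. So $y(s)=-2qIe^{qs}$ for $s<0$, and inserting this into $I$ yields
$I=-I$. -/
theorem eq_zero_of_robinInvolution_eq_neg {q : ℝ} (hq : 0 < q) {y : L2}
    (h1 : robinInvolution q y = -y) (h0 : posOp y = 0) : y = 0 := by
  have h2 : (2 : ℂ) • causalOp q y = y - reflectL2 y := by
    have := congrArg reflectL2 h1
    rw [robinInvolution_apply, reflectL2_reflectL2, map_neg] at this
    rw [sub_eq_iff_eq_add.1 this]
    abel
  have hpos : ∀ᵐ x, 0 < x → y x = 0 := by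
    filter_upwards [posOp_ae y, Lp.coeFn_zero ℂ 2 (volume : Measure ℝ)] with x e1 e2 hx
    rw [h0, e2, Set.indicator_of_mem (Set.mem_Ioi.2 hx)] at e1
    exact e1.symm
  set I : ℂ := ∫ s in Set.Iic (0 : ℝ), Complex.exp (q * s) * y s with hI
  have hval : ∀ x, 0 < x → causalInt q y x = q * Complex.exp (-q * x) * I := fun x hx => by
    rw [causalInt_eq, hI]
    congr 1
    refine (setIntegral_eq_of_subset_of_ae_sdiff_eq_zero measurableSet_Iic.nullMeasurableSet
      (Set.Iic_subset_Iic.2 hx.le) ?_)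
    filter_upwards [hpos] with s hs hsx
    rw [hs (by simpa using hsx.2), mul_zero]
  have hy : ∀ᵐ x, 0 < x → y (-x) = -2 * q * Complex.exp (-q * x) * I := by
    filter_upwards [causalOp_ae hq y, Lp.coeFn_smul (2 : ℂ) (causalOp q y),
      Lp.coeFn_sub y (reflectL2 y), reflectL2_ae y, hpos] with x e1 e2 e3 e4 e5 hx
    rw [h2, e3, Pi.sub_apply, e4, Pi.smul_apply, e1, hval x hx, e5 hx, smul_eq_mul] at e2
    linear_combination -e2
  have hyneg : ∀ᵐ s, s < 0 → y s = -2 * q * Complex.exp (q * s) * I := by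
    filter_upwards [ae_comp_neg hy] with s hs h
    have := hs (by linarith)
    rw [neg_neg] at this
    rw [this]
    congr 3
    push_cast; ring_nf
  have hI0 : I = 0 := by
    have e : I = ∫ s in Set.Iic (0 : ℝ), (-2 * q * I) * Complex.exp ((2 * q : ℂ) * s) := by
      rw [integral_Iic_eq_integral_Iio]
      refine (hI.trans integral_Iic_eq_integral_Iio).trans ?_
      refine setIntegral_congr_ae measurableSet_Iio ?_
      filter_upwards [hyneg] with s hs h
      rw [hs h, show (2 * q : ℂ) * s = q * s + q * s by ring, Complex.exp_add]
      ring
    rw [integral_const_mul, integral_exp_mul_complex_Iic (by simpa using hq)] at e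
    have hq' : (q : ℂ) ≠ 0 := by exact_mod_cast hq.ne'
    simp only [Complex.ofReal_zero, mul_zero, Complex.exp_zero] at e
    field_simp at e
    have e2 : 2 * I = 0 := by linear_combination e
    simpa using e2
  refine Lp.ext ?_
  filter_upwards [hpos, hyneg, ae_ne_zero, Lp.coeFn_zero ℂ 2 (volume : Measure ℝ)]
    with x e1 e2 e3 e4
  rw [e4, Pi.zero_apply]
  rcases lt_or_gt_of_ne e3 with h | h
  · rw [e2 h, hI0, mul_zero]
  · exact e1 h

/-- Both sides lie in the $(-1)$-eigenspace and agree on $x>0$, so the uniqueness just proved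
applies. -/
theorem sub_robinInvolution_posOp {q : ℝ} (hq : 0 < q) {w : L2} (hw : robinInvolution q w = -w) :
    posOp w - robinInvolution q (posOp w) = w := by
  have h := eq_zero_of_robinInvolution_eq_neg hq
    (y := w - (posOp w - robinInvolution q (posOp w)))
    (by rw [map_sub, map_sub, hw, robinInvolution_robinInvolution hq]; abel)
    (by rw [map_sub, map_sub, posOp_posOp, posOp_robinInvolution_posOp hq]; abel)
  exact (sub_eq_zero.1 h).symm

/-! ### The explicit group of $H_q$ -/

/-- The even extension of the restriction to the positive half-line. -/
noncomputable def evenExt : L2 →L[ℂ] L2 :=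
  posOp + reflectL2.toContinuousLinearMap ∘L posOp

theorem evenExt_apply (f : L2) : evenExt f = posOp f + reflectL2 (posOp f) := rfl

/-- The even part of `f`, doubled and restricted to the positive half-line. -/
noncomputable def foldOp : L2 →L[ℂ] L2 :=
  posOp ∘L (1 + reflectL2.toContinuousLinearMap)

theorem foldOp_apply (f : L2) : foldOp f = posOp (f + reflectL2 f) := rfl

theorem reflectL2_evenExt (f : L2) : reflectL2 (evenExt f) = evenExt f := by
  rw [evenExt_apply, map_add, reflectL2_reflectL2, add_comm]

theorem posOp_evenExt (f : L2) : posOp (evenExt f) = posOp f := by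
  rw [evenExt_apply, map_add, posOp_posOp, reflectL2_posOp, posOp_negOp, add_zero]

theorem foldOp_evenExt (f : L2) : foldOp (evenExt f) = (2 : ℂ) • posOp f := by
  rw [foldOp_apply, reflectL2_evenExt, map_add, posOp_evenExt, two_smul]

theorem foldOp_reflectL2 (f : L2) : foldOp (reflectL2 f) = foldOp f := by
  rw [foldOp_apply, foldOp_apply, reflectL2_reflectL2, add_comm]

theorem posOp_foldOp (f : L2) : posOp (foldOp f) = foldOp f := posOp_posOp _

theorem evenExt_foldOp (f : L2) : evenExt (foldOp f) = f + reflectL2 f := by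
  rw [evenExt_apply, posOp_foldOp, foldOp_apply, reflectL2_posOp, map_add reflectL2,
    reflectL2_reflectL2, add_comm (reflectL2 f) f, posOp_add_negOp]

/-- The map from the even part of `L²` to the `(-1)`-eigenspace of the involution. -/
noncomputable def evenLift (q : ℝ) : L2 →L[ℂ] L2 :=
  (1 / 2 : ℂ) • ((1 - robinInvolution q) ∘L foldOp)

theorem evenLift_apply (q : ℝ) (f : L2) :
    evenLift q f = (1 / 2 : ℂ) • (foldOp f - robinInvolution q (foldOp f)) := rfl

theorem robinInvolution_evenLift {q : ℝ} (hq : 0 < q) (f : L2) :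
    robinInvolution q (evenLift q f) = -evenLift q f := by
  rw [evenLift_apply, map_smul, map_sub, robinInvolution_robinInvolution hq, ← smul_neg, neg_sub]

theorem evenLift_evenExt {q : ℝ} (hq : 0 < q) {w : L2} (hw : robinInvolution q w = -w) :
    evenLift q (evenExt w) = w := by
  rw [evenLift_apply, foldOp_evenExt, map_smul, ← smul_sub, sub_robinInvolution_posOp hq hw,
    smul_smul]
  norm_num

theorem evenExt_evenLift {q : ℝ} (hq : 0 < q) (f : L2) :
    evenExt (evenLift q f) = (1 / 2 : ℂ) • (f + reflectL2 f) := by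
  have h : evenExt (robinInvolution q (foldOp f)) = 0 := by
    rw [evenExt_apply, ← posOp_foldOp f, posOp_robinInvolution_posOp hq, map_zero, add_zero]
  rw [evenLift_apply, map_smul, map_sub, h, sub_zero, evenExt_foldOp]

theorem norm_evenExt_sq (w : L2) : ‖evenExt w‖ ^ 2 = 2 * ‖posOp w‖ ^ 2 := by
  have h : inner ℂ (posOp w) (reflectL2 (posOp w)) = 0 := by
    rw [← posOp_posOp w, inner_restrictOp_left measurableSet_Ioi, reflectL2_posOp, posOp_negOp,
      inner_zero_right]
  rw [evenExt_apply, @norm_add_sq ℂ, h, LinearIsometry.norm_map]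
  simp
  ring

/-- In $w=f-Rf$ with $f$ the restriction to $x>0$, the two parts live on opposite half-lines and
have equal norms, so $\|w\|^2=2\|f\|^2$, as for the even extension. -/
theorem norm_evenExt {q : ℝ} (hq : 0 < q) {w : L2} (hw : robinInvolution q w = -w) :
    ‖evenExt w‖ = ‖w‖ := by
  have h : inner ℂ (posOp w) (robinInvolution q (posOp w)) = 0 := by
    rw [← posOp_posOp w, inner_restrictOp_left measurableSet_Ioi, posOp_robinInvolution_posOp hq,
      inner_zero_right]
  have e : ‖w‖ ^ 2 = 2 * ‖posOp w‖ ^ 2 := by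
    conv_lhs => rw [← sub_robinInvolution_posOp hq hw, @norm_sub_sq ℂ, h, norm_robinInvolution hq]
    simp
    ring
  rw [← sq_eq_sq₀ (norm_nonneg _) (norm_nonneg _), norm_evenExt_sq, e]

/-- The odd part of a function. -/
noncomputable def oddPart : L2 →L[ℂ] L2 := (1 / 2 : ℂ) • (1 - reflectL2.toContinuousLinearMap)

theorem oddPart_apply (f : L2) : oddPart f = (1 / 2 : ℂ) • (f - reflectL2 f) := rfl

theorem reflectL2_oddPart (f : L2) : reflectL2 (oddPart f) = -oddPart f := by
  rw [oddPart_apply, map_smul, map_sub, reflectL2_reflectL2, ← smul_neg, neg_sub]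

theorem oddPart_of_odd {f : L2} (h : reflectL2 f = -f) : oddPart f = f := by
  rw [oddPart_apply, h, sub_neg_eq_add, ← two_smul ℂ f, smul_smul]; norm_num

theorem oddPart_of_even {f : L2} (h : reflectL2 f = f) : oddPart f = 0 := by
  rw [oddPart_apply, h, sub_self, smul_zero]

theorem evenLift_of_odd {q : ℝ} {f : L2} (h : reflectL2 f = -f) : evenLift q f = 0 := by
  rw [evenLift_apply, foldOp_apply, h, add_neg_cancel, map_zero, map_zero, sub_zero, smul_zero]

/-- The explicit form of the unitary group of `H_q`. -/
noncomputable def robinGroup (q t : ℝ) : L2 →L[ℂ] L2 :=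
  freeGroup t ∘L oddPart + evenExt ∘L freeGroup t ∘L evenLift q

theorem robinGroup_apply (q t : ℝ) (f : L2) :
    robinGroup q t f = freeGroup t (oddPart f) + evenExt (freeGroup t (evenLift q f)) := rfl

theorem reflectL2_freeGroup_oddPart (t : ℝ) (f : L2) :
    reflectL2 (freeGroup t (oddPart f)) = -freeGroup t (oddPart f) := by
  rw [← freeGroup_reflectL2, reflectL2_oddPart, map_neg]

theorem robinInvolution_freeGroup_evenLift {q : ℝ} (hq : 0 < q) (t : ℝ) (f : L2) :
    robinInvolution q (freeGroup t (evenLift q f)) = -freeGroup t (evenLift q f) := by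
  rw [robinInvolution_freeGroup hq, robinInvolution_evenLift hq, map_neg]

/-- Together with `evenLift_robinGroup`, this says that the odd part and the lift are coordinates in
which the group is the free one. The group law and the identification of the generator both follow
from that. -/
theorem oddPart_robinGroup (q t : ℝ) (f : L2) :
    oddPart (robinGroup q t f) = freeGroup t (oddPart f) := by
  rw [robinGroup_apply, map_add, oddPart_of_odd (reflectL2_freeGroup_oddPart t f),
    oddPart_of_even (reflectL2_evenExt _), add_zero]

theorem evenLift_robinGroup {q : ℝ} (hq : 0 < q) (t : ℝ) (f : L2) :
    evenLift q (robinGroup q t f) = freeGroup t (evenLift q f) := by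
  rw [robinGroup_apply, map_add, evenLift_of_odd (reflectL2_freeGroup_oddPart t f), zero_add,
    evenLift_evenExt hq (robinInvolution_freeGroup_evenLift hq t f)]

theorem robinGroup_zero {q : ℝ} (hq : 0 < q) (f : L2) : robinGroup q 0 f = f := by
  rw [robinGroup_apply, freeGroup_zero, freeGroup_zero, evenExt_evenLift hq, oddPart_apply,
    ← smul_add, sub_add_add_cancel, ← two_smul ℂ f, smul_smul]
  norm_num

theorem robinGroup_add {q : ℝ} (hq : 0 < q) (s t : ℝ) (f : L2) :
    robinGroup q (s + t) f = robinGroup q s (robinGroup q t f) := by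
  rw [robinGroup_apply q s, oddPart_robinGroup, evenLift_robinGroup hq, ← freeGroup_add,
    ← freeGroup_add, robinGroup_apply]

theorem inner_eq_zero_of_odd_even {a b : L2} (ha : reflectL2 a = -a) (hb : reflectL2 b = b) :
    inner ℂ a b = 0 := by
  have h : inner ℂ (reflectL2 a) (reflectL2 b) = inner ℂ a b := reflectL2.inner_map_map a b
  rw [ha, hb, inner_neg_left] at h
  linear_combination -h / 2

theorem norm_robinGroup_sq {q : ℝ} (hq : 0 < q) (t : ℝ) (f : L2) :
    ‖robinGroup q t f‖ ^ 2 = ‖oddPart f‖ ^ 2 + ‖evenLift q f‖ ^ 2 := by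
  rw [robinGroup_apply, @norm_add_sq ℂ, inner_eq_zero_of_odd_even
    (reflectL2_freeGroup_oddPart t f) (reflectL2_evenExt _), norm_freeGroup,
    norm_evenExt hq (robinInvolution_freeGroup_evenLift hq t f), norm_freeGroup]
  simp

/-- The squared norm splits orthogonally into two quantities independent of time, and time zero
gives the identity. -/
theorem norm_robinGroup {q : ℝ} (hq : 0 < q) (t : ℝ) (f : L2) : ‖robinGroup q t f‖ = ‖f‖ := by
  rw [← sq_eq_sq₀ (norm_nonneg _) (norm_nonneg _), norm_robinGroup_sq hq, ← norm_robinGroup_sq hq 0,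
    robinGroup_zero hq]

theorem continuous_robinGroup (q : ℝ) (f : L2) : Continuous fun t => robinGroup q t f :=
  (continuous_freeGroup _).add (evenExt.continuous.comp (continuous_freeGroup _))

/-- The difference of the free and the perturbed group. -/
theorem freeGroup_sub_robinGroup {q : ℝ} (hq : 0 < q) (t : ℝ) (f : L2) :
    freeGroup t f - robinGroup q t f =
      evenExt (reflectL2 (causalOp q (freeGroup t (foldOp f)))) := by
  have h1 : freeGroup t f - freeGroup t (oddPart f) =
      evenExt (freeGroup t ((1 / 2 : ℂ) • (f + reflectL2 f))) := by
    have h2 : reflectL2 (freeGroup t ((1 / 2 : ℂ) • (f + reflectL2 f))) =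
        freeGroup t ((1 / 2 : ℂ) • (f + reflectL2 f)) := by
      rw [← freeGroup_reflectL2, map_smul, map_add, reflectL2_reflectL2, add_comm]
    rw [evenExt_apply, reflectL2_posOp, h2, posOp_add_negOp, ← map_sub, oddPart_apply]
    congr 1
    module
  -- The odd parts cancel in the difference of the groups. For the even part, with $h$ the folded
  -- function, $\tfrac12(h+\check h)-\tfrac12(h-Rh)=\tfrac12(\check h+Rh)$, and $Rh$ is the
  -- reflection of $2Ch-h$, so only the reflection of $Ch$ remains.
  have h3 : (1 / 2 : ℂ) • (f + reflectL2 f) - evenLift q f =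
      reflectL2 (causalOp q (foldOp f)) := by
    rw [← evenExt_foldOp, evenExt_apply, posOp_foldOp, evenLift_apply, robinInvolution_apply,
      map_sub, map_smul]
    module
  rw [robinGroup_apply, ← sub_sub, h1, ← map_sub, ← map_sub, h3, freeGroup_reflectL2,
    freeGroup_causalOp hq]

/-! ### The generator of the explicit group -/

theorem causalInt_congr {q : ℝ} {f g : ℝ → ℂ} (h : f =ᵐ[volume] g) (x : ℝ) :
    causalInt q f x = causalInt q g x := by
  refine integral_congr_ae ?_
  have := (Measure.measurePreserving_sub_left volume x).quasiMeasurePreserving.ae h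
  filter_upwards [this] with u hu
  rw [hu]

/-- The classical form of $(q+\partial_x)Cg=qg$, valid at every point since $g$ is continuous. -/
theorem hasDerivAt_causalInt {q : ℝ} (hq : 0 < q) {g : ℝ → ℂ} (hg : MemLp g 2 volume)
    (hc : Continuous g) (x : ℝ) :
    HasDerivAt (causalInt q g) (q * (g x - causalInt q g x)) x := by
  have e : causalInt q g = fun x : ℝ => (q * Complex.exp (-q * x)) *
      ((∫ s in Set.Iic (0 : ℝ), Complex.exp (q * s) * g s) +
        ∫ s in (0 : ℝ)..x, Complex.exp (q * s) * g s) := by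
    ext x
    rw [causalInt_eq, ← intervalIntegral.integral_Iic_sub_Iic
      (integrableOn_exp_mul_Iic_of_memLp hq hg 0) (integrableOn_exp_mul_Iic_of_memLp hq hg x)]
    ring
  have hc2 : Continuous fun s : ℝ => Complex.exp (q * s) * g s := by fun_prop
  have h1 : HasDerivAt (fun x => (∫ s in Set.Iic (0 : ℝ), Complex.exp (q * s) * g s) +
      ∫ s in (0 : ℝ)..x, Complex.exp (q * s) * g s) (Complex.exp (q * x) * g x) x :=
    (intervalIntegral.integral_hasDerivAt_right (hc2.intervalIntegrable _ _)
      hc2.aestronglyMeasurable.stronglyMeasurableAtFilter hc2.continuousAt).const_add _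
  have h2 : HasDerivAt (fun x : ℝ => (q * Complex.exp (-q * x) : ℂ))
      (q * (Complex.exp (-q * x) * (-q))) x := by
    have h3 : HasDerivAt (fun x : ℝ => (-q * x : ℂ)) (-q) x := by
      have := (Complex.ofRealCLM.hasDerivAt (x := x)).const_mul (-q : ℂ)
      simp only [Complex.ofRealCLM_apply, Complex.ofReal_one, mul_one] at this
      exact this
    exact h3.cexp.const_mul _
  have h3 := h2.mul h1
  rw [e]
  refine h3.congr_deriv ?_
  have h4 : Complex.exp (-q * x) * Complex.exp (q * x) = 1 := by
    rw [← Complex.exp_add, neg_mul, neg_add_cancel, Complex.exp_zero]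
  linear_combination (q * g x) * h4

/-- Functions in the `(-1)`-eigenspace of the involution satisfy the Robin condition at `0`. -/
theorem IsSobolevTwo.robin {q : ℝ} (hq : 0 < q) {w k : L2} {W W₁ : ℝ → ℂ}
    (h : IsSobolevTwo w k W W₁) (hw : robinInvolution q w = -w) : W₁ 0 = q * W 0 := by
  obtain ⟨hd, -, hW, -⟩ := h
  have hWc : Continuous W := continuous_iff_continuousAt.2 fun x => (hd x).continuousAt
  have hWm : MemLp W 2 volume := (memLp_congr_ae hW).1 (Lp.memLp w)
  have h2 : (2 : ℂ) • causalOp q w = w - reflectL2 w := by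
    have := congrArg reflectL2 hw
    rw [robinInvolution_apply, reflectL2_reflectL2, map_neg] at this
    rw [sub_eq_iff_eq_add.1 this]
    abel
  have hae : causalInt q W =ᵐ[volume] fun x => (1 / 2 : ℂ) * (W x - W (-x)) := by
    filter_upwards [causalOp_ae hq w, Lp.coeFn_smul (2 : ℂ) (causalOp q w),
      Lp.coeFn_sub w (reflectL2 w), reflectL2_ae w, hW, ae_comp_neg hW] with x e1 e2 e3 e4 e5 e6
    rw [h2, e3, Pi.sub_apply, e4, Pi.smul_apply, e1, e5, e6, smul_eq_mul, causalInt_congr hW] at e2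
    linear_combination -e2 / 2
  -- The eigenspace equation holds everywhere because both sides are continuous. At the origin it
  -- gives $CW(0)=0$, and differentiating it there gives $W'(0)=q(W(0)-CW(0))$.
  have heq : causalInt q W = fun x => (1 / 2 : ℂ) * (W x - W (-x)) :=
    (continuous_causalInt hq hWm).ae_eq_iff_eq volume
      (by exact continuous_const.mul (hWc.sub (hWc.comp continuous_neg))) |>.1 hae
  have h0 : causalInt q W 0 = 0 := by rw [heq]; simp
  have d1 := hasDerivAt_causalInt hq hWm hWc 0
  have d2 : HasDerivAt (fun x => (1 / 2 : ℂ) * (W x - W (-x))) (W₁ 0) 0 := by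
    have hn : HasDerivAt (fun x => W (-x)) (-W₁ 0) 0 := by
      have := (show HasDerivAt W (W₁ 0) (-0) by simpa using hd 0).scomp (0 : ℝ) (hasDerivAt_neg 0)
      simpa [Function.comp_def] using this
    refine (((hd 0).sub hn).const_mul (1 / 2 : ℂ)).congr_deriv ?_
    ring
  rw [heq] at d1
  have := d2.unique d1
  simpa using this

/-- Cutting a test function off at a point away from its support. -/
theorem contDiff_cutoff {φ : ℝ → ℝ} (h1 : ContDiff ℝ ∞ φ) (h2 : HasCompactSupport φ)
    (h3 : tsupport φ ⊆ {0}ᶜ) :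
    ContDiff ℝ ∞ ((Set.Ioi 0).indicator φ) ∧ HasCompactSupport ((Set.Ioi 0).indicator φ) ∧
      deriv ((Set.Ioi 0).indicator φ) = (Set.Ioi 0).indicator (deriv φ) := by
  have h0 : φ =ᶠ[𝓝 0] 0 := notMem_tsupport_iff_eventuallyEq.1 fun h => h3 h rfl
  have hpos : ∀ x, 0 < x → (Set.Ioi 0).indicator φ =ᶠ[𝓝 x] φ := fun x hx => by
    filter_upwards [Ioi_mem_nhds hx] with y hy using Set.indicator_of_mem hy _
  have hneg : ∀ x, x < 0 → (Set.Ioi 0).indicator φ =ᶠ[𝓝 x] 0 := fun x hx => by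
    filter_upwards [Iio_mem_nhds hx] with y hy
    exact Set.indicator_of_notMem (by simp only [Set.mem_Ioi, not_lt]; exact hy.le) _
  have hzero : (Set.Ioi 0).indicator φ =ᶠ[𝓝 0] 0 := by
    filter_upwards [h0] with y hy
    by_cases h : y ∈ Set.Ioi (0 : ℝ)
    · rw [Set.indicator_of_mem h, hy]
    · rw [Set.indicator_of_notMem h]; rfl
  refine ⟨contDiff_iff_contDiffAt.2 fun x => ?_, h2.mono fun x hx => ?_, funext fun x => ?_⟩
  · rcases lt_trichotomy x 0 with h | rfl | h
    · exact contDiffAt_const.congr_of_eventuallyEq (hneg x h)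
    · exact contDiffAt_const.congr_of_eventuallyEq hzero
    · exact h1.contDiffAt.congr_of_eventuallyEq (hpos x h)
  · intro hx'
    exact hx (by by_cases h : x ∈ Set.Ioi (0 : ℝ) <;> simp [Set.indicator, hx'])
  · rcases lt_trichotomy x 0 with h | rfl | h
    · rw [(hneg x h).deriv_eq, Set.indicator_of_notMem (by simp only [Set.mem_Ioi, not_lt]; exact h.le)]
      simp
    · rw [hzero.deriv_eq, Set.indicator_of_notMem (by simp)]
      simp
    · rw [(hpos x h).deriv_eq, Set.indicator_of_mem (Set.mem_Ioi.2 h)]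

/-- The pairing of a test function with an extension by parity unfolds into a pairing of `w` with
the test function folded onto $x>0$, which lets the extension be differentiated on the side of the
test function. -/
theorem integral_smul_ext (ε : ℝ) {φ : ℝ → ℝ} (h1 : Continuous φ) (h2 : HasCompactSupport φ)
    (w : L2) : ∫ x, φ x • (posOp w + (ε : ℂ) • reflectL2 (posOp w) : L2) x =
      ∫ x, ((Set.Ioi 0).indicator φ x + ε * (Set.Ioi 0).indicator (fun x => φ (-x)) x) • w x := by
  have i1 := integrable_testFunction_smul (L2.locallyIntegrable (posOp w)) h1 h2
  have i2 := integrable_testFunction_smul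
    (L2.locallyIntegrable ((ε : ℂ) • reflectL2 (posOp w))) h1 h2
  have hn2 : HasCompactSupport fun x => φ (-x) := h2.comp_homeomorph (Homeomorph.neg ℝ)
  have i3 : Integrable (fun x => (Set.Ioi 0).indicator φ x • w x) volume := by
    refine ((integrable_testFunction_smul (L2.locallyIntegrable w) h1 h2).indicator
      (measurableSet_Ioi (a := (0 : ℝ)))).congr (Eventually.of_forall fun x => ?_)
    by_cases h : x ∈ Set.Ioi (0 : ℝ) <;> simp [Set.indicator, h]
  have i4 : Integrable (fun x => (ε * (Set.Ioi 0).indicator (fun x => φ (-x)) x) • w x)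
      volume := by
    refine (((integrable_testFunction_smul (L2.locallyIntegrable w) (h1.comp continuous_neg)
      hn2).indicator (measurableSet_Ioi (a := (0 : ℝ)))).smul ε).congr
      (Eventually.of_forall fun x => ?_)
    by_cases h : x ∈ Set.Ioi (0 : ℝ) <;> simp [Set.indicator, h, mul_assoc]
  have e1 : ∫ x, φ x • (posOp w + (ε : ℂ) • reflectL2 (posOp w) : L2) x =
      ∫ x, (φ x • posOp w x + φ x • ((ε : ℂ) • reflectL2 (posOp w) : L2) x) := by
    refine integral_congr_ae ?_
    filter_upwards [Lp.coeFn_add (posOp w) ((ε : ℂ) • reflectL2 (posOp w))] with x hx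
    rw [hx, Pi.add_apply, smul_add]
  simp only [add_smul]
  rw [e1, integral_add i1 i2, integral_add i3 i4]
  congr 1
  · refine integral_congr_ae ?_
    filter_upwards [posOp_ae w] with x hx
    rw [hx]
    by_cases h : x ∈ Set.Ioi (0 : ℝ) <;> simp [Set.indicator, h]
  · rw [← integral_neg_eq_self]
    refine integral_congr_ae ?_
    filter_upwards [ae_comp_neg (Lp.coeFn_smul (ε : ℂ) (reflectL2 (posOp w))),
      ae_comp_neg (reflectL2_ae (posOp w)), posOp_ae w] with x e2 e3 e4
    rw [e2, Pi.smul_apply, e3, neg_neg, e4]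
    by_cases h : x ∈ Set.Ioi (0 : ℝ) <;> simp [Set.indicator, h]
    ring

/-- Test functions supported away from the origin may be cut off there without losing smoothness, so
no boundary term appears. Differentiation exchanges even and odd extensions, whence the sign of `ε`
flips. -/
theorem HasWeakDerivOn.ext_halfLine {w w' : L2} (h : HasWeakDerivOn Set.univ w w') (ε : ℝ) :
    HasWeakDerivOn {0}ᶜ (posOp w + (ε : ℂ) • reflectL2 (posOp w) : L2)
      (posOp w' + ((-ε : ℝ) : ℂ) • reflectL2 (posOp w') : L2) := by
  intro φ h1 h2 h3
  have hn1 : ContDiff ℝ ∞ fun x => φ (-x) := h1.comp contDiff_neg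
  have hn2 : HasCompactSupport fun x => φ (-x) := h2.comp_homeomorph (Homeomorph.neg ℝ)
  have hn3 : tsupport (fun x => φ (-x)) ⊆ {0}ᶜ := fun x hx => by
    have := h3 (tsupport_comp_subset_preimage φ continuous_neg hx : -x ∈ tsupport φ)
    simpa using this
  obtain ⟨a1, a2, a3⟩ := contDiff_cutoff h1 h2 h3
  obtain ⟨b1, b2, b3⟩ := contDiff_cutoff hn1 hn2 hn3
  rw [integral_smul_ext ε (h1.continuous_deriv (by simp)) h2.deriv,
    integral_smul_ext (-ε) h1.continuous h2]
  have := h (fun x => (Set.Ioi 0).indicator φ x + (-ε) * (Set.Ioi 0).indicator (fun x => φ (-x)) x)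
    (a1.add (contDiff_const.mul b1)) (a2.add b2.mul_left) (Set.subset_univ _)
  rw [← this]
  congr 1
  ext x
  congr 1
  have da := (a1.differentiable (by simp) x).hasDerivAt
  have db := ((b1.differentiable (by simp) x).hasDerivAt).const_mul (-ε)
  have dd : deriv (fun x => (Set.Ioi 0).indicator φ x +
      (-ε) * (Set.Ioi 0).indicator (fun x => φ (-x)) x) x = _ := (da.add db).deriv
  rw [dd, a3, b3]
  by_cases h : x ∈ Set.Ioi (0 : ℝ)
  · simp [Set.indicator, deriv_comp_neg]
  · simp [Set.indicator, h]

theorem HasWeakDerivOn.add {Ω : Set ℝ} {f g f' g' : L2} (h : HasWeakDerivOn Ω f f')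
    (h' : HasWeakDerivOn Ω g g') : HasWeakDerivOn Ω (f + g : L2) (f' + g' : L2) := by
  have e : ∀ φ : ℝ → ℝ, Continuous φ → HasCompactSupport φ → ∀ u v : L2,
      ∫ x, φ x • (u + v : L2) x = (∫ x, φ x • u x) + ∫ x, φ x • v x := fun φ h1 h2 u v => by
    rw [← integral_add (integrable_testFunction_smul (L2.locallyIntegrable u) h1 h2)
      (integrable_testFunction_smul (L2.locallyIntegrable v) h1 h2)]
    refine integral_congr_ae ?_
    filter_upwards [Lp.coeFn_add u v] with x hx
    rw [hx, Pi.add_apply, smul_add]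
  intro φ h1 h2 h3
  rw [e _ (h1.continuous_deriv (by simp)) h2.deriv, e _ h1.continuous h2, h φ h1 h2 h3,
    h' φ h1 h2 h3, neg_add]

theorem DeltaHamiltonian.add {q : ℝ} {f h g k : L2} (hf : DeltaHamiltonian q f h)
    (hg : DeltaHamiltonian q g k) : DeltaHamiltonian q (f + g) (h + k) := by
  obtain ⟨F, F₁, f₁, f₂, a, b, ⟨Fc, fF⟩, wf, wf₁, ⟨F₁c, fF₁⟩, ⟨fa, fb⟩, fj, rfl⟩ := hf
  obtain ⟨G, G₁, g₁, g₂, c, d, ⟨Gc, gG⟩, wg, wg₁, ⟨G₁c, gG₁⟩, ⟨gc, gd⟩, gj, rfl⟩ := hg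
  refine ⟨F + G, F₁ + G₁, f₁ + g₁, f₂ + g₂, a + c, b + d,
    ⟨Fc.add Gc, (Lp.coeFn_add f g).trans (fF.add gG)⟩, wf.add wg, wf₁.add wg₁,
    ⟨F₁c.add G₁c, (Lp.coeFn_add f₁ g₁).trans (fF₁.add gG₁)⟩, ⟨fa.add gc, fb.add gd⟩, ?_,
    (smul_add _ _ _).symm⟩
  rw [Pi.add_apply]
  linear_combination fj + gj

theorem evenExt_ae (w : L2) : evenExt w =ᵐ[volume] fun x => w |x| := by
  filter_upwards [Lp.coeFn_add (posOp w) (reflectL2 (posOp w)), posOp_ae w,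
    reflectL2_ae (posOp w), ae_comp_neg (posOp_ae w), ae_ne_zero] with x h1 h2 h3 h4 h5
  rw [evenExt_apply, h1, Pi.add_apply, h2, h3, h4]
  rcases lt_or_gt_of_ne h5 with h | h
  · simp [Set.indicator, h, h.le, abs_of_neg]
  · simp [Set.indicator, h, h.le, abs_of_pos]

theorem ae_abs {P : ℝ → Prop} (h : ∀ᵐ x, P x) : ∀ᵐ x : ℝ, P |x| := by
  filter_upwards [h, ae_comp_neg h] with x h1 h2
  rcases abs_choice x with e | e <;> rw [e] <;> assumption

/-- The derivative of the even extension jumps from $-W'(0)$ to $W'(0)$, and the Robin condition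
turns the jump $2W'(0)$ into $2qW(0)$. -/
theorem IsSobolevTwo.deltaHamiltonian_evenExt {q : ℝ} (hq : 0 < q) {w k : L2} {W W₁ : ℝ → ℂ}
    (h : IsSobolevTwo w k W W₁) (hw : robinInvolution q w = -w) :
    DeltaHamiltonian q (evenExt w) (evenExt k) := by
  have hR := h.robin hq hw
  obtain ⟨hd, hc, hW, w₁, e₁, d1, d2⟩ := h
  have hWc : Continuous W := continuous_iff_continuousAt.2 fun x => (hd x).continuousAt
  have D1 := d1.ext_halfLine 1
  have D2 := d2.ext_halfLine (-1)
  simp only [neg_neg, Complex.ofReal_one, one_smul, Complex.ofReal_neg] at D1 D2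
  refine ⟨fun x => W |x|, fun x => if 0 < x then W₁ x else -W₁ (-x),
    posOp w₁ + (-1 : ℂ) • reflectL2 (posOp w₁), evenExt (-(2 : ℂ) • k), W₁ 0, -W₁ 0,
    ⟨hWc.comp continuous_abs, ?_⟩, ?_, ?_, ⟨?_, ?_⟩, ⟨?_, ?_⟩, ?_, ?_⟩
  · filter_upwards [evenExt_ae w, ae_abs hW] with x h1 h2
    rw [h1, h2]
  · exact D1
  · exact D2
  · intro x hx
    rcases lt_or_gt_of_ne (show x ≠ 0 from hx) with h | h
    · refine ((hc.comp continuous_neg).neg.continuousAt.congr ?_).continuousWithinAt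
      filter_upwards [Iio_mem_nhds h] with y hy
      rw [if_neg (not_lt.2 (le_of_lt hy))]; rfl
    · refine (hc.continuousAt.congr ?_).continuousWithinAt
      filter_upwards [Ioi_mem_nhds h] with y hy
      rw [if_pos (Set.mem_Ioi.1 hy)]
  · filter_upwards [Lp.coeFn_add (posOp w₁) ((-1 : ℂ) • reflectL2 (posOp w₁)),
      Lp.coeFn_smul (-1 : ℂ) (reflectL2 (posOp w₁)), posOp_ae w₁,
      reflectL2_ae (posOp w₁), ae_comp_neg (posOp_ae w₁), e₁, ae_comp_neg e₁, ae_ne_zero]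
      with x h1 h2 h3 h4 h5 h6 h7 h8
    rw [h1, Pi.add_apply, h2, Pi.smul_apply, h3, h4, h5]
    rcases lt_or_gt_of_ne h8 with h | h
    · simp [Set.indicator, h, not_lt.2 h.le, h7]
    · simp [Set.indicator, h, not_lt.2 h.le, h6]
  · refine ((hc.tendsto 0).mono_left nhdsWithin_le_nhds).congr' ?_
    filter_upwards [self_mem_nhdsWithin] with y hy
    rw [if_pos (Set.mem_Ioi.1 hy)]
  · have := ((hc.comp continuous_neg).neg.tendsto 0).mono_left
      (nhdsWithin_le_nhds (s := Set.Iio (0 : ℝ)))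
    simp only [Function.comp_apply, neg_zero, Pi.neg_apply] at this
    refine this.congr' ?_
    filter_upwards [self_mem_nhdsWithin] with y hy
    rw [if_neg (not_lt.2 (le_of_lt hy))]; rfl
  · simp only [abs_zero]
    rw [hR]
    ring
  · rw [map_smul, smul_smul]; norm_num

/-- Differentiability of the group at `f` passes to its odd part and its lift, which evolve freely
and are therefore in $H^2$. Each is then mapped back into the domain of $H_q$, and their sum is `f`.
-/
theorem isUnitaryGroupOf_robinGroup {q : ℝ} (hq : 0 < q) :
    IsUnitaryGroupOf (DeltaHamiltonian q) (robinGroup q) := by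
  refine IsUnitaryGroupOf.of_symmetric (robinGroup_zero hq) (robinGroup_add hq)
    (norm_robinGroup hq) (continuous_robinGroup q) (fun f h hd => ?_)
    (fun f h g k hf hg => hf.symmetric hg)
  have h1 := (oddPart.restrictScalars ℝ).hasFDerivAt.comp_hasDerivAt 0 hd
  have h2 := ((evenLift q).restrictScalars ℝ).hasFDerivAt.comp_hasDerivAt 0 hd
  have e1 : (oddPart.restrictScalars ℝ) ∘ (fun t => robinGroup q t f) =
      fun t => freeGroup t (oddPart f) := funext fun t => oddPart_robinGroup q t f
  have e2 : ((evenLift q).restrictScalars ℝ) ∘ (fun t => robinGroup q t f) =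
      fun t => freeGroup t (evenLift q f) := funext fun t => evenLift_robinGroup hq t f
  rw [e1, ContinuousLinearMap.coe_restrictScalars', map_smul] at h1
  rw [e2, ContinuousLinearMap.coe_restrictScalars', map_smul] at h2
  obtain ⟨A, A₁, hA⟩ := isSobolevTwo_of_hasDerivAt_freeGroup h1
  obtain ⟨W, W₁, hW⟩ := isSobolevTwo_of_hasDerivAt_freeGroup h2
  -- An odd continuous function vanishes at the origin, so the point interaction does not act on it.
  have hA0 : A 0 = 0 := by
    have hAc : Continuous A := continuous_iff_continuousAt.2 fun x => (hA.1 x).continuousAt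
    have hodd : (fun x => A (-x)) = fun x => -A x := by
      refine ((hAc.comp continuous_neg).ae_eq_iff_eq volume hAc.neg).1 ?_
      filter_upwards [hA.2.2.1, ae_comp_neg hA.2.2.1, reflectL2_ae (oddPart f),
        Lp.coeFn_neg (oddPart f)] with x k1 k2 k3 k4
      rw [reflectL2_oddPart, k4, Pi.neg_apply, k1, k2] at k3
      exact k3.symm
    have := congrFun hodd 0
    simp only [neg_zero] at this
    linear_combination this / 2
  have key := (hA.deltaHamiltonian (q := q) (by rw [hA0, mul_zero])).add
    (hW.deltaHamiltonian_evenExt hq (robinInvolution_evenLift hq f))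
  have split : ∀ g : L2, oddPart g + evenExt (evenLift q g) = g := fun g => by
    have := robinGroup_zero hq g
    rwa [robinGroup_apply, freeGroup_zero, freeGroup_zero] at this
  rwa [split, split] at key

theorem deltaGroup_eq_robinGroup {q : ℝ} (hq : 0 < q) : deltaGroup q = robinGroup q :=
  (isUnitaryGroupOf_robinGroup hq).deltaGroup_eq

/-! ### $L^r$ norms of $L^2$ functions by duality -/

/-- The `L^r` norm of a class in `L²`, possibly infinite. -/
noncomputable abbrev rNorm (r : ℝ) (w : L2) : ℝ≥0∞ := eLpNorm w (ENNReal.ofReal r) volume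

theorem eLpNorm_ofReal_rpow {r : ℝ} (hr : 0 < r) {X E : Type*} [MeasurableSpace X] {μ : Measure X}
    [NormedAddCommGroup E] (f : X → E) :
    eLpNorm f (ENNReal.ofReal r) μ ^ r = ∫⁻ x, ‖f x‖ₑ ^ r ∂μ := by
  rw [eLpNorm_eq_lintegral_rpow_enorm_toReal (by simpa using hr) (by simp),
    ENNReal.toReal_ofReal hr.le, ← ENNReal.rpow_mul, one_div, inv_mul_cancel₀ hr.ne',
    ENNReal.rpow_one]

theorem eLpNorm_enorm_ofReal_rpow {r : ℝ} (hr : 0 < r) {X : Type*} [MeasurableSpace X]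
    {μ : Measure X} (f : X → ℝ≥0∞) :
    eLpNorm f (ENNReal.ofReal r) μ ^ r = ∫⁻ x, f x ^ r ∂μ := by
  rw [eLpNorm_eq_lintegral_rpow_enorm_toReal (by simpa using hr) (by simp),
    ENNReal.toReal_ofReal hr.le, ← ENNReal.rpow_mul, one_div, inv_mul_cancel₀ hr.ne',
    ENNReal.rpow_one]
  simp

theorem rNorm_rpow {r : ℝ} (hr : 0 < r) (w : L2) : rNorm r w ^ r = ∫⁻ x, ‖w x‖ₑ ^ r :=
  eLpNorm_ofReal_rpow hr w

theorem rNorm_eq {r : ℝ} (hr : 0 < r) (w : L2) : rNorm r w = (∫⁻ x, ‖w x‖ₑ ^ r) ^ (1 / r) := by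
  rw [← rNorm_rpow hr, ← ENNReal.rpow_mul, mul_one_div_cancel hr.ne', ENNReal.rpow_one]

theorem rNorm_two (w : L2) : rNorm 2 w = ‖w‖ₑ := by
  rw [Lp.enorm_def, rNorm, ENNReal.ofReal_ofNat]

theorem enorm_inner_le {r s : ℝ} (h : r.HolderConjugate s) (g w : L2) :
    ‖(inner ℂ g w : ℂ)‖ₑ ≤ rNorm r w * rNorm s g := by
  rw [L2.inner_eq, rNorm_eq h.pos, rNorm_eq h.symm.pos]
  refine (enorm_integral_le_lintegral_enorm _).trans ?_
  have := ENNReal.lintegral_mul_le_Lp_mul_Lq volume h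
    (Lp.aestronglyMeasurable w).enorm (Lp.aestronglyMeasurable g).enorm
  refine le_trans (le_of_eq ?_) this
  refine lintegral_congr fun x => ?_
  rw [enorm_mul, RCLike.enorm_conj]
  rfl

/-- Since $(r-2)s=(r-2)+(2-s)$ and $s\le2$, the surplus power $\min(a,k)^{2-s}$ is at most
$a^{2-s}$. For the truncated dual function $g$ of $w$ it says $\|g\|_s^s\le\langle g,w\rangle$. -/
theorem rpow_mul_min_le {a k r s : ℝ} (h : r.HolderConjugate s) (hr : 2 ≤ r) (ha : 0 ≤ a)
    (hk : 0 ≤ k) : (a * min a k ^ (r - 2)) ^ s ≤ a ^ 2 * min a k ^ (r - 2) := by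
  set m := min a k with hm
  have hm0 : 0 ≤ m := le_min ha hk
  have hs : s ≤ 2 := by
    have := h.inv_add_inv_eq_one
    have h3 : r⁻¹ ≤ 2⁻¹ := inv_anti₀ (by norm_num) hr
    have h4 : (2 : ℝ)⁻¹ ≤ s⁻¹ := by linarith
    exact (inv_le_inv₀ (by norm_num) h.symm.pos).1 h4
  rcases ha.eq_or_lt with h0 | h0
  · rw [← h0]; simp [Real.zero_rpow h.symm.ne_zero]
  rcases hm0.eq_or_lt with h1 | h1
  · rcases hr.eq_or_lt with h2 | h2
    · rw [← h2] at h ⊢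
      have : s = 2 := by
        have := h.inv_add_inv_eq_one
        have h5 : s⁻¹ = 2⁻¹ := by linarith
        exact inv_injective h5
      rw [this]; simp
    · rw [← h1, Real.zero_rpow (by linarith), mul_zero, Real.zero_rpow h.symm.ne_zero, mul_zero]
  have e1 : (r - 2) * s = (r - 2) + (2 - s) := by
    have := h.mul_eq_add; linarith
  rw [Real.mul_rpow h0.le (by positivity), ← Real.rpow_mul hm0, e1, Real.rpow_add h1]
  have e2 : a ^ 2 = a ^ s * a ^ (2 - s) := by
    rw [← Real.rpow_add h0]; norm_num
  rw [e2]
  have : m ^ (2 - s) ≤ a ^ (2 - s) := Real.rpow_le_rpow hm0 (min_le_left _ _) (by linarith)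
  calc a ^ s * (m ^ (r - 2) * m ^ (2 - s)) ≤ a ^ s * (m ^ (r - 2) * a ^ (2 - s)) := by gcongr
    _ = _ := by ring

/-- Duality: the `L^r` norm is determined by the pairings with `L² ∩ L^{r'}`. -/
theorem rNorm_le_of_inner_le {r s : ℝ} (h : r.HolderConjugate s) (hr : 2 ≤ r) {w : L2} {M : ℝ≥0∞}
    (H : ∀ g : L2, rNorm s g ≠ ⊤ → ‖(inner ℂ g w : ℂ)‖ₑ ≤ M * rNorm s g) : rNorm r w ≤ M := by
  rcases eq_or_ne M ⊤ with rfl | hM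
  · exact le_top
  have key : ∀ k : ℕ, ∫⁻ x, ENNReal.ofReal (‖w x‖ ^ 2 * min ‖w x‖ k ^ (r - 2)) ≤ M ^ r := by
    intro k
    -- The extremal test function $|w|^{r-2}w$ with its weight truncated at height `k`: it stays in
    -- $L^2$ and makes `A` finite, so that `A` may be divided out. Monotone convergence removes the
    -- truncation.
    set c : ℝ → ℝ := fun x => min ‖w x‖ k ^ (r - 2) with hc
    have hc0 : ∀ x, 0 ≤ c x := fun x => Real.rpow_nonneg (le_min (norm_nonneg _) k.cast_nonneg) _
    have hcb : ∀ x, c x ≤ (k : ℝ) ^ (r - 2) := fun x =>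
      Real.rpow_le_rpow (le_min (norm_nonneg _) k.cast_nonneg) (min_le_right _ _) (by linarith)
    have hcm : AEStronglyMeasurable c volume :=
      (((Lp.aestronglyMeasurable w).norm.aemeasurable.min aemeasurable_const).pow_const
        _).aestronglyMeasurable
    have hgm : MemLp (fun x => (c x : ℂ) * w x) 2 volume := by
      refine ((Lp.memLp w).const_mul ((k : ℝ) ^ (r - 2) : ℝ)).of_le
        ((Complex.continuous_ofReal.comp_aestronglyMeasurable hcm).mul (Lp.aestronglyMeasurable w))
        (Eventually.of_forall fun x => ?_)
      rw [norm_mul, norm_mul, Complex.norm_of_nonneg (hc0 x)]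
      have h1 : ‖((((k : ℝ) ^ (r - 2) : ℝ)) : ℝ)‖ = (k : ℝ) ^ (r - 2) :=
        Real.norm_of_nonneg (by positivity)
      simp only [Complex.norm_real, h1]
      gcongr
      exact hcb x
    set g : L2 := hgm.toLp with hg
    have hgae : g =ᵐ[volume] fun x => (c x : ℂ) * w x := hgm.coeFn_toLp
    have hin : (inner ℂ g w : ℂ) = ((∫ x, ‖w x‖ ^ 2 * c x : ℝ) : ℂ) := by
      rw [L2.inner_eq, ← integral_complex_ofReal]
      refine integral_congr_ae ?_
      filter_upwards [hgae] with x hx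
      rw [hx, map_mul, Complex.conj_ofReal, mul_left_comm, Complex.mul_conj]
      rw [Complex.normSq_eq_norm_sq]; push_cast; ring
    have hint : Integrable (fun x => ‖w x‖ ^ 2 * c x) volume := by
      refine ((Lp.memLp w).integrable_norm_pow (by norm_num)).mul_bdd (c := (k : ℝ) ^ (r - 2)) hcm
        (Eventually.of_forall fun x => ?_)
      rw [Real.norm_of_nonneg (hc0 x)]; exact hcb x
    have hnn : ∀ x, 0 ≤ ‖w x‖ ^ 2 * c x := fun x => mul_nonneg (by positivity) (hc0 x)
    set A := ∫⁻ x, ENNReal.ofReal (‖w x‖ ^ 2 * c x) with hA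
    have hAt : A ≠ ⊤ := by
      rw [hA, ← ofReal_integral_eq_lintegral_ofReal hint (Eventually.of_forall hnn)]; simp
    have hgA : rNorm s g ^ s ≤ A := by
      rw [rNorm_rpow h.symm.pos]
      refine lintegral_mono_ae ?_
      filter_upwards [hgae] with x hx
      rw [hx, ← ofReal_norm, ENNReal.ofReal_rpow_of_nonneg (norm_nonneg _) h.symm.nonneg]
      refine ENNReal.ofReal_le_ofReal ?_
      rw [norm_mul, Complex.norm_of_nonneg (hc0 x), mul_comm]
      exact rpow_mul_min_le h hr (norm_nonneg _) k.cast_nonneg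
    have hgA2 : rNorm s g ≤ A ^ (1 / s) := by
      rw [one_div, ENNReal.le_rpow_inv_iff h.symm.pos]; exact hgA
    have h1 : A ≤ M * A ^ (1 / s) := by
      have h2 : ‖(inner ℂ g w : ℂ)‖ₑ = A := by
        rw [hin, ← ofReal_norm, Complex.norm_of_nonneg (integral_nonneg hnn),
          ofReal_integral_eq_lintegral_ofReal hint (Eventually.of_forall hnn)]
      rw [← h2]
      refine (H g (ne_top_of_le_ne_top ?_ hgA2)).trans ?_
      · exact ENNReal.rpow_ne_top_of_nonneg (by have := h.symm.pos; positivity) hAt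
      · rw [h2]; gcongr
    change A ≤ M ^ r
    rcases eq_or_ne A 0 with h0 | h0
    · rw [h0]; exact zero_le
    have h3 : A ^ (1 / r) * A ^ (1 / s) = A := by
      rw [← ENNReal.rpow_add _ _ h0 hAt, one_div, one_div, h.inv_add_inv_eq_one, ENNReal.rpow_one]
    have h4 : A ^ (1 / r) ≤ M := by
      have h5 : A ^ (1 / s) ≠ 0 := by
        simp [ENNReal.rpow_eq_zero_iff, h0, hAt]
      have h6 : A ^ (1 / s) ≠ ⊤ :=
        ENNReal.rpow_ne_top_of_nonneg (by have := h.symm.pos; positivity) hAt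
      rw [← ENNReal.mul_le_mul_iff_left h5 h6, h3]
      exact h1
    rwa [one_div, ENNReal.rpow_inv_le_iff h.pos] at h4
  have hlim : ∫⁻ x, ‖w x‖ₑ ^ r ≤ M ^ r := by
    have e : ∀ x, ‖w x‖ₑ ^ r = ⨆ k : ℕ, ENNReal.ofReal (‖w x‖ ^ 2 * min ‖w x‖ k ^ (r - 2)) := by
      intro x
      have e1 : ‖w x‖ₑ ^ r = ENNReal.ofReal (‖w x‖ ^ 2 * ‖w x‖ ^ (r - 2)) := by
        rw [← ofReal_norm, ENNReal.ofReal_rpow_of_nonneg (norm_nonneg _) h.nonneg]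
        congr 1
        rcases (norm_nonneg (w x)).eq_or_lt with h0 | h0
        · rw [← h0, Real.zero_rpow h.ne_zero]; simp
        · rw [← Real.rpow_natCast, ← Real.rpow_add h0]; congr 1; push_cast; ring
      refine le_antisymm ?_ (iSup_le fun k => ?_)
      · obtain ⟨k, hk⟩ := exists_nat_ge ‖w x‖
        refine le_iSup_of_le k ?_
        rw [min_eq_left hk, e1]
      · rw [e1]
        refine ENNReal.ofReal_le_ofReal ?_
        gcongr
        exact min_le_left _ _
    simp_rw [e]
    rw [lintegral_iSup']
    · exact iSup_le key
    · intro k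
      refine AEMeasurable.ennreal_ofReal ?_
      exact ((Lp.aestronglyMeasurable w).norm.aemeasurable.pow_const 2).mul
        (((Lp.aestronglyMeasurable w).norm.aemeasurable.min aemeasurable_const).pow_const _)
    · refine Eventually.of_forall fun x i j hij => ?_
      refine ENNReal.ofReal_le_ofReal ?_
      gcongr
  rw [rNorm_eq h.pos, one_div, ENNReal.rpow_inv_le_iff h.pos]
  exact hlim

/-- By duality the set is an intersection of closed conditions on pairings. So the $L^r$ norm,
though not continuous on $L^2$, is lower semicontinuous, which makes it measurable along continuous
curves. -/
theorem isClosed_rNorm_le {r s : ℝ} (h : r.HolderConjugate s) (hr : 2 ≤ r) (M : ℝ≥0∞) :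
    IsClosed {w : L2 | rNorm r w ≤ M} := by
  rcases eq_or_ne M ⊤ with rfl | hM
  · simp
  have : {w : L2 | rNorm r w ≤ M} =
      ⋂ (g : L2) (_ : rNorm s g ≠ ⊤), {w : L2 | ‖(inner ℂ g w : ℂ)‖ₑ ≤ M * rNorm s g} := by
    ext w
    simp only [Set.mem_ofPred_eq, Set.mem_iInter]
    refine ⟨fun hw g _ => (enorm_inner_le h g w).trans (by gcongr), fun hw =>
      rNorm_le_of_inner_le h hr hw⟩
  rw [this]
  refine isClosed_iInter fun g => isClosed_iInter fun _ => isClosed_le ?_ continuous_const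
  fun_prop

theorem measurable_rNorm {r s : ℝ} (h : r.HolderConjugate s) (hr : 2 ≤ r) {u : ℝ → L2}
    (hu : Continuous u) : Measurable fun t => rNorm r (u t) := by
  refine measurable_of_Iic fun M => ?_
  exact ((isClosed_rNorm_le h hr M).preimage hu).measurableSet

/-- Minkowski's inequality for integrals. -/
theorem rNorm_integral_le {r s : ℝ} (h : r.HolderConjugate s) (hr : 2 ≤ r) {μ : Measure ℝ}
    {G : ℝ → L2} (hG : Integrable G μ) :
    rNorm r (∫ t, G t ∂μ) ≤ ∫⁻ t, rNorm r (G t) ∂μ := by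
  refine rNorm_le_of_inner_le h hr fun g hg => ?_
  rw [← integral_inner hG, ← lintegral_mul_const' _ _ hg]
  refine (enorm_integral_le_lintegral_enorm _).trans (lintegral_mono fun t => ?_)
  exact enorm_inner_le h g (G t)

theorem rNorm_add_le {r : ℝ} (hr : 1 ≤ r) (f g : L2) :
    rNorm r (f + g) ≤ rNorm r f + rNorm r g := by
  rw [rNorm, eLpNorm_congr_ae (Lp.coeFn_add f g)]
  exact eLpNorm_add_le (Lp.aestronglyMeasurable f) (Lp.aestronglyMeasurable g) (by simpa using hr)

theorem rNorm_smul (r : ℝ) (c : ℂ) (f : L2) : rNorm r (c • f) = ‖c‖ₑ * rNorm r f := by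
  rw [rNorm, eLpNorm_congr_ae (Lp.coeFn_smul c f), eLpNorm_const_smul]

theorem rNorm_neg (r : ℝ) (f : L2) : rNorm r (-f) = rNorm r f := by
  rw [rNorm, eLpNorm_congr_ae (Lp.coeFn_neg f), eLpNorm_neg]

theorem rNorm_sub_le {r : ℝ} (hr : 1 ≤ r) (f g : L2) :
    rNorm r (f - g) ≤ rNorm r f + rNorm r g := by
  rw [sub_eq_add_neg, ← rNorm_neg r g]
  exact rNorm_add_le hr _ _

theorem rNorm_reflectL2 (r : ℝ) (f : L2) : rNorm r (reflectL2 f) = rNorm r f := by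
  rw [rNorm, eLpNorm_congr_ae (reflectL2_ae f)]
  exact eLpNorm_comp_measurePreserving (Lp.aestronglyMeasurable f) (Measure.measurePreserving_neg _)

theorem rNorm_translateL2 (r y : ℝ) (f : L2) : rNorm r (translateL2 y f) = rNorm r f := by
  rw [rNorm, eLpNorm_congr_ae (translateL2_ae y f)]
  exact eLpNorm_comp_measurePreserving (Lp.aestronglyMeasurable f)
    (measurePreserving_sub_right volume y)

theorem rNorm_restrictOp_le (r : ℝ) {s : Set ℝ} (hs : MeasurableSet s) (f : L2) :
    rNorm r (restrictOp s f) ≤ rNorm r f := by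
  rw [rNorm, eLpNorm_congr_ae (restrictOp_ae hs f)]
  exact eLpNorm_indicator_le _

/-- Convolution with the exponential density does not increase `L^r` norms. -/
theorem rNorm_causalOp_le {r s : ℝ} (h : r.HolderConjugate s) (hr : 2 ≤ r) {q : ℝ} (hq : 0 < q)
    (f : L2) : rNorm r (causalOp q f) ≤ rNorm r f := by
  refine rNorm_le_of_inner_le h hr fun g hg => ?_
  rw [inner_causalOp hq]
  have hk : ∫⁻ u, ENNReal.ofReal (expDensity q u) = 1 := by
    rw [← ofReal_integral_eq_lintegral_ofReal (integrable_expDensity hq)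
      (Eventually.of_forall (expDensity_nonneg hq)), integral_expDensity hq, ENNReal.ofReal_one]
  calc _ ≤ ∫⁻ u, ‖(expDensity q u : ℂ) * inner ℂ g (translateL2 u f)‖ₑ :=
        enorm_integral_le_lintegral_enorm _
    _ ≤ ∫⁻ u, ENNReal.ofReal (expDensity q u) * (rNorm r f * rNorm s g) := by
        refine lintegral_mono fun u => ?_
        rw [enorm_mul, ← rNorm_translateL2 r u f]
        refine mul_le_mul' (le_of_eq ?_) (enorm_inner_le h g _)
        rw [← ofReal_norm, Complex.norm_of_nonneg (expDensity_nonneg hq u)]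
    _ = _ := by
        rw [lintegral_mul_const _ (measurable_expDensity q).ennreal_ofReal, hk, one_mul]

theorem rNorm_rpow_le_of_ae_norm_le {r K : ℝ} (hr : 2 ≤ r) {w : L2}
    (hw : ∀ᵐ x, ‖w x‖ ≤ K) :
    rNorm r w ^ r ≤ ENNReal.ofReal K ^ (r - 2) * ‖w‖ₑ ^ (2 : ℝ) := by
  rw [rNorm_rpow (by linarith), ← rNorm_two w, rNorm_rpow two_pos,
    ← lintegral_const_mul' _ _ (ENNReal.rpow_ne_top_of_nonneg (by linarith) (by simp))]
  refine lintegral_mono_ae ?_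
  filter_upwards [hw] with x hx
  have e : ‖w x‖ₑ ^ r = ‖w x‖ₑ ^ (r - 2) * ‖w x‖ₑ ^ (2 : ℝ) := by
    rw [← ENNReal.rpow_add_of_nonneg _ _ (by linarith) (by norm_num)]
    congr 1; ring
  rw [e]
  gcongr
  rw [← ofReal_norm]; exact ENNReal.ofReal_le_ofReal hx

/-- The smoothing effect of the convolution with the exponential density. -/
theorem exists_rNorm_causalOp_le {q : ℝ} (hq : 0 < q) {r : ℝ} (hr : 2 ≤ r) :
    ∃ c : ℝ≥0∞, c ≠ ⊤ ∧ ∀ f : L2, rNorm r (causalOp q f) ≤ c * ‖f‖ₑ := by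
  obtain ⟨K, hK⟩ : ∃ K : ℝ, ∀ x, ‖causalSymbol q x‖ ≤ K := (bddMeas_causalSymbol hq).2
  have hK0 : 0 ≤ K := (norm_nonneg _).trans (hK 0)
  obtain ⟨k, hk⟩ : ∃ k, k = ‖(memLp_expDensity hq).toLp‖ := ⟨_, rfl⟩
  have hk0 : 0 ≤ k := hk ▸ norm_nonneg _
  refine ⟨(ENNReal.ofReal k ^ (r - 2) * ENNReal.ofReal K ^ (2 : ℝ)) ^ (1 / r), ?_, fun f => ?_⟩
  · refine ENNReal.rpow_ne_top_of_nonneg (by positivity) (ENNReal.mul_ne_top ?_ ?_)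
    · exact ENNReal.rpow_ne_top_of_nonneg (by linarith) (by simp)
    · exact ENNReal.rpow_ne_top_of_nonneg (by norm_num) (by simp)
  have hr0 : 0 < r := by linarith
  have h0 := ae_norm_causalOp_le hq f
  rw [← hk] at h0
  have h1 := rNorm_rpow_le_of_ae_norm_le hr h0
  have h2 : ‖causalOp q f‖ₑ ≤ ENNReal.ofReal K * ‖f‖ₑ := by
    rw [← ofReal_norm, ← ofReal_norm, ← ENNReal.ofReal_mul hK0]
    exact ENNReal.ofReal_le_ofReal (norm_fourierMul_le (bddMeas_causalSymbol hq).1 hK f)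
  rw [← ENNReal.rpow_le_rpow_iff hr0, ENNReal.mul_rpow_of_nonneg _ _ hr0.le, ← ENNReal.rpow_mul,
    one_div_mul_cancel hr0.ne', ENNReal.rpow_one]
  refine h1.trans ?_
  calc _ ≤ ENNReal.ofReal (k * ‖f‖) ^ (r - 2) * (ENNReal.ofReal K * ‖f‖ₑ) ^ (2 : ℝ) := by gcongr
    _ = _ := by
      rw [ENNReal.ofReal_mul hk0, ofReal_norm,
        ENNReal.mul_rpow_of_nonneg _ _ (by linarith : (0 : ℝ) ≤ r - 2),
        ENNReal.mul_rpow_of_nonneg _ _ (by norm_num : (0 : ℝ) ≤ 2)]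
      have e : ‖f‖ₑ ^ r = ‖f‖ₑ ^ (r - 2) * ‖f‖ₑ ^ (2 : ℝ) := by
        rw [← ENNReal.rpow_add_of_nonneg _ _ (by linarith) (by norm_num)]
        congr 1; ring
      rw [e]; ring

theorem evenExt_reflectL2 (f : L2) :
    evenExt (reflectL2 f) = reflectL2 (negOp f) + negOp f := by
  rw [evenExt_apply, ← reflectL2_negOp, reflectL2_reflectL2]

theorem rNorm_evenExt_reflectL2_le {r : ℝ} (hr : 1 ≤ r) (f : L2) :
    rNorm r (evenExt (reflectL2 f)) ≤ 2 * rNorm r (negOp f) := by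
  rw [evenExt_reflectL2]
  refine (rNorm_add_le hr _ _).trans (le_of_eq ?_)
  rw [rNorm_reflectL2, two_mul]

/-- Even extension after reflection only reads $x<0$, and by causality $C$ there only reads $x<0$ as
well. This is the mechanism by which waves far to the right do not see the delta. -/
theorem rNorm_evenExt_reflectL2_causalOp_le {r s : ℝ} (h : r.HolderConjugate s) (hr : 2 ≤ r)
    {q : ℝ} (hq : 0 < q) (f : L2) :
    rNorm r (evenExt (reflectL2 (causalOp q f))) ≤ 2 * rNorm r (negOp f) := by
  refine (rNorm_evenExt_reflectL2_le (by linarith) _).trans ?_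
  rw [negOp_causalOp hq]
  gcongr
  exact (rNorm_restrictOp_le r measurableSet_Iio _).trans (rNorm_causalOp_le h hr hq _)

/-! ### The $L^1\to L^\infty$ dispersive estimate -/

/-- The symbol of the free propagator damped by a Gaussian. -/
noncomputable def dampedSymbol (ε t x : ℝ) : ℂ :=
  Complex.exp (-(2 * Real.pi ^ 2 * (ε + t * Complex.I)) * x ^ 2)

theorem dampedSymbol_eq (ε t x : ℝ) :
    dampedSymbol ε t x = dampedSymbol ε 0 x * freeSymbol t x := by
  rw [dampedSymbol, dampedSymbol, freeSymbol, ← Complex.exp_add]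
  congr 1; push_cast; ring

theorem norm_dampedSymbol (ε t x : ℝ) :
    ‖dampedSymbol ε t x‖ = Real.exp (-(2 * Real.pi ^ 2 * ε * x ^ 2)) := by
  rw [dampedSymbol, Complex.norm_exp]
  congr 1
  have : -(2 * (Real.pi : ℂ) ^ 2 * (ε + t * Complex.I)) * (x : ℂ) ^ 2 =
      ((-(2 * Real.pi ^ 2 * ε * x ^ 2) : ℝ) : ℂ) +
        ((-(2 * Real.pi ^ 2 * t * x ^ 2) : ℝ) : ℂ) * Complex.I := by
    push_cast; ring
  rw [this, Complex.add_re, Complex.ofReal_re, Complex.re_ofReal_mul, Complex.I_re, mul_zero,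
    add_zero]

theorem norm_dampedSymbol_le {ε : ℝ} (hε : 0 ≤ ε) (t x : ℝ) : ‖dampedSymbol ε t x‖ ≤ 1 := by
  rw [norm_dampedSymbol]
  exact Real.exp_le_one_iff.2 (neg_nonpos.2 (by positivity))

theorem continuous_dampedSymbol (ε t : ℝ) : Continuous (dampedSymbol ε t) := by
  unfold dampedSymbol; fun_prop

theorem bddMeas_dampedSymbol {ε : ℝ} (hε : 0 ≤ ε) (t : ℝ) : BddMeas (dampedSymbol ε t) :=
  ⟨(continuous_dampedSymbol ε t).measurable, 1, norm_dampedSymbol_le hε t⟩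

theorem integrable_dampedSymbol {ε : ℝ} (hε : 0 < ε) (t : ℝ) : Integrable (dampedSymbol ε t) := by
  refine (integrable_exp_neg_mul_sq (b := 2 * Real.pi ^ 2 * ε) (by positivity)).mono
    (continuous_dampedSymbol ε t).aestronglyMeasurable (Eventually.of_forall fun x => ?_)
  rw [norm_dampedSymbol, Real.norm_of_nonneg (Real.exp_pos _).le, neg_mul]

/-- The integral is an explicit Gaussian whose exponential factor has modulus at most one. In the
prefactor $(\pi/b)^{1/2}$ one uses $|b|\ge|\operatorname{Im}b|=2\pi^2|t|$, so the bound is uniform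
in the damping. -/
theorem norm_fourier_dampedSymbol_le {ε t : ℝ} (hε : 0 < ε) (ht : t ≠ 0) (y : ℝ) :
    ‖∫ v : ℝ, Complex.exp (Complex.I * y * v) * dampedSymbol ε t v‖ ≤
      (1 / (2 * Real.pi * |t|)) ^ (1 / 2 : ℝ) := by
  set b : ℂ := 2 * Real.pi ^ 2 * (ε + t * Complex.I) with hb
  have hb' : b = ((2 * Real.pi ^ 2 * ε : ℝ) : ℂ) + ((2 * Real.pi ^ 2 * t : ℝ) : ℂ) * Complex.I := by
    rw [hb]; push_cast; ring
  have hre : b.re = 2 * Real.pi ^ 2 * ε := by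
    rw [hb', Complex.add_re, Complex.ofReal_re, Complex.re_ofReal_mul, Complex.I_re, mul_zero,
      add_zero]
  have him : b.im = 2 * Real.pi ^ 2 * t := by
    rw [hb', Complex.add_im, Complex.ofReal_im, Complex.im_ofReal_mul, Complex.I_im, mul_one,
      zero_add]
  have hre0 : 0 < b.re := by rw [hre]; positivity
  have h := fourierIntegral_gaussian hre0 y
  unfold dampedSymbol
  rw [← hb, h, norm_mul]
  have h1 : ‖Complex.exp (-(y : ℂ) ^ 2 / (4 * b))‖ ≤ 1 := by
    rw [Complex.norm_exp, Real.exp_le_one_iff]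
    have : -(y : ℂ) ^ 2 / (4 * b) = ((-(y ^ 2 / 4) : ℝ) : ℂ) * b⁻¹ := by
      push_cast
      rw [div_eq_mul_inv, mul_inv]; ring
    rw [this, Complex.re_ofReal_mul, Complex.inv_re]
    have : 0 ≤ b.re / Complex.normSq b := div_nonneg hre0.le (Complex.normSq_nonneg _)
    nlinarith [sq_nonneg y]
  have h2 : ‖((Real.pi : ℂ) / b) ^ (1 / 2 : ℂ)‖ ≤ (1 / (2 * Real.pi * |t|)) ^ (1 / 2 : ℝ) := by
    have : (1 / 2 : ℂ) = ((1 / 2 : ℝ) : ℂ) := by push_cast; ring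
    rw [this, Complex.norm_cpow_real]
    refine Real.rpow_le_rpow (norm_nonneg _) ?_ (by norm_num)
    rw [norm_div, Complex.norm_real, Real.norm_of_nonneg Real.pi_pos.le]
    have h3 : 2 * Real.pi ^ 2 * |t| ≤ ‖b‖ := by
      refine le_trans (le_of_eq ?_) (Complex.abs_im_le_norm b)
      rw [him, abs_mul, abs_of_nonneg (by positivity : (0 : ℝ) ≤ 2 * Real.pi ^ 2)]
    have ht' : 0 < |t| := abs_pos.2 ht
    calc Real.pi / ‖b‖ ≤ Real.pi / (2 * Real.pi ^ 2 * |t|) := by gcongr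
      _ = _ := by field_simp
  calc _ ≤ (1 / (2 * Real.pi * |t|)) ^ (1 / 2 : ℝ) * 1 := by gcongr
    _ = _ := mul_one _

/-- The damped symbol is integrable, so the Fourier integral can be moved from `f` onto the
Gaussian, giving a convolution with a bounded kernel. -/
theorem ae_norm_dampedGroup_le {ε t : ℝ} (hε : 0 < ε) (ht : t ≠ 0) {f : L2}
    (hf : Integrable f volume) :
    ∀ᵐ x, ‖fourierMul (dampedSymbol ε t) f x‖ ≤
      (1 / (2 * Real.pi * |t|)) ^ (1 / 2 : ℝ) * ∫ y, ‖f y‖ := by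
  have hc : Continuous (𝓕 (f : ℝ → ℂ)) :=
    VectorFourier.fourierIntegral_continuous Real.continuous_fourierChar
      (by exact continuous_inner) hf
  set h : L2 := mulOp (dampedSymbol ε t) (fourierL2 f) with hh
  have hae : h =ᵐ[volume] fun v => dampedSymbol ε t v * 𝓕 (f : ℝ → ℂ) v := by
    filter_upwards [mulOp_ae (bddMeas_dampedSymbol hε.le t) (fourierL2 f), fourierL2_ae_eq f hf]
      with x h1 h2
    rw [hh, h1, h2]
  have hi : Integrable h volume := by
    refine Integrable.congr ?_ hae.symm
    refine (integrable_dampedSymbol hε t).mul_bdd (c := ∫ y, ‖f y‖) hc.aestronglyMeasurable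
      (Eventually.of_forall fun x => ?_)
    exact VectorFourier.norm_fourierIntegral_le_integral_norm _ _ _ _ _
  rw [fourierMul_apply]
  filter_upwards [fourierL2_symm_ae_eq h hi] with x hx
  rw [hx, Real.fourierInv_congr_ae hae, Real.fourierInv_eq']
  set g : ℝ → ℂ := fun v => Complex.exp (Complex.I * (2 * Real.pi * x) * v) * dampedSymbol ε t v
    with hg
  have hgi : Integrable g volume := by
    refine (integrable_dampedSymbol hε t).mono (Continuous.aestronglyMeasurable ?_)
      (Eventually.of_forall fun v => ?_)
    · exact (by fun_prop : Continuous fun v : ℝ => _).mul (continuous_dampedSymbol ε t)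
    · rw [hg, norm_mul]
      have : Complex.I * (2 * Real.pi * x) * v = ((2 * Real.pi * x * v : ℝ) : ℂ) * Complex.I := by
        push_cast; ring
      rw [this, Complex.norm_exp_ofReal_mul_I, one_mul]
  have e1 : ∫ v : ℝ, Complex.exp (((2 * Real.pi * inner ℝ v x : ℝ) : ℂ) * Complex.I) •
      (dampedSymbol ε t v * 𝓕 (f : ℝ → ℂ) v) = ∫ v, 𝓕 (f : ℝ → ℂ) v • g v := by
    congr 1; ext v
    simp only [hg, smul_eq_mul, RCLike.inner_apply, conj_trivial]
    rw [show (((2 * Real.pi * (x * v) : ℝ) : ℂ) * Complex.I) = Complex.I * (2 * Real.pi * x) * v by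
      push_cast; ring]
    ring
  have e2 := VectorFourier.integral_fourierIntegral_smul_eq_flip (L := innerₗ ℝ)
    (μ := (volume : Measure ℝ)) (ν := (volume : Measure ℝ))
    Real.continuous_fourierChar (by exact continuous_inner) hf hgi
  rw [e1]
  refine (le_of_eq (congrArg norm e2)).trans ?_
  rw [← integral_const_mul]
  refine norm_integral_le_of_norm_le (hf.norm.const_mul _) (Eventually.of_forall fun y => ?_)
  rw [norm_smul, mul_comm]
  gcongr
  have e3 : VectorFourier.fourierIntegral Real.fourierChar volume (innerₗ ℝ).flip g y =
      ∫ v : ℝ, Complex.exp (Complex.I * ((2 * Real.pi * (x - y) : ℝ) : ℂ) * v) *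
        dampedSymbol ε t v := by
    rw [VectorFourier.fourierIntegral]
    congr 1; ext v
    rw [Circle.smul_def, Real.fourierChar_apply, hg]
    simp only [smul_eq_mul]
    rw [← mul_assoc, ← Complex.exp_add]
    congr 2
    simp [innerₗ_apply_apply]
    ring
  rw [e3]
  exact norm_fourier_dampedSymbol_le hε ht _

/-- For contractions $T_n$ with $\langle u,T_nu\rangle\to\|u\|^2$ one has
$\|T_nu-u\|^2\le2\|u\|^2-2\operatorname{Re}\langle u,T_nu\rangle\to0$. -/
theorem tendsto_fourierMul_dampedSymbol (u : L2) {ε : ℕ → ℝ} (h0 : ∀ n, 0 ≤ ε n)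
    (hε : Tendsto ε atTop (𝓝 0)) :
    Tendsto (fun n => fourierMul (dampedSymbol (ε n) 0) u) atTop (𝓝 u) := by
  have hw : Tendsto (fun n => inner ℂ u (fourierMul (dampedSymbol (ε n) 0) u)) atTop
      (𝓝 (inner ℂ u u)) := by
    have e : inner ℂ u u = ∫ x, fourierL2 u x * (starRingEnd ℂ) (fourierL2 u x) := by
      rw [← L2.inner_eq, fourierL2.inner_map_map]
    rw [e]
    simp only [fun n => inner_fourierMul (bddMeas_dampedSymbol (h0 n) 0) u u]
    refine tendsto_integral_of_dominated_convergence
      (fun x => ‖fourierL2 u x * (starRingEnd ℂ) (fourierL2 u x)‖) (fun n => ?_)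
      (integrable_mul_conj _ _).norm (fun n => Eventually.of_forall fun x => ?_)
      (Eventually.of_forall fun x => ?_)
    · exact (continuous_dampedSymbol _ _).aestronglyMeasurable.mul (integrable_mul_conj _ _).1
    · rw [norm_mul]
      exact mul_le_of_le_one_left (norm_nonneg _) (norm_dampedSymbol_le (h0 n) 0 x)
    · have : Continuous fun s : ℝ => dampedSymbol s 0 x := by unfold dampedSymbol; fun_prop
      have h1 := (this.tendsto 0).comp hε
      have h2 : dampedSymbol 0 0 x = 1 := by simp [dampedSymbol]
      rw [h2] at h1
      simpa using h1.mul_const (fourierL2 u x * (starRingEnd ℂ) (fourierL2 u x))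
  rw [tendsto_iff_norm_sub_tendsto_zero]
  have h2 : Tendsto (fun n => ‖fourierMul (dampedSymbol (ε n) 0) u - u‖ ^ 2) atTop (𝓝 0) := by
    have h3 := ((RCLike.continuous_re.tendsto _).comp hw).const_mul 2 |>.const_sub (2 * ‖u‖ ^ 2)
    rw [inner_self_eq_norm_sq, sub_self] at h3
    refine squeeze_zero (fun n => by positivity) (fun n => ?_) h3
    have h4 := norm_fourierMul_le (bddMeas_dampedSymbol (h0 n) 0).1
      (norm_dampedSymbol_le (h0 n) 0) u
    rw [← norm_neg, neg_sub, @norm_sub_sq ℂ]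
    simp only [Function.comp_apply]
    rw [one_mul] at h4
    nlinarith [norm_nonneg (fourierMul (dampedSymbol (ε n) 0) u)]
  simpa [Real.sqrt_sq] using h2.sqrt

/-- The `L¹ → L^∞` dispersive estimate. -/
theorem ae_norm_freeGroup_le {t : ℝ} (ht : t ≠ 0) {f : L2} (hf : Integrable f volume) :
    ∀ᵐ x, ‖freeGroup t f x‖ ≤ (1 / (2 * Real.pi * |t|)) ^ (1 / 2 : ℝ) * ∫ y, ‖f y‖ := by
  have h1 := tendsto_fourierMul_dampedSymbol (freeGroup t f) (ε := fun n : ℕ => 1 / ((n : ℝ) + 1))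
    (fun n => by positivity) tendsto_one_div_add_atTop_nhds_zero_nat
  obtain ⟨ns, -, h2⟩ := (tendstoInMeasure_of_tendsto_Lp h1).exists_seq_tendsto_ae
  have h3 : ∀ᵐ x, ∀ n : ℕ, ‖fourierMul (dampedSymbol (1 / ((n : ℝ) + 1)) t) f x‖ ≤
      (1 / (2 * Real.pi * |t|)) ^ (1 / 2 : ℝ) * ∫ y, ‖f y‖ :=
    ae_all_iff.2 fun n => ae_norm_dampedGroup_le (by positivity) ht hf
  filter_upwards [h2, h3] with x hx h4
  refine le_of_tendsto hx.norm (Eventually.of_forall fun n => ?_)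
  have e : fourierMul (dampedSymbol (1 / (((ns n : ℕ) : ℝ) + 1)) 0) (freeGroup t f) =
      fourierMul (dampedSymbol (1 / (((ns n : ℕ) : ℝ) + 1)) t) f := by
    rw [freeGroup, fourierMul_fourierMul (bddMeas_dampedSymbol (by positivity) 0)
      (bddMeas_freeSymbol t)]
    congr 2; ext x
    rw [dampedSymbol_eq _ t]
  rw [e]
  exact h4 (ns n)

/-! ### Real interpolation and the $L^{r'}\to L^r$ dispersive estimate -/

theorem lintegral_Ioo_mul_rpow {p a : ℝ} (hp : 0 < p) (ha : 0 ≤ a) :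
    ∫⁻ σ in Set.Ioo 0 a, ENNReal.ofReal (p * σ ^ (p - 1)) = ENNReal.ofReal (a ^ p) := by
  have hi := (intervalIntegral.intervalIntegrable_rpow' (a := 0) (b := a)
    (by linarith : -1 < p - 1)).const_mul p
  rw [← ofReal_integral_eq_lintegral_ofReal
    ((intervalIntegrable_iff_integrableOn_Ioo_of_le ha).1 hi)
    ((ae_restrict_mem measurableSet_Ioo).mono fun σ hσ =>
      mul_nonneg hp.le (Real.rpow_nonneg hσ.1.le _))]
  congr 1
  rw [← integral_Ioc_eq_integral_Ioo, ← intervalIntegral.integral_of_le ha,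
    intervalIntegral.integral_const_mul, integral_rpow (Or.inl (by linarith)), sub_add_cancel,
    Real.zero_rpow hp.ne', sub_zero]
  field_simp

/-- The layer-cake formula for a single extended nonnegative real. -/
theorem lintegral_Ioi_indicator_rpow {p : ℝ} (hp : 0 < p) (g : ℝ≥0∞) :
    ∫⁻ σ in Set.Ioi (0 : ℝ), {σ : ℝ | ENNReal.ofReal σ < g}.indicator
      (fun σ => ENNReal.ofReal (p * σ ^ (p - 1))) σ = g ^ p := by
  have hm : ∀ g : ℝ≥0∞, MeasurableSet {σ : ℝ | ENNReal.ofReal σ < g} := fun g =>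
    ENNReal.measurable_ofReal measurableSet_Iio
  have key : ∀ a : ℝ, 0 ≤ a → ∫⁻ σ in Set.Ioi (0 : ℝ),
      {σ : ℝ | ENNReal.ofReal σ < ENNReal.ofReal a}.indicator
      (fun σ => ENNReal.ofReal (p * σ ^ (p - 1))) σ = ENNReal.ofReal a ^ p := by
    intro a ha
    rw [lintegral_indicator (hm _), Measure.restrict_restrict (hm _)]
    have : {σ : ℝ | ENNReal.ofReal σ < ENNReal.ofReal a} ∩ Set.Ioi 0 = Set.Ioo 0 a := by
      ext σ
      simp only [Set.mem_inter_iff, Set.mem_ofPred_eq, Set.mem_Ioi, Set.mem_Ioo]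
      constructor
      · rintro ⟨h1, h2⟩
        exact ⟨h2, (ENNReal.ofReal_lt_ofReal_iff_of_nonneg h2.le).1 h1⟩
      · rintro ⟨h1, h2⟩
        exact ⟨(ENNReal.ofReal_lt_ofReal_iff_of_nonneg h1.le).2 h2, h1⟩
    rw [this, lintegral_Ioo_mul_rpow hp ha, ENNReal.ofReal_rpow_of_nonneg ha hp.le]
  rcases eq_or_ne g ⊤ with rfl | hg
  · rw [ENNReal.top_rpow_of_pos hp]
    refine ENNReal.eq_top_of_forall_nnreal_le fun r => ?_
    have h1 := key (r ^ (1 / p) : ℝ) (by positivity)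
    rw [ENNReal.ofReal_rpow_of_nonneg (by positivity) hp.le, ← Real.rpow_mul r.coe_nonneg,
      one_div_mul_cancel hp.ne', Real.rpow_one, ENNReal.ofReal_coe_nnreal] at h1
    rw [← h1]
    refine lintegral_mono fun σ => ?_
    refine Set.indicator_le_indicator_of_subset (fun x hx => ?_) (fun _ => zero_le) _
    exact lt_of_lt_of_le hx (b := ENNReal.ofReal (r ^ (1 / p) : ℝ)) le_top
  · rw [← ENNReal.ofReal_toReal hg]
    exact key _ ENNReal.toReal_nonneg

/-- Real interpolation: a bound on the level sets of `F` by truncations of `G` gives a bound on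
its `L^p` norm. -/
theorem lintegral_rpow_le_of_level {X Y : Type*} [MeasurableSpace X] [MeasurableSpace Y]
    {μ : Measure X} {ν : Measure Y} [SFinite μ] [SFinite ν] {F : X → ℝ≥0∞} {G L : Y → ℝ≥0∞}
    (hF : Measurable F) (hG : Measurable G) (hL : Measurable L) {p a A : ℝ} (ha : a < p)
    (hp : 0 < p) (hA : 0 ≤ A)
    (h : ∀ σ : ℝ, 0 < σ → μ {x | ENNReal.ofReal σ < F x} ≤
      ENNReal.ofReal (A * σ ^ (-a)) * ∫⁻ y in {y | ENNReal.ofReal σ < L y}, G y ∂ν) :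
    ∫⁻ x, F x ^ p ∂μ ≤ ENNReal.ofReal (p / (p - a) * A) * ∫⁻ y, G y * L y ^ (p - a) ∂ν := by
  have hpa : 0 < p - a := by linarith
  have hmF : MeasurableSet {z : X × ℝ | ENNReal.ofReal z.2 < F z.1} :=
    measurableSet_lt (by fun_prop) (by fun_prop)
  have hmL : MeasurableSet {z : ℝ × Y | ENNReal.ofReal z.1 < L z.2} :=
    measurableSet_lt (by fun_prop) (by fun_prop)
  calc ∫⁻ x, F x ^ p ∂μ = ∫⁻ x, (∫⁻ σ in Set.Ioi (0 : ℝ),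
        {z : X × ℝ | ENNReal.ofReal z.2 < F z.1}.indicator
          (fun z => ENNReal.ofReal (p * z.2 ^ (p - 1))) (x, σ)) ∂μ := by
        refine lintegral_congr fun x => ?_
        rw [← lintegral_Ioi_indicator_rpow hp]
        rfl
    _ = ∫⁻ σ in Set.Ioi (0 : ℝ), (∫⁻ x, {z : X × ℝ | ENNReal.ofReal z.2 < F z.1}.indicator
          (fun z => ENNReal.ofReal (p * z.2 ^ (p - 1))) (x, σ) ∂μ) :=
        lintegral_lintegral_swap ((Measurable.indicator (by fun_prop) hmF).aemeasurable)
    _ ≤ ∫⁻ σ in Set.Ioi (0 : ℝ), (∫⁻ y, ENNReal.ofReal (p / (p - a) * A) *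
          (G y * {z : ℝ × Y | ENNReal.ofReal z.1 < L z.2}.indicator
          (fun z => ENNReal.ofReal ((p - a) * z.1 ^ (p - a - 1))) (σ, y)) ∂ν) := by
        refine lintegral_mono_ae ((ae_restrict_mem measurableSet_Ioi).mono fun σ hσ => ?_)
        have hσ' : (0 : ℝ) < σ := hσ
        have hs : MeasurableSet {x | ENNReal.ofReal σ < F x} := hF measurableSet_Ioi
        have hs' : MeasurableSet {y | ENNReal.ofReal σ < L y} := hL measurableSet_Ioi
        have e1 : ∀ x, {z : X × ℝ | ENNReal.ofReal z.2 < F z.1}.indicator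
          (fun z => ENNReal.ofReal (p * z.2 ^ (p - 1))) (x, σ) =
          {x | ENNReal.ofReal σ < F x}.indicator
            (fun _ => ENNReal.ofReal (p * σ ^ (p - 1))) x := fun x => rfl
        have e2 : ∀ y, G y * {z : ℝ × Y | ENNReal.ofReal z.1 < L z.2}.indicator
          (fun z => ENNReal.ofReal ((p - a) * z.1 ^ (p - a - 1))) (σ, y) =
          ENNReal.ofReal ((p - a) * σ ^ (p - a - 1)) *
            {y | ENNReal.ofReal σ < L y}.indicator G y := fun y => by
          by_cases hy : ENNReal.ofReal σ < L y
          · rw [Set.indicator_of_mem (by exact hy), Set.indicator_of_mem (by exact hy), mul_comm]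
          · rw [Set.indicator_of_notMem (by exact hy), Set.indicator_of_notMem (by exact hy)]
            simp
        simp only [e1, e2]
        rw [lintegral_indicator_const hs, lintegral_const_mul _ (by fun_prop),
          lintegral_const_mul _ (hG.indicator hs'), lintegral_indicator hs', ← mul_assoc]
        refine (mul_le_mul_right (h σ hσ') _).trans (le_of_eq ?_)
        rw [← mul_assoc, ← ENNReal.ofReal_mul (by positivity), ← ENNReal.ofReal_mul (by positivity)]
        congr 2
        -- The layer-cake weight of `F` times the factor of the hypothesis is, up to a constant, the
        -- layer-cake weight for the power `p - a` of `L`.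
        have : σ ^ (p - a - 1) = σ ^ (p - 1) * σ ^ (-a) := by
          rw [← Real.rpow_add hσ']; congr 1; ring
        rw [this]
        field_simp
    _ = ∫⁻ y, (∫⁻ σ in Set.Ioi (0 : ℝ), ENNReal.ofReal (p / (p - a) * A) *
          (G y * {z : ℝ × Y | ENNReal.ofReal z.1 < L z.2}.indicator
          (fun z => ENNReal.ofReal ((p - a) * z.1 ^ (p - a - 1))) (σ, y))) ∂ν := by
        refine lintegral_lintegral_swap (Measurable.aemeasurable ?_)
        refine measurable_const.mul ((hG.comp measurable_snd).mul ?_)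
        exact Measurable.indicator (by fun_prop) hmL
    _ = _ := by
        have hm3 : Measurable fun y => G y * L y ^ (p - a) := hG.mul (hL.pow_const _)
        rw [← lintegral_const_mul _ hm3]
        refine lintegral_congr fun y => ?_
        have hm1 : Measurable fun σ => {z : ℝ × Y | ENNReal.ofReal z.1 < L z.2}.indicator
            (fun z => ENNReal.ofReal ((p - a) * z.1 ^ (p - a - 1))) (σ, y) :=
          (Measurable.indicator (by fun_prop) hmL).comp (measurable_id.prodMk measurable_const)
        have hm2 : Measurable fun σ => G y * {z : ℝ × Y | ENNReal.ofReal z.1 < L z.2}.indicator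
            (fun z => ENNReal.ofReal ((p - a) * z.1 ^ (p - a - 1))) (σ, y) :=
          hm1.const_mul (G y)
        rw [lintegral_const_mul _ hm2, lintegral_const_mul _ hm1, ← lintegral_Ioi_indicator_rpow hpa (L y)]
        rfl

/-- Equality of exponents, $2-(r-2)/(r-1)=s$; only an inequality because of the convention
$\infty\cdot0=0$ at $a=\infty$. -/
theorem mul_rpow_inv_le {a : ℝ≥0∞} {r s : ℝ} (h : r.HolderConjugate s) (hr : 2 < r) :
    a ^ (2 : ℝ) * (a⁻¹ ^ (1 / (r - 1))) ^ (r - 2) ≤ a ^ s := by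
  have hs := h.symm.pos
  have hr1 : 0 < r - 1 := by linarith
  rcases eq_or_ne a 0 with rfl | h0
  · simp [ENNReal.zero_rpow_of_pos hs]
  rcases eq_or_ne a ⊤ with rfl | h1
  · simp [ENNReal.top_rpow_of_pos hs]
  refine le_of_eq ?_
  rw [ENNReal.inv_rpow, ← ENNReal.rpow_neg, ← ENNReal.rpow_mul, ← ENNReal.rpow_add _ _ h0 h1]
  congr 1
  rw [h.conjugate_eq]
  field_simp
  ring

/-- Marcinkiewicz's argument. At each level `σ`, `f` is cut by height: the tall part has $L^1$ norm
so small that its image is at most $\sigma/2$, so the image of the rest must exceed $\sigma/2$, and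
Chebyshev in $L^2$ measures that set. -/
theorem rNorm_le_of_interpolation {r s : ℝ} (h : r.HolderConjugate s) (hr : 2 < r)
    {T : L2 →L[ℂ] L2} {D : ℝ} (hD : 0 < D) (h2 : ∀ f, ‖T f‖ ≤ ‖f‖)
    (h1 : ∀ f : L2, Integrable f volume → ∀ᵐ x, ‖T f x‖ ≤ D * ∫ y, ‖f y‖) {f : L2}
    (hf : ∫⁻ x, ‖f x‖ₑ ^ s ≤ 1) :
    ∫⁻ x, ‖T f x‖ₑ ^ r ≤ ENNReal.ofReal (4 * r / (r - 2) * (2 * D) ^ (r - 2)) := by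
  have hfm : Measurable f := (Lp.stronglyMeasurable f).measurable
  have hr1 : 0 < r - 1 := by linarith
  have hs : s = 1 + 1 / (r - 1) := by
    rw [h.conjugate_eq]; field_simp; ring
  -- `σ < L` singles out the low values of `f`: on the complement $|f|^{-1/(r-1)}\le\sigma/(2D)$, so
  -- $|f|=|f|^{-1/(r-1)}|f|^s$ has integral at most $\sigma/(2D)$. Where `f` vanishes, `L` is
  -- infinite, which puts the point in the harmless part.
  set L : ℝ → ℝ≥0∞ := fun x => ENNReal.ofReal (2 * D) * ‖f x‖ₑ⁻¹ ^ (1 / (r - 1)) with hL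
  have hLm : Measurable L := by fun_prop
  have key := lintegral_rpow_le_of_level (μ := volume) (ν := volume) (F := fun x => ‖T f x‖ₑ)
    (G := fun x => ‖f x‖ₑ ^ (2 : ℝ)) (L := L) (p := r) (a := 2) (A := 4)
    (Lp.stronglyMeasurable _).measurable.enorm (by fun_prop) hLm hr (by linarith) (by norm_num) ?_
  · refine key.trans ?_
    calc _ ≤ ENNReal.ofReal (r / (r - 2) * 4) *
          (ENNReal.ofReal ((2 * D) ^ (r - 2)) * ∫⁻ x, ‖f x‖ₑ ^ s) := by
          gcongr
          rw [← lintegral_const_mul _ (by fun_prop)]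
          refine lintegral_mono fun x => ?_
          rw [hL, ENNReal.mul_rpow_of_nonneg _ _ (by linarith), mul_left_comm,
            ENNReal.ofReal_rpow_of_nonneg (by positivity) (by linarith)]
          gcongr
          exact mul_rpow_inv_le h hr
      _ ≤ ENNReal.ofReal (r / (r - 2) * 4) * (ENNReal.ofReal ((2 * D) ^ (r - 2)) * 1) := by gcongr
      _ = _ := by
          rw [mul_one, ← ENNReal.ofReal_mul (by have : 0 < r - 2 := by linarith
                                                positivity)]
          congr 1; ring
  · intro σ hσ
    set S : Set ℝ := {y | ENNReal.ofReal σ < L y} with hS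
    have hSm : MeasurableSet S := hLm measurableSet_Ioi
    set f₁ : L2 := restrictOp Sᶜ f with hf₁
    set f₂ : L2 := restrictOp S f with hf₂
    have hsum : f = f₁ + f₂ := by
      apply Lp.ext
      filter_upwards [restrictOp_ae hSm.compl f, restrictOp_ae hSm f, Lp.coeFn_add f₁ f₂]
        with x e1 e2 e3
      rw [e3, Pi.add_apply, hf₁, hf₂, e1, e2, Set.indicator_compl_add_self_apply]
    have hb : ∫⁻ x, ‖f₁ x‖ₑ ≤ ENNReal.ofReal (σ / (2 * D)) := by
      calc ∫⁻ x, ‖f₁ x‖ₑ ≤ ∫⁻ x, ENNReal.ofReal (σ / (2 * D)) * ‖f x‖ₑ ^ s := by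
            refine lintegral_mono_ae ?_
            filter_upwards [restrictOp_ae hSm.compl f] with x e1
            rw [hf₁, e1]
            by_cases hx : x ∈ S
            · rw [Set.indicator_of_notMem (by simpa using hx)]; simp
            · rw [Set.indicator_of_mem (by simpa using hx)]
              have hx' : L x ≤ ENNReal.ofReal σ := not_lt.1 hx
              rcases eq_or_ne ‖f x‖ₑ 0 with h0 | h0
              · rw [h0]; simp
              have h3 : ‖f x‖ₑ⁻¹ ^ (1 / (r - 1)) ≤ ENNReal.ofReal (σ / (2 * D)) := by
                rw [ENNReal.ofReal_div_of_pos (by positivity)]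
                rw [ENNReal.le_div_iff_mul_le (by left; simpa using hD) (by left; exact ENNReal.ofReal_ne_top), mul_comm]
                exact hx'
              calc ‖f x‖ₑ = ‖f x‖ₑ⁻¹ ^ (1 / (r - 1)) * ‖f x‖ₑ ^ s := by
                    rw [hs, ENNReal.rpow_add _ _ h0 (by simp), ENNReal.rpow_one, mul_left_comm,
                      ← ENNReal.mul_rpow_of_nonneg _ _ (by positivity),
                      ENNReal.inv_mul_cancel h0 (by simp), ENNReal.one_rpow, mul_one]
                _ ≤ _ := by gcongr
        _ ≤ ENNReal.ofReal (σ / (2 * D)) * 1 := by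
            rw [lintegral_const_mul _ (by fun_prop)]; gcongr
        _ = _ := mul_one _
    have hi : Integrable f₁ volume :=
      ⟨Lp.aestronglyMeasurable _, lt_of_le_of_lt hb (by simp)⟩
    have hb' : D * ∫ y, ‖f₁ y‖ ≤ σ / 2 := by
      rw [integral_norm_eq_lintegral_enorm hi.1]
      have := ENNReal.toReal_mono (by simp) hb
      rw [ENNReal.toReal_ofReal (by positivity)] at this
      calc _ ≤ D * (σ / (2 * D)) := by gcongr
        _ = _ := by field_simp
    have hsub : ∀ᵐ x, ENNReal.ofReal σ < ‖T f x‖ₑ → ENNReal.ofReal (σ / 2) ^ (2 : ℝ) ≤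
        ‖T f₂ x‖ₑ ^ (2 : ℝ) := by
      have e : T f = T f₁ + T f₂ := by rw [← map_add, ← hsum]
      filter_upwards [h1 f₁ hi, Lp.coeFn_add (T f₁) (T f₂)] with x h3 h4 h5
      rw [e, h4, Pi.add_apply, ← ofReal_norm, ENNReal.ofReal_lt_ofReal_iff_of_nonneg hσ.le] at h5
      gcongr
      rw [← ofReal_norm]
      refine ENNReal.ofReal_le_ofReal ?_
      have := norm_add_le (T f₁ x) (T f₂ x)
      linarith
    have hpos : ENNReal.ofReal (σ / 2) ^ (2 : ℝ) = ENNReal.ofReal (σ ^ 2 / 4) := by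
      rw [ENNReal.ofReal_rpow_of_nonneg (by positivity) (by norm_num)]
      congr 1; rw [Real.rpow_two]; ring
    calc volume {x | ENNReal.ofReal σ < ‖T f x‖ₑ}
        ≤ volume {x | ENNReal.ofReal (σ / 2) ^ (2 : ℝ) ≤ ‖T f₂ x‖ₑ ^ (2 : ℝ)} :=
          measure_mono_ae hsub
      _ ≤ (∫⁻ x, ‖T f₂ x‖ₑ ^ (2 : ℝ)) / ENNReal.ofReal (σ / 2) ^ (2 : ℝ) := by
          refine meas_ge_le_lintegral_div ?_ ?_ ?_
          · exact ((Lp.stronglyMeasurable _).measurable.enorm.pow_const _).aemeasurable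
          · rw [hpos]; simp; positivity
          · rw [hpos]; simp
      _ ≤ (∫⁻ x in S, ‖f x‖ₑ ^ (2 : ℝ)) / ENNReal.ofReal (σ / 2) ^ (2 : ℝ) := by
          refine ENNReal.div_le_div_right ?_ _
          rw [← rNorm_rpow two_pos, rNorm_two]
          have e : ∫⁻ x in S, ‖f x‖ₑ ^ (2 : ℝ) = ‖f₂‖ₑ ^ (2 : ℝ) := by
            rw [← rNorm_two, rNorm_rpow two_pos, ← lintegral_indicator hSm]
            refine lintegral_congr_ae ?_
            filter_upwards [restrictOp_ae hSm f] with x e2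
            rw [hf₂, e2]
            by_cases hx : x ∈ S
            · simp [hx]
            · simp [hx]
          rw [e]
          gcongr
          rw [← ofReal_norm, ← ofReal_norm]
          exact ENNReal.ofReal_le_ofReal (h2 f₂)
      _ = _ := by
          rw [hpos, ENNReal.div_eq_inv_mul, ← ENNReal.ofReal_inv_of_pos (by positivity)]
          congr 2
          rw [Real.rpow_neg hσ.le, Real.rpow_two]
          field_simp

theorem rNorm_eq_zero {s : ℝ} (hs : 0 < s) {f : L2} (h : rNorm s f = 0) : f = 0 := by
  rw [rNorm, eLpNorm_eq_zero_iff (Lp.aestronglyMeasurable f) (by simpa using hs)] at h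
  exact Lp.ext (h.trans (Lp.coeFn_zero _ _ _).symm)

/-- The `L^{r'} → L^r` dispersive estimate. -/
theorem exists_rNorm_freeGroup_le {r s : ℝ} (h : r.HolderConjugate s) (hr : 2 < r) :
    ∃ c : ℝ≥0∞, c ≠ ⊤ ∧ ∀ t ≠ 0, ∀ f : L2,
      rNorm r (freeGroup t f) ≤ c * ENNReal.ofReal (|t| ^ (-(1 / 2 - 1 / r))) * rNorm s f := by
  have hr0 : 0 < r := by linarith
  have hr2 : 0 < r - 2 := by linarith
  set K : ℝ := 4 * r / (r - 2) * (2 * (1 / (2 * Real.pi)) ^ (1 / 2 : ℝ)) ^ (r - 2) with hK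
  have hK0 : 0 < K := by positivity
  refine ⟨ENNReal.ofReal (K ^ (1 / r)), by simp, fun t ht f => ?_⟩
  have ht' : 0 < |t| := abs_pos.2 ht
  rcases eq_or_ne (rNorm s f) ⊤ with h1 | h1
  · rw [h1, ENNReal.mul_top]
    · exact le_top
    · rw [← ENNReal.ofReal_mul (by positivity)]
      have : 0 < K ^ (1 / r) * |t| ^ (-(1 / 2 - 1 / r)) := by positivity
      simpa using this
  rcases eq_or_ne (rNorm s f) 0 with h0 | h0
  · rw [rNorm_eq_zero h.symm.pos h0, map_zero, rNorm, eLpNorm_congr_ae (Lp.coeFn_zero _ _ _),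
      eLpNorm_zero]
    exact zero_le
  set N := (rNorm s f).toReal with hN
  have hN0 : 0 < N := ENNReal.toReal_pos h0 h1
  have hNe : rNorm s f = ENNReal.ofReal N := (ENNReal.ofReal_toReal h1).symm
  have hcN : ‖((N⁻¹ : ℝ) : ℂ)‖ₑ = (ENNReal.ofReal N)⁻¹ := by
    rw [← ofReal_norm, Complex.norm_of_nonneg (by positivity), ENNReal.ofReal_inv_of_pos hN0]
  have hN1 : (ENNReal.ofReal N)⁻¹ * ENNReal.ofReal N = 1 :=
    ENNReal.inv_mul_cancel (by simpa using hN0) (by simp)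
  set D : ℝ := (1 / (2 * Real.pi * |t|)) ^ (1 / 2 : ℝ) with hD
  have key := rNorm_le_of_interpolation h hr (T := freeGroup t) (D := D) (by positivity)
    (fun g => (norm_freeGroup t g).le) (fun g hg => ae_norm_freeGroup_le ht hg)
    (f := ((N⁻¹ : ℝ) : ℂ) • f) ?_
  · rw [← rNorm_rpow hr0, map_smul, rNorm_smul, hcN] at key
    -- `D` is proportional to $|t|^{-1/2}$, and $\tfrac12\cdot\tfrac{r-2}{r}=\tfrac12-\tfrac1r$.
    have e : 4 * r / (r - 2) * (2 * D) ^ (r - 2) =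
        (K ^ (1 / r) * |t| ^ (-(1 / 2 - 1 / r))) ^ r := by
      have hDt : D = (1 / (2 * Real.pi)) ^ (1 / 2 : ℝ) * |t| ^ (-(1 / 2) : ℝ) := by
        rw [hD, Real.rpow_neg ht'.le, ← Real.inv_rpow ht'.le,
          ← Real.mul_rpow (by positivity) (by positivity)]
        congr 1
        field_simp
      rw [Real.mul_rpow (x := K ^ (1 / r)) (by positivity) (by positivity), ← Real.rpow_mul hK0.le,
        one_div_mul_cancel hr0.ne', Real.rpow_one, ← Real.rpow_mul ht'.le, hDt, ← mul_assoc,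
        Real.mul_rpow (y := |t| ^ (-(1 / 2) : ℝ)) (by positivity) (by positivity),
        ← Real.rpow_mul ht'.le, hK, mul_assoc]
      congr 3
      field_simp
    rw [e, ← ENNReal.ofReal_rpow_of_nonneg (by positivity) hr0.le,
      ENNReal.rpow_le_rpow_iff hr0, ENNReal.ofReal_mul (by positivity)] at key
    rw [hNe]
    calc rNorm r (freeGroup t f) =
          ENNReal.ofReal N * ((ENNReal.ofReal N)⁻¹ * rNorm r (freeGroup t f)) := by
          rw [← mul_assoc, mul_comm (ENNReal.ofReal N), hN1, one_mul]
      _ ≤ ENNReal.ofReal N * _ := mul_le_mul_right key _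
      _ = _ := mul_comm _ _
  · rw [← rNorm_rpow h.symm.pos, rNorm_smul, hcN, hNe, hN1, ENNReal.one_rpow]

/-! ### The Hardy–Littlewood–Sobolev inequality -/

theorem lintegral_comp_abs (g : ℝ → ℝ≥0∞) : ∫⁻ u : ℝ, g |u| = 2 * ∫⁻ u in Set.Ioi 0, g u := by
  rw [← lintegral_add_compl _ (measurableSet_Ioi (a := (0 : ℝ))), Set.compl_Ioi, two_mul]
  congr 1
  · exact setLIntegral_congr_fun measurableSet_Ioi fun u hu => by rw [abs_of_pos hu]
  · rw [← setLIntegral_congr Iio_ae_eq_Iic]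
    have h := (Measure.measurePreserving_neg (volume : Measure ℝ)).setLIntegral_comp_preimage_emb
      (MeasurableEquiv.neg ℝ).measurableEmbedding g (Set.Ioi 0)
    rw [← h]
    have : Neg.neg ⁻¹' Set.Ioi (0 : ℝ) = Set.Iio 0 := by ext x; simp
    rw [this]
    exact setLIntegral_congr_fun measurableSet_Iio fun u hu => by rw [abs_of_neg hu]

/-- The kernel of the fractional integral of order `1 - l`. -/
noncomputable def rieszKernel (l u : ℝ) : ℝ≥0∞ := ENNReal.ofReal (|u| ^ (-l))

theorem measurable_rieszKernel (l : ℝ) : Measurable (rieszKernel l) := by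
  unfold rieszKernel; fun_prop

theorem lintegral_rieszKernel_near {l R : ℝ} (hl : l < 1) (hR : 0 ≤ R) :
    ∫⁻ u, {u : ℝ | |u| < R}.indicator (rieszKernel l) u =
      ENNReal.ofReal (2 / (1 - l) * R ^ (1 - l)) := by
  have hl' : 0 < 1 - l := by linarith
  have e : ∀ u : ℝ, {u : ℝ | |u| < R}.indicator (rieszKernel l) u =
      (Set.Iio R).indicator (fun v => ENNReal.ofReal (v ^ (-l))) |u| := fun u => rfl
  simp only [e]
  rw [lintegral_comp_abs ((Set.Iio R).indicator (fun v => ENNReal.ofReal (v ^ (-l)))),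
    lintegral_indicator measurableSet_Iio, Measure.restrict_restrict measurableSet_Iio,
    Set.inter_comm, Set.Ioi_inter_Iio]
  have h := lintegral_Ioo_mul_rpow hl' hR
  simp only [ENNReal.ofReal_mul hl'.le] at h
  rw [lintegral_const_mul _ (by fun_prop), show 1 - l - 1 = -l by ring] at h
  rw [ENNReal.ofReal_mul (by positivity), ← h, ← mul_assoc, ← ENNReal.ofReal_mul (by positivity),
    div_mul_cancel₀ _ hl'.ne', ENNReal.ofReal_ofNat]

theorem lintegral_rieszKernel_far {l n R : ℝ} (hn : 0 < n) (hl : 1 < l * n) (hR : 0 < R) :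
    ∫⁻ u, {u : ℝ | R ≤ |u|}.indicator (rieszKernel l) u ^ n =
      ENNReal.ofReal (2 / (l * n - 1) * R ^ (1 - l * n)) := by
  have hl' : 0 < l * n - 1 := by linarith
  have e : ∀ u : ℝ, {u : ℝ | R ≤ |u|}.indicator (rieszKernel l) u ^ n =
      (Set.Ici R).indicator (fun v => ENNReal.ofReal (v ^ (-(l * n)))) |u| := fun u => by
    by_cases hu : R ≤ |u|
    · rw [Set.indicator_of_mem (by exact hu), Set.indicator_of_mem (by exact hu), rieszKernel,
        ENNReal.ofReal_rpow_of_nonneg (by positivity) hn.le, ← Real.rpow_mul (abs_nonneg u)]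
      congr 2; ring
    · rw [Set.indicator_of_notMem (by exact hu), Set.indicator_of_notMem (by exact hu),
        ENNReal.zero_rpow_of_pos hn]
  simp only [e]
  rw [lintegral_comp_abs ((Set.Ici R).indicator (fun v => ENNReal.ofReal (v ^ (-(l * n))))),
    lintegral_indicator measurableSet_Ici, Measure.restrict_restrict measurableSet_Ici,
    Set.inter_eq_left.2 (Set.Ici_subset_Ioi.2 hR), setLIntegral_congr Ioi_ae_eq_Ici.symm,
    ← ofReal_integral_eq_lintegral_ofReal (integrableOn_Ioi_rpow_of_lt (by linarith) hR)
      ((ae_restrict_mem measurableSet_Ioi).mono fun u hu =>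
        Real.rpow_nonneg (hR.trans hu).le _),
    integral_Ioi_rpow_of_lt (by linarith) hR, ← ENNReal.ofReal_ofNat,
    ← ENNReal.ofReal_mul (by norm_num)]
  congr 1
  have h1 : -(l * n) + 1 = -(l * n - 1) := by ring
  rw [h1, neg_div_neg_eq, show 1 - l * n = -(l * n - 1) by ring]
  ring

/-- The fractional integral of order `1 - l`. -/
noncomputable def rieszIntegral (l : ℝ) (f : ℝ → ℝ≥0∞) (t : ℝ) : ℝ≥0∞ :=
  ∫⁻ s, rieszKernel l (t - s) * f s

theorem measurable_rieszIntegral (l : ℝ) {f : ℝ → ℝ≥0∞} (hf : Measurable f) :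
    Measurable (rieszIntegral l f) := by
  refine Measurable.lintegral_prod_right' (f := fun z : ℝ × ℝ => rieszKernel l (z.1 - z.2) * f z.2) ?_
  exact ((measurable_rieszKernel l).comp (by fun_prop)).mul (hf.comp measurable_snd)

/-- The Hardy–Littlewood–Sobolev inequality on the unit ball. -/
theorem exists_lintegral_rieszIntegral_le_of_le_one {m p l : ℝ} (hm : 1 < m) (hp : 0 < p)
    (hl0 : 0 < l) (hl1 : l < 1) (h : 1 / p = 1 / m + l - 1) :
    ∃ C : ℝ, 0 < C ∧ ∀ f : ℝ → ℝ≥0∞, Measurable f → ∫⁻ s, f s ^ m ≤ 1 →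
      ∫⁻ t, rieszIntegral l f t ^ p ≤ ENNReal.ofReal C := by
  have hm0 : 0 < m := by linarith
  set n : ℝ := m / (m - 1) with hn
  have hmn : m.HolderConjugate n := Real.HolderConjugate.conjExponent hm
  have hn0 : 0 < n := hmn.symm.pos
  have hninv : 1 / n = 1 - 1 / m := by
    have := hmn.inv_add_inv_eq_one
    rw [one_div, one_div]; linarith
  have hln : 1 < l * n := by
    have h1 : 1 / n < l := by
      rw [hninv]; have : 0 < 1 / p := by positivity
      linarith
    rwa [div_lt_iff₀ hn0] at h1
  have hln' : 0 < l * n - 1 := by linarith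
  have hl1' : 0 < 1 - l := by linarith
  set c₁ : ℝ := (2 / (l * n - 1)) ^ (1 / n) with hc₁
  have hc₁0 : 0 < c₁ := by positivity
  set c₂ : ℝ := 2 / (1 - l) with hc₂
  have hc₂0 : 0 < c₂ := by positivity
  set c₃ : ℝ := (4 * c₂ * (2 * c₁) ^ (p * (1 - l)))⁻¹ with hc₃
  have hc₃0 : 0 < c₃ := by positivity
  have hpm : p / m < p := div_lt_self hp hm
  refine ⟨p / (p - p / m) * c₃⁻¹ * (c₃⁻¹) ^ (m - 1), ?_, fun f hf hf1 => ?_⟩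
  · have : 0 < p - p / m := by linarith
    positivity
  -- Chosen so that `σ < L y` means that `f y` exceeds the cut height `H` introduced below.
  set L : ℝ → ℝ≥0∞ := fun y => (ENNReal.ofReal c₃⁻¹ * f y) ^ (m / p) with hL
  have hLm : Measurable L := by fun_prop
  have key := lintegral_rpow_le_of_level (μ := volume) (ν := volume) (p := p) (a := p / m)
    (A := c₃⁻¹) (measurable_rieszIntegral l hf) hf hLm hpm hp (by positivity) ?_
  · refine key.trans ?_
    have e : ∀ y, f y * L y ^ (p - p / m) = ENNReal.ofReal (c₃⁻¹ ^ (m - 1)) * f y ^ m := fun y => by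
      have h1 : m / p * (p - p / m) = m - 1 := by field_simp
      have h2 : f y ^ m = f y * f y ^ (m - 1) := by
        nth_rewrite 2 [← ENNReal.rpow_one (f y)]
        rw [← ENNReal.rpow_add_of_nonneg _ _ zero_le_one (by linarith)]
        congr 1; ring
      rw [hL, ← ENNReal.rpow_mul, h1, ENNReal.mul_rpow_of_nonneg _ _ (by linarith), h2,
        ENNReal.ofReal_rpow_of_nonneg (by positivity) (by linarith)]
      ring
    simp only [e]
    rw [lintegral_const_mul _ (by fun_prop)]
    have hpp : 0 < p - p / m := by linarith
    calc _ ≤ ENNReal.ofReal (p / (p - p / m) * c₃⁻¹) * (ENNReal.ofReal (c₃⁻¹ ^ (m - 1)) * 1) := by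
          gcongr
      _ = _ := by rw [mul_one, ← ENNReal.ofReal_mul (by positivity)]
  intro σ hσ
  -- The kernel is cut at distance `R` and `f` at height `H`. They are chosen so that the far kernel
  -- contributes at most $\sigma/2$ by Hölder, and the near kernel acting on values at most `H`
  -- contributes at most $\sigma/4$. Where the integral exceeds `σ`, the remainder `J` is then at
  -- least $\sigma/4$, and Chebyshev in $L^1$ applies.
  set R : ℝ := (σ / (2 * c₁)) ^ (-p) with hR
  have hR0 : 0 < R := by positivity
  have hR1 : c₁ * R ^ (-(1 / p)) = σ / 2 := by
    rw [hR, ← Real.rpow_mul (by positivity), show -p * -(1 / p) = 1 by field_simp, Real.rpow_one]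
    field_simp
  set H : ℝ := c₃ * σ ^ (p / m) with hH
  have hH0 : 0 < H := by positivity
  have hRH : c₂ * R ^ (1 - l) * H = σ / 4 := by
    have h1 : R ^ (1 - l) = σ ^ (-(p * (1 - l))) * (2 * c₁) ^ (p * (1 - l)) := by
      rw [hR, ← Real.rpow_mul (by positivity), Real.div_rpow hσ.le (by positivity),
        show -p * (1 - l) = -(p * (1 - l)) by ring, Real.rpow_neg (by positivity : 0 ≤ 2 * c₁),
        div_inv_eq_mul]
    have h2 : σ ^ (-(p * (1 - l))) * σ ^ (p / m) = σ := by
      rw [← Real.rpow_add hσ]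
      have : -(p * (1 - l)) + p / m = 1 := by
        have h3 : l = 1 / p - 1 / m + 1 := by linarith
        rw [h3]; field_simp; ring
      rw [this, Real.rpow_one]
    rw [h1, hH, hc₃]
    have h3 : 0 < (2 * c₁) ^ (p * (1 - l)) := by positivity
    calc _ = (σ ^ (-(p * (1 - l))) * σ ^ (p / m)) * (c₂ * (2 * c₁) ^ (p * (1 - l)) *
          (4 * c₂ * (2 * c₁) ^ (p * (1 - l)))⁻¹) := by ring
      _ = _ := by rw [h2]; field_simp
  set S : Set ℝ := {y | ENNReal.ofReal σ < L y} with hS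
  have hSm : MeasurableSet S := hLm measurableSet_Ioi
  set κ₁ : ℝ → ℝ≥0∞ := {u : ℝ | |u| < R}.indicator (rieszKernel l) with hκ₁
  set κ₂ : ℝ → ℝ≥0∞ := {u : ℝ | R ≤ |u|}.indicator (rieszKernel l) with hκ₂
  have hκ₁m : Measurable κ₁ := (measurable_rieszKernel l).indicator
    (measurableSet_lt (by fun_prop) measurable_const)
  have hκ₂m : Measurable κ₂ := (measurable_rieszKernel l).indicator
    (measurableSet_le measurable_const (by fun_prop))
  have hI₁ : ∫⁻ u, κ₁ u = ENNReal.ofReal (c₂ * R ^ (1 - l)) :=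
    lintegral_rieszKernel_near hl1 hR0.le
  have hI₂ : (∫⁻ u, κ₂ u ^ n) ^ (1 / n) = ENNReal.ofReal (σ / 2) := by
    rw [lintegral_rieszKernel_far hn0 hln hR0,
      ENNReal.ofReal_rpow_of_nonneg (by positivity) (by positivity), ← hR1]
    congr 1
    rw [Real.mul_rpow (by positivity) (by positivity), ← Real.rpow_mul hR0.le]
    congr 2
    have : (1 - l * n) * (1 / n) = 1 / n - l := by field_simp
    rw [this, hninv, h]; ring
  set J : ℝ → ℝ≥0∞ := fun t => ∫⁻ s, κ₁ (t - s) * S.indicator f s with hJ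
  have hJm : Measurable J := by
    refine Measurable.lintegral_prod_right'
      (f := fun z : ℝ × ℝ => κ₁ (z.1 - z.2) * S.indicator f z.2) ?_
    exact (hκ₁m.comp (by fun_prop)).mul ((hf.indicator hSm).comp measurable_snd)
  have hJi : ∫⁻ t, J t = ENNReal.ofReal (c₂ * R ^ (1 - l)) * ∫⁻ y in S, f y := by
    rw [hJ, lintegral_lintegral_swap]
    · calc _ = ∫⁻ s, (∫⁻ u, κ₁ u) * S.indicator f s := by
            refine lintegral_congr fun s => ?_
            have m3 : Measurable fun t => κ₁ (t - s) := hκ₁m.comp (by fun_prop)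
            rw [lintegral_mul_const _ m3, lintegral_sub_right_eq_self κ₁ s]
        _ = _ := by
            rw [lintegral_const_mul _ (hf.indicator hSm), hI₁, lintegral_indicator hSm]
    · exact ((hκ₁m.comp (by fun_prop)).mul ((hf.indicator hSm).comp measurable_snd)).aemeasurable
  have hsplit : ∀ t, rieszIntegral l f t ≤ ENNReal.ofReal (σ / 2) + ENNReal.ofReal (σ / 4) + J t := by
    intro t
    have e : ∀ s, rieszKernel l (t - s) * f s ≤ κ₂ (t - s) * f s +
        (κ₁ (t - s) * ENNReal.ofReal H + κ₁ (t - s) * S.indicator f s) := by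
      intro s
      rcases le_or_gt R |t - s| with h1 | h1
      · have : κ₂ (t - s) = rieszKernel l (t - s) := Set.indicator_of_mem (by exact h1) _
        rw [this]
        exact le_self_add
      · have : κ₁ (t - s) = rieszKernel l (t - s) := Set.indicator_of_mem (by exact h1) _
        rw [this, ← mul_add]
        refine le_trans ?_ le_add_self
        gcongr
        by_cases hs : s ∈ S
        · rw [Set.indicator_of_mem hs]; exact le_add_self
        · rw [Set.indicator_of_notMem hs, add_zero]
          have hs' : (ENNReal.ofReal c₃⁻¹ * f s) ^ (m / p) ≤ ENNReal.ofReal σ := not_lt.1 hs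
          have hs2 := ENNReal.rpow_le_rpow hs' (by positivity : 0 ≤ p / m)
          rw [← ENNReal.rpow_mul, show m / p * (p / m) = 1 by field_simp, ENNReal.rpow_one,
            ENNReal.ofReal_rpow_of_nonneg hσ.le (by positivity)] at hs2
          calc f s = ENNReal.ofReal c₃ * (ENNReal.ofReal c₃⁻¹ * f s) := by
                rw [← mul_assoc, ← ENNReal.ofReal_mul hc₃0.le, mul_inv_cancel₀ hc₃0.ne',
                  ENNReal.ofReal_one, one_mul]
            _ ≤ ENNReal.ofReal c₃ * ENNReal.ofReal (σ ^ (p / m)) := by gcongr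
            _ = _ := by rw [← ENNReal.ofReal_mul hc₃0.le]
    have m1 : Measurable fun s => κ₂ (t - s) := hκ₂m.comp (by fun_prop)
    have m2 : Measurable fun s => κ₁ (t - s) := hκ₁m.comp (by fun_prop)
    refine (lintegral_mono e).trans ?_
    have m3 : Measurable fun s => κ₂ (t - s) * f s := m1.mul hf
    rw [lintegral_add_left m3, lintegral_add_left (m2.mul_const _), ← add_assoc]
    refine add_le_add_left (add_le_add ?_ ?_) _
    · have h1 := ENNReal.lintegral_mul_le_Lp_mul_Lq volume hmn.symm m1.aemeasurable hf.aemeasurable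
      refine h1.trans ?_
      rw [lintegral_sub_left_eq_self (fun u => κ₂ u ^ n) t, hI₂]
      calc _ ≤ ENNReal.ofReal (σ / 2) * 1 ^ (1 / m) := by gcongr
        _ = _ := by rw [ENNReal.one_rpow, mul_one]
    · rw [lintegral_mul_const _ m2, lintegral_sub_left_eq_self κ₁ t, hI₁,
        ← ENNReal.ofReal_mul (by positivity), hRH]
  calc volume {t | ENNReal.ofReal σ < rieszIntegral l f t}
      ≤ volume {t | ENNReal.ofReal (σ / 4) ≤ J t} := by
        refine measure_mono fun t ht => ?_
        by_contra hlt
        have h1 : J t < ENNReal.ofReal (σ / 4) := not_le.1 hlt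
        have h2 := (lt_of_lt_of_le (show ENNReal.ofReal σ < _ from ht) (hsplit t)).trans_le
          (add_le_add_right h1.le _)
        rw [← ENNReal.ofReal_add (by positivity) (by positivity),
          ← ENNReal.ofReal_add (by positivity) (by positivity)] at h2
        refine h2.ne ?_
        congr 1; ring
    _ ≤ (∫⁻ t, J t) / ENNReal.ofReal (σ / 4) :=
        meas_ge_le_lintegral_div hJm.aemeasurable (by simpa using hσ) (by simp)
    _ = _ := by
        rw [hJi, ENNReal.div_eq_inv_mul, ← ENNReal.ofReal_inv_of_pos (by positivity), ← mul_assoc,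
          ← ENNReal.ofReal_mul (by positivity), ← hRH, Real.rpow_neg hσ.le, ← mul_inv, ← hH]
        congr 2
        field_simp

/-- The Hardy–Littlewood–Sobolev inequality. -/
theorem exists_lintegral_rieszIntegral_le {m p l : ℝ} (hm : 1 < m) (hp : 0 < p)
    (hl0 : 0 < l) (hl1 : l < 1) (h : 1 / p = 1 / m + l - 1) :
    ∃ C : ℝ≥0∞, C ≠ ⊤ ∧ ∀ f : ℝ → ℝ≥0∞, Measurable f →
      ∫⁻ t, rieszIntegral l f t ^ p ≤ C * (∫⁻ s, f s ^ m) ^ (p / m) := by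
  have hm0 : 0 < m := by linarith
  obtain ⟨C, hC, hC'⟩ := exists_lintegral_rieszIntegral_le_of_le_one hm hp hl0 hl1 h
  refine ⟨ENNReal.ofReal C, by simp, fun f hf => ?_⟩
  rcases eq_or_ne (∫⁻ s, f s ^ m) ⊤ with h1 | h1
  · rw [h1, ENNReal.top_rpow_of_pos (by positivity), ENNReal.mul_top (by simpa using hC)]
    exact le_top
  rcases eq_or_ne (∫⁻ s, f s ^ m) 0 with h0 | h0
  · have h2 : f =ᵐ[volume] 0 := by
      rw [lintegral_eq_zero_iff (by fun_prop)] at h0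
      filter_upwards [h0] with s hs
      simpa [hm0, hm0.le, hm0.not_gt] using hs
    have h3 : ∀ t, rieszIntegral l f t = 0 := fun t => by
      rw [rieszIntegral, lintegral_congr_ae (g := fun _ => 0)]
      · simp
      · filter_upwards [h2] with s hs
        rw [hs]; simp
    simp only [h3, ENNReal.zero_rpow_of_pos hp]
    simp
  set M := (∫⁻ s, f s ^ m) ^ (1 / m) with hM
  have hM0 : M ≠ 0 := by simp [hM, h0, h1]
  have hM1 : M ≠ ⊤ := ENNReal.rpow_ne_top_of_nonneg (by positivity) h1
  have hMm : M ^ m = ∫⁻ s, f s ^ m := by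
    rw [hM, ← ENNReal.rpow_mul, one_div_mul_cancel hm0.ne', ENNReal.rpow_one]
  have h2 := hC' (fun s => M⁻¹ * f s) (by fun_prop) ?_
  · have e : ∀ t, rieszIntegral l (fun s => M⁻¹ * f s) t = M⁻¹ * rieszIntegral l f t := fun t => by
      rw [rieszIntegral, rieszIntegral, ← lintegral_const_mul' _ _ (by simpa using hM0)]
      refine lintegral_congr fun s => ?_
      ring
    simp only [e, ENNReal.mul_rpow_of_nonneg _ _ hp.le] at h2
    rw [lintegral_const_mul _ ((measurable_rieszIntegral l hf).pow_const p)] at h2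
    have h3 : (∫⁻ s, f s ^ m) ^ (p / m) = M ^ p := by
      rw [hM, ← ENNReal.rpow_mul]; congr 1; ring
    have h4 : M ^ p * M⁻¹ ^ p = 1 := by
      rw [← ENNReal.mul_rpow_of_nonneg _ _ hp.le, ENNReal.mul_inv_cancel hM0 hM1, ENNReal.one_rpow]
    rw [h3, mul_comm]
    calc _ = M ^ p * (M⁻¹ ^ p * ∫⁻ t, rieszIntegral l f t ^ p) := by
          rw [← mul_assoc, h4, one_mul]
      _ ≤ _ := by gcongr
  · simp only [ENNReal.mul_rpow_of_nonneg _ _ hm0.le]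
    rw [lintegral_const_mul _ (by fun_prop), ← hMm, ← ENNReal.mul_rpow_of_nonneg _ _ hm0.le,
      ENNReal.inv_mul_cancel hM0 hM1, ENNReal.one_rpow]

/-! ### The nonlinearity and the Sobolev embedding -/

theorem memLp_mul_norm_rpow {α K : ℝ} (hα : 0 ≤ α) {u : L2} (hK : ∀ᵐ x, ‖u x‖ ≤ K) :
    MemLp (fun x => u x * ((‖u x‖ ^ α : ℝ) : ℂ)) 2 (volume : Measure ℝ) := by
  have hm : AEStronglyMeasurable (fun x => ‖u x‖ ^ α) volume :=
    ((Lp.aestronglyMeasurable u).norm.aemeasurable.pow_const _).aestronglyMeasurable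
  refine ((Lp.memLp u).const_mul ((K ^ α : ℝ) : ℂ)).of_le ((Lp.aestronglyMeasurable u).mul
    (Complex.continuous_ofReal.comp_aestronglyMeasurable hm)) ?_
  filter_upwards [hK] with x hx
  have hK0 : 0 ≤ K := (norm_nonneg _).trans hx
  rw [norm_mul, norm_mul, Complex.norm_of_nonneg (by positivity),
    Complex.norm_of_nonneg (by positivity), mul_comm]
  gcongr

theorem nonlinearity_ae {α K : ℝ} (hα : 0 ≤ α) {u : L2} (hK : ∀ᵐ x, ‖u x‖ ≤ K) :
    nonlinearity α u =ᵐ[volume] fun x => u x * ((‖u x‖ ^ α : ℝ) : ℂ) := by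
  rw [nonlinearity, dif_pos (memLp_mul_norm_rpow hα hK)]
  exact MemLp.coeFn_toLp _

/-- Mean value inequality for $x\mapsto x^\alpha$ on $[0,K]$; one of the two factors is varied at a
time. -/
theorem norm_mul_rpow_sub_le {α K : ℝ} (hα : 1 ≤ α) {z w : ℂ} (hz : ‖z‖ ≤ K) (hw : ‖w‖ ≤ K) :
    ‖z * ((‖z‖ ^ α : ℝ) : ℂ) - w * ((‖w‖ ^ α : ℝ) : ℂ)‖ ≤ (α + 1) * K ^ α * ‖z - w‖ := by
  have hα0 : 0 ≤ α := by linarith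
  have hK0 : 0 ≤ K := (norm_nonneg _).trans hz
  have h1 : |‖z‖ ^ α - ‖w‖ ^ α| ≤ α * K ^ (α - 1) * |‖z‖ - ‖w‖| := by
    have := Convex.norm_image_sub_le_of_norm_hasDerivWithin_le (s := Set.Icc 0 K)
      (f := fun x : ℝ => x ^ α) (f' := fun x => α * x ^ (α - 1)) (C := α * K ^ (α - 1))
      (fun x _ => (Real.hasDerivAt_rpow_const (Or.inr hα)).hasDerivWithinAt) (fun x hx => ?_)
      (convex_Icc 0 K) ⟨norm_nonneg w, hw⟩ ⟨norm_nonneg z, hz⟩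
    · exact this
    · rw [Real.norm_of_nonneg (mul_nonneg hα0 (Real.rpow_nonneg hx.1 _))]
      have := Real.rpow_le_rpow hx.1 hx.2 (by linarith : 0 ≤ α - 1)
      gcongr
  have e : z * ((‖z‖ ^ α : ℝ) : ℂ) - w * ((‖w‖ ^ α : ℝ) : ℂ) =
      (z - w) * ((‖z‖ ^ α : ℝ) : ℂ) + w * ((‖z‖ ^ α - ‖w‖ ^ α : ℝ) : ℂ) := by
    push_cast; ring
  rw [e]
  refine (norm_add_le _ _).trans ?_
  rw [norm_mul, norm_mul, Complex.norm_of_nonneg (by positivity), Complex.norm_real,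
    Real.norm_eq_abs]
  have h2 : K ^ α = K * K ^ (α - 1) := by
    rcases hK0.eq_or_lt with h | h
    · rw [← h, zero_mul, Real.zero_rpow (by linarith)]
    · nth_rewrite 2 [← Real.rpow_one K]
      rw [← Real.rpow_add h]; congr 1; ring
  have h3 := abs_norm_sub_norm_le z w
  calc _ ≤ ‖z - w‖ * K ^ α + K * (α * K ^ (α - 1) * ‖z - w‖) := by
        gcongr
        exact h1.trans (by gcongr)
    _ = _ := by rw [h2]; ring

theorem norm_nonlinearity_sub_le {α K : ℝ} (hα : 1 ≤ α) {u v : L2} (hu : ∀ᵐ x, ‖u x‖ ≤ K)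
    (hv : ∀ᵐ x, ‖v x‖ ≤ K) :
    ‖nonlinearity α u - nonlinearity α v‖ ≤ (α + 1) * K ^ α * ‖u - v‖ := by
  refine Lp.norm_le_mul_norm_of_ae_le_mul ?_
  filter_upwards [hu, hv, nonlinearity_ae (by linarith) hu, nonlinearity_ae (by linarith) hv,
    Lp.coeFn_sub (nonlinearity α u) (nonlinearity α v), Lp.coeFn_sub u v] with x h1 h2 h3 h4 h5 h6
  rw [h5, h6, Pi.sub_apply, Pi.sub_apply, h3, h4]
  exact norm_mul_rpow_sub_le hα h1 h2

/-- The map is Lipschitz in $L^2$ on sets bounded in $L^\infty$, and near a given time the bound `K`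
exceeds its value there by less than one. -/
theorem continuous_nonlinearity {α : ℝ} (hα : 1 ≤ α) {u : ℝ → L2} (hu : Continuous u)
    {K : ℝ → ℝ} (hK : Continuous K) (h : ∀ t, ∀ᵐ x, ‖u t x‖ ≤ K t) :
    Continuous fun t => nonlinearity α (u t) := by
  rw [continuous_iff_continuousAt]
  intro t
  rw [ContinuousAt, tendsto_iff_norm_sub_tendsto_zero]
  have h1 : Tendsto (fun s => (α + 1) * (K t + 1) ^ α * ‖u s - u t‖) (𝓝 t) (𝓝 0) := by
    have := (tendsto_iff_norm_sub_tendsto_zero.1 (hu.tendsto t)).const_mul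
      ((α + 1) * (K t + 1) ^ α)
    rwa [mul_zero] at this
  refine squeeze_zero' (Eventually.of_forall fun s => norm_nonneg _) ?_ h1
  filter_upwards [(hK.tendsto t).eventually (gt_mem_nhds (lt_add_one (K t)))] with s hs
  exact norm_nonlinearity_sub_le hα ((h s).mono fun x hx => hx.trans hs.le)
    ((h t).mono fun x hx => hx.trans (lt_add_one _).le)

/-- $(r-1)s=r$: the nonlinearity with $\alpha=r-2$ is the duality map of $L^r$. It enters the proof
both as the force in the equation and as the extremal function in the Strichartz estimate. -/
theorem rNorm_nonlinearity {r s K : ℝ} (h : r.HolderConjugate s) (hr : 2 ≤ r) {u : L2}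
    (hu : ∀ᵐ x, ‖u x‖ ≤ K) : rNorm s (nonlinearity (r - 2) u) ^ s = rNorm r u ^ r := by
  rw [rNorm_rpow h.pos, rNorm_rpow h.symm.pos]
  refine lintegral_congr_ae ?_
  filter_upwards [nonlinearity_ae (α := r - 2) (by linarith) hu] with x hx
  have e : ‖u x * ((‖u x‖ ^ (r - 2) : ℝ) : ℂ)‖ₑ = ‖u x‖ₑ ^ (r - 1) := by
    have h1 : ‖u x‖ₑ ^ (r - 1) = ‖u x‖ₑ * ‖u x‖ₑ ^ (r - 2) := by
      nth_rewrite 2 [← ENNReal.rpow_one ‖u x‖ₑ]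
      rw [← ENNReal.rpow_add_of_nonneg _ _ zero_le_one (by linarith)]
      congr 1; ring
    rw [h1, enorm_mul, ← ofReal_norm (x := ((‖u x‖ ^ (r - 2) : ℝ) : ℂ)),
      Complex.norm_of_nonneg (by positivity),
      ← ENNReal.ofReal_rpow_of_nonneg (norm_nonneg _) (by linarith), ofReal_norm]
  rw [hx, e, ← ENNReal.rpow_mul, h.sub_one_mul_conj]

theorem inner_nonlinearity {r K : ℝ} (hr : 2 ≤ r) {u : L2} (hu : ∀ᵐ x, ‖u x‖ ≤ K) :
    (inner ℂ (nonlinearity (r - 2) u) u : ℂ) = (((rNorm r u ^ r).toReal : ℝ) : ℂ) := by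
  rw [L2.inner_eq, rNorm_rpow (by linarith)]
  have e : ∫ x, u x * (starRingEnd ℂ) (nonlinearity (r - 2) u x) = ∫ x, ((‖u x‖ ^ r : ℝ) : ℂ) := by
    refine integral_congr_ae ?_
    filter_upwards [nonlinearity_ae (α := r - 2) (by linarith) hu] with x hx
    rw [hx, map_mul, Complex.conj_ofReal, ← mul_assoc, Complex.mul_conj, Complex.normSq_eq_norm_sq,
      ← Complex.ofReal_mul]
    congr 1
    rcases (norm_nonneg (u x)).eq_or_lt with h0 | h0
    · rw [← h0, Real.zero_rpow (by linarith : r ≠ 0)]; simp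
    · rw [← Real.rpow_natCast, ← Real.rpow_add h0]; congr 1; push_cast; ring
  rw [e, integral_complex_ofReal, integral_eq_lintegral_of_nonneg_ae
    (Eventually.of_forall fun x => by positivity)
    (((Lp.aestronglyMeasurable u).norm.aemeasurable.pow_const _).aestronglyMeasurable)]
  congr 2
  refine lintegral_congr fun x => ?_
  rw [← ENNReal.ofReal_rpow_of_nonneg (norm_nonneg _) (by linarith), ofReal_norm]

theorem nonlinearity_translateL2 {α K : ℝ} (hα : 0 ≤ α) {u : L2} (hu : ∀ᵐ x, ‖u x‖ ≤ K) (y : ℝ) :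
    nonlinearity α (translateL2 y u) = translateL2 y (nonlinearity α u) := by
  have h0 : ∀ᵐ x, ‖translateL2 y u x‖ ≤ K := by
    filter_upwards [translateL2_ae y u, ae_comp_sub y hu] with x h1 h2
    rwa [h1]
  apply Lp.ext
  filter_upwards [nonlinearity_ae hα h0, translateL2_ae y u, translateL2_ae y (nonlinearity α u),
    ae_comp_sub y (nonlinearity_ae hα hu)] with x h1 h2 h3 h4
  rw [h1, h2, h3, h4]

theorem nonlinearity_reflectL2 {α K : ℝ} (hα : 0 ≤ α) {u : L2} (hu : ∀ᵐ x, ‖u x‖ ≤ K) :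
    nonlinearity α (reflectL2 u) = reflectL2 (nonlinearity α u) := by
  have h0 : ∀ᵐ x, ‖reflectL2 u x‖ ≤ K := by
    filter_upwards [reflectL2_ae u, ae_comp_neg hu] with x h1 h2
    rwa [h1]
  apply Lp.ext
  filter_upwards [nonlinearity_ae hα h0, reflectL2_ae u, reflectL2_ae (nonlinearity α u),
    ae_comp_neg (nonlinearity_ae hα hu)] with x h1 h2 h3 h4
  rw [h1, h2, h3, h4]

theorem nonlinearity_restrictOp {α K : ℝ} (hα : 0 ≤ α) {u : L2} (hu : ∀ᵐ x, ‖u x‖ ≤ K) {s : Set ℝ}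
    (hs : MeasurableSet s) :
    nonlinearity α (restrictOp s u) = restrictOp s (nonlinearity α u) := by
  have h0 : ∀ᵐ x, ‖restrictOp s u x‖ ≤ K := by
    filter_upwards [restrictOp_ae hs u, hu] with x h1 h2
    rw [h1]
    exact (norm_indicator_le_norm_self _ _).trans h2
  apply Lp.ext
  filter_upwards [nonlinearity_ae hα h0, restrictOp_ae hs u, restrictOp_ae hs (nonlinearity α u),
    nonlinearity_ae hα hu] with x h1 h2 h3 h4
  rw [h1, h2, h3]
  by_cases hx : x ∈ s
  · rw [Set.indicator_of_mem hx, Set.indicator_of_mem hx, h4]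
  · rw [Set.indicator_of_notMem hx, Set.indicator_of_notMem hx, zero_mul]

theorem setIntegral_norm_le_norm (g : L2) (x : ℝ) : ∫ y in Set.Ioc x (x + 1), ‖g y‖ ≤ ‖g‖ := by
  have h1 := eLpNorm_le_eLpNorm_mul_rpow_measure_univ (μ := volume.restrict (Set.Ioc x (x + 1)))
    (p := 1) (q := 2) (by norm_num) (Lp.aestronglyMeasurable g).restrict
  rw [Measure.restrict_apply_univ, Real.volume_Ioc, add_sub_cancel_left, ENNReal.ofReal_one,
    ENNReal.one_rpow, mul_one] at h1
  have h2 := h1.trans (eLpNorm_mono_measure g Measure.restrict_le_self)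
  rw [integral_norm_eq_lintegral_enorm (Lp.aestronglyMeasurable g).restrict, Lp.norm_def,
    ← eLpNorm_one_eq_lintegral_enorm]
  exact ENNReal.toReal_mono (Lp.eLpNorm_ne_top g) h2

/-- The Sobolev embedding `H¹(ℝ) ⊆ L^∞(ℝ)`. -/
theorem HasWeakDerivOn.ae_norm_le {f g : L2} (h : HasWeakDerivOn Set.univ f g) :
    ∀ᵐ x, ‖f x‖ ≤ ‖f‖ + ‖g‖ := by
  obtain ⟨c, hc⟩ := h.exists_ae_eq_primitive f.locallyIntegrable g.locallyIntegrable isOpen_univ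
    Set.ordConnected_univ subset_rfl Set.univ_nonempty
  have hc' : ∀ᵐ x, f x = c + ∫ s in (0 : ℝ)..x, g s := hc.mono fun x hx => hx trivial
  have hgi : ∀ a b, IntervalIntegrable g volume a b := fun a b =>
    (g.locallyIntegrable.integrableOn_isCompact isCompact_uIcc).intervalIntegrable
  have hfi : ∀ x, IntegrableOn (fun y => ‖f y‖) (Set.Ioc x (x + 1)) volume := fun x =>
    ((f.locallyIntegrable.integrableOn_isCompact isCompact_Icc).mono_set
      Set.Ioc_subset_Icc_self).norm
  filter_upwards [hc'] with x hx
  -- $f(x)$ differs from $f(y)$ by the integral of $g$ over an interval of length at most one.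
  -- Averaging over $y$ in the unit interval then bounds $|f(x)|$ by the two $L^2$ norms.
  have key : ∀ᵐ y, y ∈ Set.Ioc x (x + 1) → ‖f x‖ ≤ ‖f y‖ + ‖g‖ := by
    filter_upwards [hc'] with y hy hyI
    have e : f x = f y - ∫ s in x..y, g s := by
      rw [hx, hy, ← intervalIntegral.integral_add_adjacent_intervals (hgi 0 x) (hgi x y)]; ring
    rw [e]
    refine (norm_sub_le _ _).trans ?_
    gcongr
    rw [intervalIntegral.integral_of_le hyI.1.le]
    refine (norm_integral_le_integral_norm _).trans
      (le_trans (setIntegral_mono_set ?_ ?_ ?_) (setIntegral_norm_le_norm g x))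
    · exact ((g.locallyIntegrable.integrableOn_isCompact isCompact_Icc).mono_set
        Set.Ioc_subset_Icc_self).norm
    · exact Eventually.of_forall fun s => norm_nonneg _
    · exact (Set.Ioc_subset_Ioc_right hyI.2).eventuallyLE
  have h1 : ∫ _ in Set.Ioc x (x + 1), ‖f x‖ ≤ ∫ y in Set.Ioc x (x + 1), (‖f y‖ + ‖g‖) := by
    refine setIntegral_mono_on_ae (by simp) ((hfi x).add (by simp)) measurableSet_Ioc ?_
    exact key
  rw [integral_add (hfi x) (by simp)] at h1
  simp only [setIntegral_const, smul_eq_mul] at h1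
  have h2 : volume.real (Set.Ioc x (x + 1)) = 1 := by simp
  rw [h2, one_mul, one_mul] at h1
  exact h1.trans (by gcongr; exact setIntegral_norm_le_norm f x)

/-! ### A Strichartz estimate for the smoothed free flow -/

/-- The adjoint of the convolution with the exponential density. -/
noncomputable def anticausalOp (q : ℝ) : L2 →L[ℂ] L2 :=
  reflectL2.toContinuousLinearMap ∘L causalOp q ∘L reflectL2.toContinuousLinearMap

theorem anticausalOp_apply (q : ℝ) (f : L2) :
    anticausalOp q f = reflectL2 (causalOp q (reflectL2 f)) := rfl

theorem conj_causalSymbol (q x : ℝ) :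
    (starRingEnd ℂ) (causalSymbol q x) = causalSymbol q (-x) := by
  simp [causalSymbol, map_ofNat (starRingEnd ℂ) 2]

theorem inner_fourierMul_left {m : ℝ → ℂ} (hm : BddMeas m) (f g : L2) :
    inner ℂ (fourierMul m f) g =
      ∫ x, (starRingEnd ℂ) (m x) * (fourierL2 g x * (starRingEnd ℂ) (fourierL2 f x)) := by
  rw [← inner_conj_symm, inner_fourierMul hm, ← integral_conj]
  congr 1; ext x
  simp only [map_mul, Complex.conj_conj]
  ring

theorem inner_causalOp_left {q : ℝ} (hq : 0 < q) (f g : L2) :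
    inner ℂ (causalOp q f) g = inner ℂ f (anticausalOp q g) := by
  have e : anticausalOp q g = fourierMul (fun x => causalSymbol q (-x)) g := by
    rw [anticausalOp_apply, causalOp, reflectL2_fourierMul (bddMeas_causalSymbol hq),
      reflectL2_reflectL2]
  rw [e, causalOp, inner_fourierMul_left (bddMeas_causalSymbol hq),
    inner_fourierMul (bddMeas_causalSymbol hq).comp_neg]
  simp only [conj_causalSymbol]

theorem inner_anticausalOp_left {q : ℝ} (hq : 0 < q) (f g : L2) :
    inner ℂ (anticausalOp q f) g = inner ℂ f (causalOp q g) := by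
  rw [← inner_conj_symm, ← inner_causalOp_left hq, inner_conj_symm]

theorem freeGroup_anticausalOp {q : ℝ} (hq : 0 < q) (t : ℝ) (f : L2) :
    freeGroup t (anticausalOp q f) = anticausalOp q (freeGroup t f) := by
  rw [anticausalOp_apply, freeGroup_reflectL2, freeGroup_causalOp hq, freeGroup_reflectL2]
  rfl

theorem rNorm_anticausalOp_le {r s : ℝ} (h : r.HolderConjugate s) (hr : 2 ≤ r) {q : ℝ} (hq : 0 < q)
    (f : L2) : rNorm r (anticausalOp q f) ≤ rNorm r f := by
  rw [anticausalOp_apply, rNorm_reflectL2]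
  exact (rNorm_causalOp_le h hr hq _).trans_eq (rNorm_reflectL2 r f)

/-- The dual of the smoothing $L^2\to L^r$, read off from $\|C^*f\|^2=\langle f,CC^*f\rangle$. -/
theorem exists_enorm_anticausalOp_le {r s : ℝ} (h : r.HolderConjugate s) (hr : 2 ≤ r) {q : ℝ}
    (hq : 0 < q) : ∃ c : ℝ≥0∞, c ≠ ⊤ ∧ ∀ f : L2, ‖anticausalOp q f‖ₑ ≤ c * rNorm s f := by
  obtain ⟨c, hc, hc'⟩ := exists_rNorm_causalOp_le hq hr
  refine ⟨c, hc, fun f => ?_⟩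
  have h1 : ‖anticausalOp q f‖ₑ * ‖anticausalOp q f‖ₑ =
      ‖(inner ℂ f (causalOp q (anticausalOp q f)) : ℂ)‖ₑ := by
    rw [← inner_anticausalOp_left hq, inner_self_eq_norm_sq_to_K, ← ofReal_norm, ← ofReal_norm,
      ← ENNReal.ofReal_mul (norm_nonneg _), norm_pow]
    congr 1
    simp [sq]
  have h2 : ‖anticausalOp q f‖ₑ * ‖anticausalOp q f‖ₑ ≤ c * rNorm s f * ‖anticausalOp q f‖ₑ := by
    rw [h1]
    refine (enorm_inner_le h _ _).trans ?_
    calc _ ≤ (c * ‖anticausalOp q f‖ₑ) * rNorm s f := by gcongr; exact hc' _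
      _ = _ := by ring
  rcases eq_or_ne ‖anticausalOp q f‖ₑ 0 with h0 | h0
  · rw [h0]; exact zero_le
  · exact (ENNReal.mul_le_mul_iff_left h0 enorm_ne_top).1 h2

/-- The kernel estimate behind the Strichartz estimate. -/
theorem exists_enorm_inner_freeGroup_anticausalOp_le {r s : ℝ} (h : r.HolderConjugate s)
    (hr : 6 ≤ r) {q : ℝ} (hq : 0 < q) :
    ∃ c : ℝ≥0∞, c ≠ ⊤ ∧ ∀ t ≠ 0, ∀ f g : L2,
      ‖(inner ℂ (anticausalOp q g) (freeGroup t (anticausalOp q f)) : ℂ)‖ₑ ≤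
        c * rieszKernel (2 / r) t * (rNorm s g * rNorm s f) := by
  have hr2 : 2 ≤ r := by linarith
  obtain ⟨c, hc, hc'⟩ := exists_rNorm_freeGroup_le h (by linarith : 2 < r)
  obtain ⟨d, hd, hd'⟩ := exists_enorm_anticausalOp_le h hr2 hq
  refine ⟨c + d * d, ENNReal.add_ne_top.2 ⟨hc, ENNReal.mul_ne_top hd hd⟩, fun t ht f g => ?_⟩
  have ht' : 0 < |t| := abs_pos.2 ht
  -- For short times smoothing gives a bound without singularity, and the kernel is at least one.
  -- For long times dispersion decays like $|t|^{-(1/2-1/r)}$, which is at most $|t|^{-2/r}$ exactly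
  -- because $r\ge6$.
  rcases le_total |t| 1 with h1 | h1
  · have h2 : 1 ≤ rieszKernel (2 / r) t := by
      rw [rieszKernel, ← ENNReal.ofReal_one]
      exact ENNReal.ofReal_le_ofReal (Real.one_le_rpow_of_pos_of_le_one_of_nonpos ht' h1
        (neg_nonpos.2 (by positivity)))
    calc _ ≤ ‖anticausalOp q g‖ₑ * ‖anticausalOp q f‖ₑ := by
          rw [← ofReal_norm, ← ofReal_norm, ← ofReal_norm, ← ENNReal.ofReal_mul (norm_nonneg _)]
          refine ENNReal.ofReal_le_ofReal ((norm_inner_le_norm _ _).trans_eq ?_)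
          rw [norm_freeGroup]
      _ ≤ (d * rNorm s g) * (d * rNorm s f) := by gcongr <;> exact hd' _
      _ = d * d * 1 * (rNorm s g * rNorm s f) := by ring
      _ ≤ _ := by
          gcongr
          exact le_add_self
  · have h2 : ENNReal.ofReal (|t| ^ (-(1 / 2 - 1 / r))) ≤ rieszKernel (2 / r) t := by
      refine ENNReal.ofReal_le_ofReal (Real.rpow_le_rpow_of_exponent_le h1 ?_)
      rw [neg_le_neg_iff, div_le_iff₀ (by linarith)]
      have : (1 / 2 - 1 / r) * r = r / 2 - 1 := by
        have : r ≠ 0 := by linarith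
        field_simp
      linarith
    rw [inner_anticausalOp_left hq, freeGroup_anticausalOp hq]
    calc _ ≤ rNorm r (causalOp q (anticausalOp q (freeGroup t f))) * rNorm s g :=
          enorm_inner_le h _ _
      _ ≤ (c * ENNReal.ofReal (|t| ^ (-(1 / 2 - 1 / r))) * rNorm s f) * rNorm s g := by
          gcongr
          exact (rNorm_causalOp_le h hr2 hq _).trans
            ((rNorm_anticausalOp_le h hr2 hq _).trans (hc' t ht f))
      _ ≤ ((c + d * d) * rieszKernel (2 / r) t * rNorm s f) * rNorm s g := by
          gcongr
          exact le_self_add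
      _ = _ := by ring

theorem lintegral_le_of_setLIntegral_Icc_le {f : ℝ → ℝ≥0∞} (hf : Measurable f) {M : ℝ≥0∞}
    (h : ∀ T : ℝ, ∫⁻ t in Set.Icc (-T) T, f t ≤ M) : ∫⁻ t, f t ≤ M := by
  have h1 := (aecover_Icc (μ := (volume : Measure ℝ)) tendsto_neg_atTop_atBot
    tendsto_id).lintegral_tendsto_of_countably_generated hf.aemeasurable
  exact le_of_tendsto' h1 fun T => h T

/-- The dual Strichartz estimate in `L^{r'}` of space-time, localized in time. -/
theorem exists_enorm_integral_freeGroup_anticausalOp_le {r s : ℝ} (h : r.HolderConjugate s)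
    (hr : 6 ≤ r) {q : ℝ} (hq : 0 < q) :
    ∃ c : ℝ≥0∞, c ≠ ⊤ ∧ ∀ (F : ℝ → L2) (S : Set ℝ), MeasurableSet S →
      (Measurable fun t => rNorm s (F t)) →
      IntegrableOn (fun t => freeGroup (-t) (anticausalOp q (F t))) S →
      ‖∫ t in S, freeGroup (-t) (anticausalOp q (F t))‖ₑ ^ (2 : ℝ) ≤
        c * (∫⁻ t in S, rNorm s (F t) ^ s) ^ (2 / s) := by
  have hr0 : 0 < r := by linarith
  have hs0 : 0 < s := h.symm.pos
  have hs1 : 1 < s := h.symm.lt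
  obtain ⟨c, hc, hc'⟩ := exists_enorm_inner_freeGroup_anticausalOp_le h hr hq
  -- The kernel $|t|^{-2/r}$ maps $L^{r'}$ to $L^r$ in time, since $1/r=1/s+2/r-1$. The squared norm
  -- of the integral is expanded as a double integral and closed by Hölder.
  obtain ⟨C, hC, hC'⟩ := exists_lintegral_rieszIntegral_le (m := s) (p := r) (l := 2 / r) hs1 hr0
    (by positivity) (by rw [div_lt_one hr0]; linarith)
    (by have := h.inv_add_inv_eq_one
        rw [one_div, one_div, div_eq_mul_inv]; linarith)
  refine ⟨c * C ^ (1 / r), ENNReal.mul_ne_top hc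
    (ENNReal.rpow_ne_top_of_nonneg (by positivity) hC), fun F S hS hFm hFi => ?_⟩
  set G : ℝ → L2 := fun t => freeGroup (-t) (anticausalOp q (F t)) with hG
  set Φ := ∫ t in S, G t with hΦ
  set φ : ℝ → ℝ≥0∞ := S.indicator fun t => rNorm s (F t) with hφ
  have hφm : Measurable φ := hFm.indicator hS
  set A := ∫⁻ t in S, rNorm s (F t) ^ s with hA
  have hφA : ∫⁻ t, φ t ^ s = A := by
    rw [hA, ← lintegral_indicator hS]
    refine lintegral_congr fun t => ?_
    by_cases ht : t ∈ S
    · rw [hφ, Set.indicator_of_mem ht, Set.indicator_of_mem ht]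
    · rw [hφ, Set.indicator_of_notMem ht, Set.indicator_of_notMem ht, ENNReal.zero_rpow_of_pos hs0]
  have hGG : ∀ t t', t' ≠ t → ‖(inner ℂ (G t) (G t') : ℂ)‖ₑ ≤
      c * rieszKernel (2 / r) (t - t') * (rNorm s (F t) * rNorm s (F t')) := by
    intro t t' htt
    have e : (inner ℂ (G t) (G t') : ℂ) = inner ℂ (anticausalOp q (F t))
        (freeGroup (t - t') (anticausalOp q (F t'))) := by
      rw [sub_eq_add_neg, freeGroup_add]
      exact (inner_freeGroup_right t _ _).symm
    rw [e]
    exact hc' _ (sub_ne_zero.2 htt.symm) _ _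
  have h1 : ∀ t, ‖(inner ℂ Φ (G t) : ℂ)‖ₑ ≤
      c * (rNorm s (F t) * rieszIntegral (2 / r) φ t) := by
    intro t
    rw [← inner_conj_symm, RCLike.enorm_conj, hΦ, ← integral_inner hFi]
    refine (enorm_integral_le_lintegral_enorm _).trans ?_
    have hne : ∀ᵐ t' : ℝ, t' ≠ t := by simp [ae_iff]
    calc _ ≤ ∫⁻ t' in S, c * rNorm s (F t) * (rieszKernel (2 / r) (t - t') * rNorm s (F t')) := by
          refine lintegral_mono_ae ((ae_restrict_of_ae hne).mono fun t' htt => ?_)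
          exact (hGG t t' htt).trans_eq (by ring)
      _ = ∫⁻ t', c * rNorm s (F t) * (rieszKernel (2 / r) (t - t') * φ t') := by
          rw [← lintegral_indicator hS]
          refine lintegral_congr fun t' => ?_
          by_cases ht : t' ∈ S
          · rw [hφ, Set.indicator_of_mem ht, Set.indicator_of_mem ht]
          · rw [hφ, Set.indicator_of_notMem ht, Set.indicator_of_notMem ht, mul_zero, mul_zero]
      _ = _ := by
          have m1 : Measurable fun t' => rieszKernel (2 / r) (t - t') * φ t' :=
            ((measurable_rieszKernel _).comp (by fun_prop)).mul hφm
          rw [lintegral_const_mul _ m1, mul_assoc]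
          rfl
  have h2 : ‖Φ‖ₑ ^ (2 : ℝ) = ‖(inner ℂ Φ Φ : ℂ)‖ₑ := by
    rw [inner_self_eq_norm_sq_to_K, ← ofReal_norm, ← ofReal_norm,
      ENNReal.ofReal_rpow_of_nonneg (norm_nonneg _) (by norm_num), norm_pow, Real.rpow_two]
    simp
  have h3 : (inner ℂ Φ Φ : ℂ) = ∫ t in S, inner ℂ Φ (G t) := by
    conv_lhs => rw [hΦ]
    rw [← hΦ, integral_inner hFi]
  rw [h2, h3]
  refine (enorm_integral_le_lintegral_enorm _).trans ?_
  calc _ ≤ ∫⁻ t in S, c * (rNorm s (F t) * rieszIntegral (2 / r) φ t) := lintegral_mono h1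
    _ = ∫⁻ t, c * (φ t * rieszIntegral (2 / r) φ t) := by
        rw [← lintegral_indicator hS]
        refine lintegral_congr fun t => ?_
        by_cases ht : t ∈ S
        · rw [Set.indicator_of_mem ht, hφ, Set.indicator_of_mem ht]
        · rw [Set.indicator_of_notMem ht, hφ, Set.indicator_of_notMem ht, zero_mul, mul_zero]
    _ = c * ∫⁻ t, φ t * rieszIntegral (2 / r) φ t :=
        lintegral_const_mul _ (hφm.mul (measurable_rieszIntegral _ hφm))
    _ ≤ c * (A ^ (1 / s) * (C * A ^ (r / s)) ^ (1 / r)) := by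
        gcongr
        have h4 := ENNReal.lintegral_mul_le_Lp_mul_Lq volume h.symm hφm.aemeasurable
          (measurable_rieszIntegral (2 / r) hφm).aemeasurable
        refine h4.trans ?_
        rw [hφA]
        gcongr
        exact (hC' φ hφm).trans_eq (by rw [hφA])
    _ = _ := by
        rw [ENNReal.mul_rpow_of_nonneg _ _ (by positivity), ← ENNReal.rpow_mul]
        have h5 : r / s * (1 / r) = 1 / s := by field_simp
        have h6 : A ^ (2 / s) = A ^ (1 / s) * A ^ (1 / s) := by
          rw [← ENNReal.rpow_add_of_nonneg _ _ (by positivity) (by positivity)]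
          congr 1; ring
        rw [h5, h6]; ring

theorem continuous_freeGroup_comp {θ : ℝ → ℝ} (hθ : Continuous θ) {g : ℝ → L2}
    (hg : Continuous g) : Continuous fun t => freeGroup (θ t) (g t) := by
  rw [continuous_iff_continuousAt]
  intro t
  rw [ContinuousAt, tendsto_iff_norm_sub_tendsto_zero]
  have e1 : Tendsto (fun t' => ‖g t' - g t‖) (𝓝 t) (𝓝 0) :=
    tendsto_iff_norm_sub_tendsto_zero.1 (hg.tendsto t)
  have e2 : Tendsto (fun t' => ‖freeGroup (θ t') (g t) - freeGroup (θ t) (g t)‖) (𝓝 t) (𝓝 0) :=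
    tendsto_iff_norm_sub_tendsto_zero.1 (((continuous_freeGroup (g t)).comp hθ).tendsto t)
  have e3 := e1.add e2
  rw [add_zero] at e3
  refine squeeze_zero (fun _ => norm_nonneg _) (fun t' => ?_) e3
  rw [← norm_freeGroup (θ t') (g t' - _), map_sub]
  exact norm_sub_le_norm_sub_add_norm_sub _ _ _

/-- A Strichartz estimate for the smoothed free evolution, in `L^r` of space-time. -/
theorem exists_lintegral_rNorm_freeGroup_causalOp_le {r s : ℝ} (h : r.HolderConjugate s)
    (hr : 6 ≤ r) {q : ℝ} (hq : 0 < q) :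
    ∃ c : ℝ≥0∞, c ≠ ⊤ ∧ ∀ b : L2,
      ∫⁻ t, rNorm r (freeGroup t (causalOp q b)) ^ r ≤ c * ‖b‖ₑ ^ r := by
  have hr0 : 0 < r := by linarith
  have hr2 : 2 ≤ r := by linarith
  have hs0 : 0 < s := h.symm.pos
  obtain ⟨c, hc, hc'⟩ := exists_enorm_integral_freeGroup_anticausalOp_le h hr hq
  obtain ⟨d, hd, hd'⟩ := exists_rNorm_causalOp_le hq hr2
  refine ⟨c ^ (r / 2), ENNReal.rpow_ne_top_of_nonneg (by positivity) hc, fun b => ?_⟩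
  set u : ℝ → L2 := fun t => freeGroup t (causalOp q b) with hu
  have huc : Continuous u := continuous_freeGroup _
  set K : ℝ := ‖(memLp_expDensity hq).toLp‖ * ‖b‖ with hK
  have hub : ∀ t, ∀ᵐ x, ‖u t x‖ ≤ K := fun t => by
    change ∀ᵐ x, ‖freeGroup t (causalOp q b) x‖ ≤ K
    rw [freeGroup_causalOp hq, hK, ← norm_freeGroup t b]
    exact ae_norm_causalOp_le hq _
  have hur : ∀ t, rNorm r (u t) ≤ d * ‖b‖ₑ := fun t => by
    change rNorm r (freeGroup t (causalOp q b)) ≤ _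
    rw [freeGroup_causalOp hq]
    refine (hd' _).trans_eq ?_
    rw [← ofReal_norm, norm_freeGroup, ofReal_norm]
  have hum : Measurable fun t => rNorm r (u t) := measurable_rNorm h hr2 huc
  -- $TT^*$ with the extremal function: the pairing of `F` with the evolution `u` is exactly the
  -- quantity to be bounded, and the $L^{s}$ norm of `F` is a power of the same quantity.
  set F : ℝ → L2 := fun t => nonlinearity (r - 2) (u t) with hF
  have hFc : Continuous F :=
    continuous_nonlinearity (by linarith) huc (continuous_const (y := K)) hub
  have hFs : ∀ t, rNorm s (F t) ^ s = rNorm r (u t) ^ r := fun t =>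
    rNorm_nonlinearity h hr2 (hub t)
  have hFm : Measurable fun t => rNorm s (F t) := by
    have e : (fun t => rNorm s (F t)) = fun t => (rNorm r (u t) ^ r) ^ (1 / s) := by
      funext t
      rw [← hFs, ← ENNReal.rpow_mul, mul_one_div_cancel hs0.ne', ENNReal.rpow_one]
    rw [e]
    fun_prop
  refine lintegral_le_of_setLIntegral_Icc_le (hum.pow_const r) fun T => ?_
  set A := ∫⁻ t in Set.Icc (-T) T, rNorm r (u t) ^ r with hA
  -- The norm of the evolution is bounded uniformly in time, so the integral over $[-T,T]$ is finite
  -- and may be divided out of $A^2\le c\|b\|^2A^{2/s}$. The resulting bound does not depend on `T`.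
  have hAt : A ≠ ⊤ := by
    have h1 : A ≤ ∫⁻ t in Set.Icc (-T) T, (d * ‖b‖ₑ) ^ r :=
      lintegral_mono fun t => by gcongr; exact hur t
    refine ne_top_of_le_ne_top ?_ h1
    rw [setLIntegral_const]
    exact ENNReal.mul_ne_top (ENNReal.rpow_ne_top_of_nonneg hr0.le
      (ENNReal.mul_ne_top hd enorm_ne_top)) (by simp)
  set G : ℝ → L2 := fun t => freeGroup (-t) (anticausalOp q (F t)) with hG
  have hGc : Continuous G :=
    continuous_freeGroup_comp continuous_neg ((anticausalOp q).continuous.comp hFc)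
  have hGi : IntegrableOn G (Set.Icc (-T) T) := hGc.integrableOn_Icc
  have h1 := hc' F (Set.Icc (-T) T) measurableSet_Icc hFm hGi
  simp only [hFs] at h1
  rw [← hA] at h1
  have h2 : ∀ t, (inner ℂ (G t) b : ℂ) = (((rNorm r (u t) ^ r).toReal : ℝ) : ℂ) := fun t => by
    have e : (inner ℂ (G t) b : ℂ) = inner ℂ (F t) (u t) := by
      rw [← inner_freeGroup_right, inner_anticausalOp_left hq, hu, ← freeGroup_causalOp hq]
    rw [e]
    exact inner_nonlinearity hr2 (hub t)
  have h3 : A ≤ ‖∫ t in Set.Icc (-T) T, G t‖ₑ * ‖b‖ₑ := by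
    have e1 : (inner ℂ b (∫ t in Set.Icc (-T) T, G t) : ℂ) = ((A.toReal : ℝ) : ℂ) := by
      rw [← integral_inner hGi]
      have e2 : ∀ t, (inner ℂ b (G t) : ℂ) = (((rNorm r (u t) ^ r).toReal : ℝ) : ℂ) := fun t => by
        rw [← inner_conj_symm, h2, Complex.conj_ofReal]
      simp only [e2]
      rw [integral_complex_ofReal, integral_toReal (hum.pow_const r).aemeasurable]
      refine Eventually.of_forall fun t => lt_top_iff_ne_top.2 ?_
      exact ENNReal.rpow_ne_top_of_nonneg hr0.le (ne_top_of_le_ne_top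
        (ENNReal.mul_ne_top hd enorm_ne_top) (hur t))
    have e3 : A = ‖(inner ℂ b (∫ t in Set.Icc (-T) T, G t) : ℂ)‖ₑ := by
      rw [e1, ← ofReal_norm, Complex.norm_of_nonneg ENNReal.toReal_nonneg,
        ENNReal.ofReal_toReal hAt]
    conv_lhs => rw [e3]
    rw [← ofReal_norm, ← ofReal_norm, ← ofReal_norm, ← ENNReal.ofReal_mul (norm_nonneg _)]
    exact ENNReal.ofReal_le_ofReal ((norm_inner_le_norm _ _).trans_eq (mul_comm _ _))
  rcases eq_or_ne A 0 with h0 | h0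
  · rw [h0]; exact zero_le
  have h4 : A ^ (2 : ℝ) ≤ c * ‖b‖ₑ ^ (2 : ℝ) * A ^ (2 / s) := by
    calc A ^ (2 : ℝ) ≤ (‖∫ t in Set.Icc (-T) T, G t‖ₑ * ‖b‖ₑ) ^ (2 : ℝ) := by gcongr
      _ = ‖∫ t in Set.Icc (-T) T, G t‖ₑ ^ (2 : ℝ) * ‖b‖ₑ ^ (2 : ℝ) :=
          ENNReal.mul_rpow_of_nonneg _ _ (by norm_num)
      _ ≤ (c * A ^ (2 / s)) * ‖b‖ₑ ^ (2 : ℝ) := by gcongr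
      _ = _ := by ring
  have h5 : A ^ (2 / r) * A ^ (2 / s) = A ^ (2 : ℝ) := by
    rw [← ENNReal.rpow_add _ _ h0 hAt]
    congr 1
    have := h.inv_add_inv_eq_one
    rw [div_eq_mul_inv, div_eq_mul_inv, ← mul_add, this, mul_one]
  rw [← h5] at h4
  have h6 : A ^ (2 / r) ≤ c * ‖b‖ₑ ^ (2 : ℝ) := by
    refine (ENNReal.mul_le_mul_iff_left ?_ ?_).1 h4
    · simp [ENNReal.rpow_eq_zero_iff, h0, hAt]
    · exact ENNReal.rpow_ne_top_of_nonneg (by positivity) hAt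
  have h7 := ENNReal.rpow_le_rpow h6 (by positivity : 0 ≤ r / 2)
  rw [← ENNReal.rpow_mul, show 2 / r * (r / 2) = 1 by field_simp, ENNReal.rpow_one,
    ENNReal.mul_rpow_of_nonneg _ _ (by positivity), ← ENNReal.rpow_mul,
    show 2 * (r / 2) = r by ring] at h7
  exact h7

/-- A Strichartz estimate for the smoothed free evolution, in `L^p L^r`. -/
theorem exists_lintegral_rNorm_rpow_freeGroup_causalOp_le {r s p : ℝ} (h : r.HolderConjugate s)
    (hr : 6 ≤ r) (hp : r ≤ p) {q : ℝ} (hq : 0 < q) :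
    ∃ c : ℝ≥0∞, c ≠ ⊤ ∧ ∀ b : L2,
      ∫⁻ t, rNorm r (freeGroup t (causalOp q b)) ^ p ≤ c * ‖b‖ₑ ^ p := by
  obtain ⟨c, hc, hc'⟩ := exists_lintegral_rNorm_freeGroup_causalOp_le h hr hq
  obtain ⟨d, hd, hd'⟩ := exists_rNorm_causalOp_le hq (by linarith : 2 ≤ r)
  have hpr : 0 ≤ p - r := by linarith
  have hdp : d ^ (p - r) ≠ ⊤ := ENNReal.rpow_ne_top_of_nonneg hpr hd
  refine ⟨d ^ (p - r) * c, ENNReal.mul_ne_top hdp hc, fun b => ?_⟩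
  -- The surplus power is absorbed by the uniform bound in time that smoothing provides.
  have e : ∀ a : ℝ≥0∞, a ^ p = a ^ (p - r) * a ^ r := fun a => by
    rw [← ENNReal.rpow_add_of_nonneg _ _ hpr (by linarith)]
    congr 1; ring
  calc _ ≤ ∫⁻ t, (d * ‖b‖ₑ) ^ (p - r) * rNorm r (freeGroup t (causalOp q b)) ^ r := by
        refine lintegral_mono fun t => ?_
        rw [e]
        gcongr
        rw [freeGroup_causalOp hq]
        refine (hd' _).trans_eq ?_
        rw [← ofReal_norm, norm_freeGroup, ofReal_norm]
    _ = (d * ‖b‖ₑ) ^ (p - r) * ∫⁻ t, rNorm r (freeGroup t (causalOp q b)) ^ r :=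
        lintegral_const_mul' _ _ (ENNReal.rpow_ne_top_of_nonneg hpr
          (ENNReal.mul_ne_top hd enorm_ne_top))
    _ ≤ (d * ‖b‖ₑ) ^ (p - r) * (c * ‖b‖ₑ ^ r) := by gcongr; exact hc' b
    _ = _ := by
        rw [ENNReal.mul_rpow_of_nonneg _ _ hpr, e ‖b‖ₑ]; ring

/-! ### The error in the Duhamel equation of $H_q$ -/

/-- `U` solves the free Duhamel equation with data `ψ`, is continuous in `L²` and is bounded in
`L^∞` by a continuous function of time. -/
structure IsFreeSolution (α : ℝ) (ψ : L2) (U : ℝ → L2) (K : ℝ → ℝ) : Prop where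
  one_le : 1 ≤ α
  continuous : Continuous U
  continuous_bound : Continuous K
  ae_norm_le : ∀ t, ∀ᵐ x, ‖U t x‖ ≤ K t
  eq : ∀ t, U t = freeGroup t ψ -
    Complex.I • ∫ s in (0 : ℝ)..t, freeGroup (t - s) (nonlinearity α (U s))

namespace IsFreeSolution

variable {α : ℝ} {ψ : L2} {U : ℝ → L2} {K : ℝ → ℝ}

theorem of_duhamel (hα : 1 ≤ α) (hU : ContinuousInH1 U) (h : ∀ t, U t = duhamel 0 α ψ U t) :
    ∃ K, IsFreeSolution α ψ U K := by
  obtain ⟨V, hV, hUc, hVc⟩ := hU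
  refine ⟨fun t => ‖U t‖ + ‖V t‖, hα, hUc, hUc.norm.add hVc.norm,
    fun t => (hV t).ae_norm_le, fun t => ?_⟩
  conv_lhs => rw [h t]
  rw [duhamel, deltaGroup_zero_eq]

theorem continuous_nonlinearity (h : IsFreeSolution α ψ U K) :
    Continuous fun t => nonlinearity α (U t) :=
  _root_.continuous_nonlinearity h.one_le h.continuous h.continuous_bound h.ae_norm_le

theorem continuous_integrand (h : IsFreeSolution α ψ U K) (A : L2 →L[ℂ] L2) (t : ℝ) :
    Continuous fun s => freeGroup (t - s) (A (nonlinearity α (U s))) :=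
  continuous_freeGroup_comp (by fun_prop) (A.continuous.comp h.continuous_nonlinearity)

theorem continuous_freeGroup_nonlinearity (h : IsFreeSolution α ψ U K) (t : ℝ) :
    Continuous fun s => freeGroup (t - s) (nonlinearity α (U s)) :=
  h.continuous_integrand (.id ℂ L2) t

/-- Symmetries of the free equation: operators commuting with the flow and, along `U`, with the
nonlinearity. -/
theorem map (h : IsFreeSolution α ψ U K) (T : L2 →L[ℂ] L2)
    (hT : ∀ t f, T (freeGroup t f) = freeGroup t (T f))
    (hN : ∀ t, nonlinearity α (T (U t)) = T (nonlinearity α (U t)))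
    (hK : ∀ t, ∀ᵐ x, ‖T (U t) x‖ ≤ K t) :
    IsFreeSolution α (T ψ) (fun t => T (U t)) K := by
  refine ⟨h.one_le, T.continuous.comp h.continuous, h.continuous_bound, hK, fun t => ?_⟩
  conv_lhs => rw [h.eq t]
  rw [map_sub, map_smul, hT, ← T.intervalIntegral_comp_comm
    ((h.continuous_freeGroup_nonlinearity t).intervalIntegrable _ _)]
  simp only [hT, hN]

theorem reflect (h : IsFreeSolution α ψ U K) :
    IsFreeSolution α (reflectL2 ψ) (fun t => reflectL2 (U t)) K := by
  refine h.map reflectL2.toContinuousLinearMap (fun t f => (freeGroup_reflectL2 t f).symm)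
    (fun t => nonlinearity_reflectL2 (by linarith [h.one_le]) (h.ae_norm_le t)) fun t => ?_
  filter_upwards [reflectL2_ae (U t), ae_comp_neg (h.ae_norm_le t)] with x h1 h2
  exact (congrArg norm h1).trans_le h2

theorem translate (h : IsFreeSolution α ψ U K) (y : ℝ) :
    IsFreeSolution α (translateL2 y ψ) (fun t => translateL2 y (U t)) K := by
  refine h.map (translateₗᵢ y).toContinuousLinearMap (fun t f => (freeGroup_translateL2 t y f).symm)
    (fun t => nonlinearity_translateL2 (by linarith [h.one_le]) (h.ae_norm_le t) y) fun t => ?_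
  filter_upwards [translateL2_ae y (U t), ae_comp_sub y (h.ae_norm_le t)] with x h1 h2
  exact (congrArg norm h1).trans_le h2

end IsFreeSolution

/-- The operator that carries `e^{-itH_0}` of the folded data to `e^{-itH_0} - e^{-itH_q}`. -/
noncomputable def scatterOp (q : ℝ) : L2 →L[ℂ] L2 :=
  evenExt ∘L reflectL2.toContinuousLinearMap ∘L causalOp q

theorem scatterOp_apply (q : ℝ) (f : L2) :
    scatterOp q f = evenExt (reflectL2 (causalOp q f)) := rfl

/-- The part of `f` on the negative half line, minus its reflection. -/
noncomputable def foldDefect : L2 →L[ℂ] L2 := negOp - reflectL2.toContinuousLinearMap ∘L negOp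

theorem foldDefect_apply (f : L2) : foldDefect f = negOp f - reflectL2 (negOp f) := rfl

theorem foldOp_eq_sub_foldDefect (f : L2) : foldOp f = f - foldDefect f := by
  rw [foldOp_apply, foldDefect_apply, map_add, reflectL2_negOp]
  nth_rewrite 3 [← posOp_add_negOp f]
  abel

theorem deltaGroup_eq_sub {q : ℝ} (hq : 0 < q) (t : ℝ) (f : L2) :
    deltaGroup q t f = freeGroup t f - scatterOp q (freeGroup t (foldOp f)) := by
  rw [deltaGroup_eq_robinGroup hq, scatterOp_apply, ← freeGroup_sub_robinGroup hq, sub_sub_cancel]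

namespace IsFreeSolution

variable {α : ℝ} {ψ : L2} {U : ℝ → L2} {K : ℝ → ℝ}

theorem sub_duhamel (h : IsFreeSolution α ψ U K) {q : ℝ} (hq : 0 < q) (t : ℝ) :
    U t - duhamel q α ψ U t = scatterOp q (freeGroup t (foldOp ψ)) -
      Complex.I • ∫ s in (0 : ℝ)..t,
        scatterOp q (freeGroup (t - s) (foldOp (nonlinearity α (U s)))) := by
  rw [duhamel]
  simp only [deltaGroup_eq_sub hq]
  have h1 := h.continuous_freeGroup_nonlinearity t
  have h2 : Continuous fun s =>
      scatterOp q (freeGroup (t - s) (foldOp (nonlinearity α (U s)))) :=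
    (scatterOp q).continuous.comp (h.continuous_integrand foldOp t)
  rw [intervalIntegral.integral_sub (h1.intervalIntegrable _ _) (h2.intervalIntegrable _ _)]
  conv_lhs => enter [1]; rw [h.eq t]
  rw [smul_sub]
  abel

/-- The error depends on the data and the force only through `foldOp`, which cannot distinguish a
function from its reflection. This reduces escape to $-\infty$ to escape to $+\infty$. -/
theorem sub_duhamel_reflect (h : IsFreeSolution α ψ U K) {q : ℝ} (hq : 0 < q) (t : ℝ) :
    U t - duhamel q α ψ U t =
      reflectL2 (U t) - duhamel q α (reflectL2 ψ) (fun t => reflectL2 (U t)) t := by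
  rw [h.sub_duhamel hq, h.reflect.sub_duhamel hq, foldOp_reflectL2]
  have e : ∀ s, foldOp (nonlinearity α (reflectL2 (U s))) = foldOp (nonlinearity α (U s)) := fun s => by
    rw [nonlinearity_reflectL2 (by linarith [h.one_le]) (h.ae_norm_le s), foldOp_reflectL2]
  simp only [e]

/-- With `foldOp` written as the identity minus `foldDefect`, the identity parts of the linear and
Duhamel terms add up to `U` by its own equation. The solution therefore enters through its given
norm, and only the defects need space-time estimates. -/
theorem sub_duhamel_eq_foldDefect (h : IsFreeSolution α ψ U K) {q : ℝ} (hq : 0 < q) (t : ℝ) :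
    U t - duhamel q α ψ U t = scatterOp q (U t) - scatterOp q (freeGroup t (foldDefect ψ)) +
      Complex.I • scatterOp q (∫ s in (0 : ℝ)..t,
        freeGroup (t - s) (foldDefect (nonlinearity α (U s)))) := by
  have h1 := h.continuous_freeGroup_nonlinearity t
  have h2 := h.continuous_integrand foldDefect t
  rw [h.sub_duhamel hq, (scatterOp q).intervalIntegral_comp_comm
    ((h.continuous_integrand foldOp t).intervalIntegrable _ _)]
  simp only [foldOp_eq_sub_foldDefect, map_sub]
  rw [intervalIntegral.integral_sub (h1.intervalIntegrable _ _) (h2.intervalIntegrable _ _)]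
  conv_rhs => enter [1, 1]; rw [h.eq t]
  rw [map_sub, map_sub, map_smul, smul_sub]
  abel

end IsFreeSolution

/-! ### Estimates of the error and the limit -/

theorem negOp_translateL2 (y : ℝ) (f : L2) :
    negOp (translateL2 y f) = translateL2 y (restrictOp (Set.Iio (-y)) f) := by
  apply Lp.ext
  filter_upwards [negOp_ae (translateL2 y f), translateL2_ae y f,
    translateL2_ae y (restrictOp (Set.Iio (-y)) f),
    ae_comp_sub y (restrictOp_ae measurableSet_Iio f)] with x h1 h2 h3 h4
  rw [h1, h3, h4]
  have e : x ∈ Set.Iio 0 ↔ x - y ∈ Set.Iio (-y) := by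
    simp only [Set.mem_Iio]; constructor <;> intro h <;> linarith
  by_cases hx : x ∈ Set.Iio 0
  · rw [Set.indicator_of_mem hx, Set.indicator_of_mem (e.1 hx), h2]
  · rw [Set.indicator_of_notMem hx, Set.indicator_of_notMem (fun h => hx (e.2 h))]

theorem rNorm_scatterOp_le {r s : ℝ} (h : r.HolderConjugate s) (hr : 2 ≤ r) {q : ℝ} (hq : 0 < q)
    (f : L2) : rNorm r (scatterOp q f) ≤ 2 * rNorm r (negOp f) :=
  rNorm_evenExt_reflectL2_causalOp_le h hr hq f

/-- Here $C$ is kept inside the bound instead of being dropped by contraction, since the $L^2$ data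
need its smoothing. -/
theorem rNorm_scatterOp_freeGroup_le {r : ℝ} (hr : 1 ≤ r) {q : ℝ} (hq : 0 < q) (t : ℝ) (f : L2) :
    rNorm r (scatterOp q (freeGroup t f)) ≤ 2 * rNorm r (freeGroup t (causalOp q f)) := by
  rw [scatterOp_apply, freeGroup_causalOp hq]
  refine (rNorm_evenExt_reflectL2_le hr _).trans ?_
  gcongr
  exact rNorm_restrictOp_le r measurableSet_Iio _

theorem rNorm_foldDefect_le {r : ℝ} (hr : 1 ≤ r) (f : L2) :
    rNorm r (foldDefect f) ≤ 2 * rNorm r (negOp f) := by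
  rw [foldDefect_apply, two_mul]
  exact (rNorm_sub_le hr _ _).trans_eq (by rw [rNorm_reflectL2])

theorem tendsto_rNorm_restrictOp_Iio {r : ℝ} (hr : 0 < r) {f : L2} (hf : rNorm r f ≠ ⊤) :
    Tendsto (fun y : ℝ => rNorm r (restrictOp (Set.Iio (-y)) f)) atTop (𝓝 0) := by
  have hfm : Measurable f := (Lp.stronglyMeasurable f).measurable
  have e : ∀ y : ℝ, rNorm r (restrictOp (Set.Iio (-y)) f) ^ r =
      ∫⁻ x, (Set.Iio (-y)).indicator (fun x => ‖f x‖ₑ ^ r) x := fun y => by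
    rw [rNorm_rpow hr]
    refine lintegral_congr_ae ?_
    filter_upwards [restrictOp_ae measurableSet_Iio f] with x hx
    rw [hx]
    by_cases h : x ∈ Set.Iio (-y)
    · rw [Set.indicator_of_mem h, Set.indicator_of_mem h]
    · rw [Set.indicator_of_notMem h, Set.indicator_of_notMem h, enorm_zero,
        ENNReal.zero_rpow_of_pos hr]
  have h1 : Tendsto (fun y : ℝ => rNorm r (restrictOp (Set.Iio (-y)) f) ^ r) atTop (𝓝 0) := by
    simp only [e]
    rw [← lintegral_zero (μ := (volume : Measure ℝ))]
    refine tendsto_lintegral_filter_of_dominated_convergence (fun x => ‖f x‖ₑ ^ r)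
      (Eventually.of_forall fun y => (by fun_prop : Measurable fun x => ‖f x‖ₑ ^ r).indicator
        measurableSet_Iio) (Eventually.of_forall fun y => Eventually.of_forall fun x =>
        Set.indicator_le_self' (fun _ _ => zero_le) x) ?_ (Eventually.of_forall fun x => ?_)
    · rw [← rNorm_rpow hr]
      exact ENNReal.rpow_ne_top_of_nonneg hr.le hf
    · refine tendsto_const_nhds.congr' ?_
      filter_upwards [eventually_gt_atTop (-x)] with y hy
      rw [Set.indicator_of_notMem]
      simp only [Set.mem_Iio, not_lt]; linarith
  have h2 := (ENNReal.continuous_rpow_const (y := 1 / r)).tendsto 0 |>.comp h1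
  rw [ENNReal.zero_rpow_of_pos (by positivity)] at h2
  refine h2.congr fun y => ?_
  simp only [Function.comp_apply]
  rw [← ENNReal.rpow_mul, mul_one_div_cancel hr.ne', ENNReal.rpow_one]

theorem tendsto_lintegral_rNorm_restrictOp_Iio {r s p : ℝ} (h : r.HolderConjugate s) (hr : 2 ≤ r)
    (hp : 0 < p) {U : ℝ → L2} (hU : Continuous U) (hUp : ∫⁻ t, rNorm r (U t) ^ p ≠ ⊤) :
    Tendsto (fun y : ℝ => ∫⁻ t, rNorm r (restrictOp (Set.Iio (-y)) (U t)) ^ p) atTop (𝓝 0) := by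
  have hm := measurable_rNorm h hr hU
  rw [← lintegral_zero (μ := (volume : Measure ℝ))]
  refine tendsto_lintegral_filter_of_dominated_convergence (fun t => rNorm r (U t) ^ p)
    (Eventually.of_forall fun y => ?_) (Eventually.of_forall fun y => Eventually.of_forall fun t => ?_)
    hUp ?_
  · exact (measurable_rNorm h hr ((restrictOp _).continuous.comp hU)).pow_const p
  · exact ENNReal.rpow_le_rpow (rNorm_restrictOp_le r measurableSet_Iio _) hp.le
  · filter_upwards [ae_lt_top (hm.pow_const p) hUp] with t ht
    have h1 : rNorm r (U t) ≠ ⊤ := fun h0 => by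
      rw [h0, ENNReal.top_rpow_of_pos hp] at ht
      exact ht.ne rfl
    have h2 := (ENNReal.continuous_rpow_const (y := p)).tendsto 0 |>.comp
      (tendsto_rNorm_restrictOp_Iio h.pos h1)
    rw [ENNReal.zero_rpow_of_pos hp] at h2
    exact h2

theorem add_add_rpow_le {p : ℝ} (hp : 0 ≤ p) (a b c : ℝ≥0∞) :
    (a + b + c) ^ p ≤ 3 ^ p * (a ^ p + b ^ p + c ^ p) := by
  have h1 : a + b + c ≤ 3 * max (max a b) c := by
    calc a + b + c ≤ max (max a b) c + max (max a b) c + max (max a b) c := by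
          gcongr
          · exact (le_max_left a b).trans (le_max_left _ _)
          · exact (le_max_right a b).trans (le_max_left _ _)
          · exact le_max_right _ _
      _ = _ := by ring
  refine (ENNReal.rpow_le_rpow h1 hp).trans ?_
  rw [ENNReal.mul_rpow_of_nonneg _ _ hp]
  gcongr
  rcases max_choice (max a b) c with h | h <;> rw [h]
  · rcases max_choice a b with h | h <;> rw [h]
    · exact le_add_right le_self_add
    · exact le_add_right le_add_self
  · exact le_add_self

/-- The mixed norm of the error made by replacing the free group by `e^{-itH_q}`, for a solution
translated by `y`. -/
theorem exists_lintegral_rNorm_sub_duhamel_le {r s p : ℝ} (h : r.HolderConjugate s) (hr : 6 < r)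
    (hp : p = 2 * (r - 2) * r / (r + 2)) {q : ℝ} (hq : 0 < q) :
    ∃ c₁ c₂ c₃ : ℝ≥0∞, c₁ ≠ ⊤ ∧ c₂ ≠ ⊤ ∧ c₃ ≠ ⊤ ∧
      ∀ (ψ : L2) (U : ℝ → L2) (K : ℝ → ℝ), IsFreeSolution (r - 2) ψ U K →
      ∫⁻ t, rNorm r (U t - duhamel q (r - 2) ψ U t) ^ p ≤
        c₁ * (∫⁻ t, rNorm r (negOp (U t)) ^ p) + c₂ * ‖negOp ψ‖ₑ ^ p +
          c₃ * (∫⁻ t, rNorm r (negOp (U t)) ^ p) ^ (r - 1) := by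
  have hr0 : 0 < r := by linarith
  have hr1 : 0 < r - 1 := by linarith
  have hr2 : 2 ≤ r := by linarith
  have hs0 : 0 < s := h.symm.pos
  -- Equivalent to $r\ge6$, that is, to $\alpha\ge4$.
  have hrp : r ≤ p := by
    rw [hp, le_div_iff₀ (by linarith)]
    nlinarith
  have hp0 : 0 < p := by linarith
  obtain ⟨cd, hcd, hcd'⟩ := exists_rNorm_freeGroup_le h (by linarith : 2 < r)
  obtain ⟨cs, hcs, hcs'⟩ := exists_lintegral_rNorm_rpow_freeGroup_causalOp_le h hr.le hrp hq
  set l : ℝ := 1 / 2 - 1 / r with hl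
  have hr' : 1 / r < 1 / 6 := one_div_lt_one_div_of_lt (by norm_num) hr
  have hr'' : 0 < 1 / r := by positivity
  -- The force has $L^{s}$ norm in $L^{p/(r-1)}$ of time and the dispersive kernel has exponent
  -- $l=1/2-1/r$. The relation $1/p=(r-1)/p+l-1$ amounts to $p=2r(r-2)/(r+2)$.
  obtain ⟨ch, hch, hch'⟩ := exists_lintegral_rieszIntegral_le (m := p / (r - 1)) (p := p) (l := l)
    (by rw [lt_div_iff₀ hr1]; linarith) hp0 (by linarith) (by linarith)
    (by
      have h2 : r - 2 ≠ 0 := by linarith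
      rw [hl, hp]
      field_simp
      ring)
  have hexp : p / (p / (r - 1)) = r - 1 := by field_simp
  rw [hexp] at hch'
  have h3p : (3 : ℝ≥0∞) ^ p ≠ ⊤ := ENNReal.rpow_ne_top_of_nonneg hp0.le (by simp)
  have h2p : (2 : ℝ≥0∞) ^ p ≠ ⊤ := ENNReal.rpow_ne_top_of_nonneg hp0.le (by simp)
  have h4p : (4 * cd) ^ p ≠ ⊤ := ENNReal.rpow_ne_top_of_nonneg hp0.le
    (ENNReal.mul_ne_top (by simp) hcd)
  refine ⟨3 ^ p * 2 ^ p, 3 ^ p * (2 ^ p * (cs * 2 ^ p)), 3 ^ p * ((4 * cd) ^ p * ch),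
    ENNReal.mul_ne_top h3p h2p,
    ENNReal.mul_ne_top h3p (ENNReal.mul_ne_top h2p (ENNReal.mul_ne_top hcs h2p)),
    ENNReal.mul_ne_top h3p (ENNReal.mul_ne_top h4p hch), fun ψ U K hU => ?_⟩
  set m : ℝ → ℝ≥0∞ := fun t => rNorm r (negOp (U t)) with hm
  have hmm : Measurable m := measurable_rNorm h hr2 (negOp.continuous.comp hU.continuous)
  set b : L2 := foldDefect ψ with hb
  have hbm : Measurable fun t => rNorm r (freeGroup t (causalOp q b)) :=
    measurable_rNorm h hr2 (continuous_freeGroup _)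
  have hbn : ‖b‖ₑ ≤ 2 * ‖negOp ψ‖ₑ := by
    rw [← rNorm_two, ← rNorm_two]
    exact rNorm_foldDefect_le (by norm_num) ψ
  have hmm' : Measurable fun t => m t ^ (r - 1) := hmm.pow_const _
  -- The nonlinearity is local, so its part on $x<0$ is the nonlinearity of the part of `U` there,
  -- and $r/s=r-1$.
  have hN : ∀ t, rNorm s (foldDefect (nonlinearity (r - 2) (U t))) ≤ 2 * m t ^ (r - 1) := fun t => by
    refine (rNorm_foldDefect_le h.symm.lt.le _).trans ?_
    gcongr
    rw [← nonlinearity_restrictOp (by linarith) (hU.ae_norm_le t) measurableSet_Iio]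
    have hK : ∀ᵐ x, ‖negOp (U t) x‖ ≤ K t := by
      filter_upwards [negOp_ae (U t), hU.ae_norm_le t] with x h1 h2
      rw [h1]
      exact (norm_indicator_le_norm_self _ _).trans h2
    refine le_of_eq ?_
    have h1 := rNorm_nonlinearity h hr2 hK
    rw [← h.div_conj_eq_sub_one, div_eq_mul_one_div, ENNReal.rpow_mul, ← h1, ← ENNReal.rpow_mul,
      mul_one_div_cancel hs0.ne', ENNReal.rpow_one]
  have hD : ∀ t, rNorm r (∫ σ in (0 : ℝ)..t,
      freeGroup (t - σ) (foldDefect (nonlinearity (r - 2) (U σ)))) ≤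
      2 * cd * rieszIntegral l (fun σ => m σ ^ (r - 1)) t := by
    intro t
    have hi := hU.continuous_integrand foldDefect t
    have hne : ∀ᵐ σ : ℝ, σ ≠ t := by simp [ae_iff]
    -- The time integral is enlarged to the whole line once norms are inside, which treats both
    -- signs of `t` together.
    have key : ∀ S : Set ℝ, IntegrableOn
        (fun σ => freeGroup (t - σ) (foldDefect (nonlinearity (r - 2) (U σ)))) S →
        rNorm r (∫ σ in S, freeGroup (t - σ) (foldDefect (nonlinearity (r - 2) (U σ)))) ≤
        2 * cd * rieszIntegral l (fun σ => m σ ^ (r - 1)) t := by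
      intro S hS
      refine (rNorm_integral_le h hr2 hS).trans ?_
      calc _ ≤ ∫⁻ σ, rNorm r (freeGroup (t - σ) (foldDefect (nonlinearity (r - 2) (U σ)))) :=
            setLIntegral_le_lintegral _ _
        _ ≤ ∫⁻ σ, 2 * cd * (rieszKernel l (t - σ) * m σ ^ (r - 1)) := by
            refine lintegral_mono_ae (hne.mono fun σ hσ => ?_)
            refine (hcd' _ (sub_ne_zero.2 hσ.symm) _).trans ?_
            calc _ ≤ cd * rieszKernel l (t - σ) * (2 * m σ ^ (r - 1)) :=
                  mul_le_mul_right (hN σ) _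
              _ = _ := by ring
        _ = _ := by
            have m1 : Measurable fun σ => rieszKernel l (t - σ) * m σ ^ (r - 1) :=
              ((measurable_rieszKernel l).comp (by fun_prop)).mul hmm'
            rw [lintegral_const_mul _ m1]
            rfl
    rcases le_total 0 t with ht | ht
    · rw [intervalIntegral.integral_of_le ht]
      exact key _ (hi.integrableOn_Icc.mono_set Set.Ioc_subset_Icc_self)
    · rw [intervalIntegral.integral_of_ge ht, rNorm_neg]
      exact key _ (hi.integrableOn_Icc.mono_set Set.Ioc_subset_Icc_self)
  have hpt : ∀ t, rNorm r (U t - duhamel q (r - 2) ψ U t) ≤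
      2 * m t + 2 * rNorm r (freeGroup t (causalOp q b)) +
        4 * cd * rieszIntegral l (fun σ => m σ ^ (r - 1)) t := by
    intro t
    rw [hU.sub_duhamel_eq_foldDefect hq]
    refine (rNorm_add_le (by linarith) _ _).trans (add_le_add
      ((rNorm_sub_le (by linarith) _ _).trans (add_le_add ?_ ?_)) ?_)
    · exact rNorm_scatterOp_le h hr2 hq _
    · exact rNorm_scatterOp_freeGroup_le (by linarith) hq t _
    · rw [rNorm_smul]
      have : ‖Complex.I‖ₑ = 1 := by rw [← ofReal_norm, Complex.norm_I, ENNReal.ofReal_one]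
      rw [this, one_mul]
      refine (rNorm_scatterOp_le h hr2 hq _).trans ?_
      calc _ ≤ 2 * (2 * cd * rieszIntegral l (fun σ => m σ ^ (r - 1)) t) := by
            gcongr
            exact (rNorm_restrictOp_le r measurableSet_Iio _).trans (hD t)
        _ = _ := by ring
  have hIm := measurable_rieszIntegral l hmm'
  calc _ ≤ ∫⁻ t, 3 ^ p * (2 ^ p * m t ^ p + 2 ^ p * rNorm r (freeGroup t (causalOp q b)) ^ p +
          (4 * cd) ^ p * rieszIntegral l (fun σ => m σ ^ (r - 1)) t ^ p) := by
        refine lintegral_mono fun t => ?_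
        refine (ENNReal.rpow_le_rpow (hpt t) hp0.le).trans ((add_add_rpow_le hp0.le _ _ _).trans ?_)
        rw [ENNReal.mul_rpow_of_nonneg _ _ hp0.le, ENNReal.mul_rpow_of_nonneg _ _ hp0.le,
          ENNReal.mul_rpow_of_nonneg (4 * cd) _ hp0.le]
    _ = 3 ^ p * (2 ^ p * (∫⁻ t, m t ^ p) +
          2 ^ p * (∫⁻ t, rNorm r (freeGroup t (causalOp q b)) ^ p) +
          (4 * cd) ^ p * ∫⁻ t, rieszIntegral l (fun σ => m σ ^ (r - 1)) t ^ p) := by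
        rw [lintegral_const_mul' _ _ h3p, lintegral_add_right _ ((hIm.pow_const p).const_mul _),
          lintegral_add_right _ ((hbm.pow_const p).const_mul _), lintegral_const_mul' _ _ h2p,
          lintegral_const_mul' _ _ h2p, lintegral_const_mul' _ _ h4p]
    _ ≤ 3 ^ p * (2 ^ p * (∫⁻ t, m t ^ p) + 2 ^ p * (cs * (2 * ‖negOp ψ‖ₑ) ^ p) +
          (4 * cd) ^ p * (ch * (∫⁻ t, m t ^ p) ^ (r - 1))) := by
        gcongr
        · exact (hcs' b).trans (by gcongr)
        · refine (hch' _ hmm').trans (le_of_eq ?_)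
          congr 2
          refine lintegral_congr fun t => ?_
          rw [← ENNReal.rpow_mul]
          congr 1
          field_simp
    _ = _ := by
        rw [ENNReal.mul_rpow_of_nonneg _ _ hp0.le]
        ring

theorem tendsto_lintegral_rNorm_sub_duhamel_translate {r s p : ℝ} (h : r.HolderConjugate s)
    (hr : 6 < r) (hp : p = 2 * (r - 2) * r / (r + 2)) {q : ℝ} (hq : 0 < q) {ψ : L2} {U : ℝ → L2}
    {K : ℝ → ℝ} (hU : IsFreeSolution (r - 2) ψ U K) (hUp : ∫⁻ t, rNorm r (U t) ^ p ≠ ⊤) :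
    Tendsto (fun y : ℝ => ∫⁻ t, rNorm r (translateL2 y (U t) -
      duhamel q (r - 2) (translateL2 y ψ) (fun t => translateL2 y (U t)) t) ^ p) atTop (𝓝 0) := by
  obtain ⟨c₁, c₂, c₃, h₁, h₂, h₃, H⟩ := exists_lintegral_rNorm_sub_duhamel_le h hr hp hq
  have hp0 : 0 < p := by
    have : 0 < r - 2 := by linarith
    have : 0 < r := by linarith
    rw [hp]; positivity
  have hr1 : 0 < r - 1 := by linarith
  have e1 := tendsto_lintegral_rNorm_restrictOp_Iio h (by linarith) hp0 hU.continuous hUp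
  have e2 : Tendsto (fun y : ℝ => ‖restrictOp (Set.Iio (-y)) ψ‖ₑ) atTop (𝓝 0) := by
    simp only [← rNorm_two]
    exact tendsto_rNorm_restrictOp_Iio two_pos (by rw [rNorm_two]; exact enorm_ne_top)
  have e3 := ((ENNReal.continuous_rpow_const (y := p)).tendsto 0).comp e2
  have e4 := ((ENNReal.continuous_rpow_const (y := r - 1)).tendsto 0).comp e1
  rw [ENNReal.zero_rpow_of_pos hp0] at e3
  rw [ENNReal.zero_rpow_of_pos hr1] at e4
  have e5 := ((ENNReal.Tendsto.const_mul e1 (Or.inr h₁)).add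
    (ENNReal.Tendsto.const_mul e3 (Or.inr h₂))).add (ENNReal.Tendsto.const_mul e4 (Or.inr h₃))
  simp only [mul_zero, add_zero] at e5
  refine tendsto_of_tendsto_of_tendsto_of_le_of_le tendsto_const_nhds e5 (fun _ => zero_le)
    fun y => ?_
  refine (H _ _ _ (hU.translate y)).trans (le_of_eq ?_)
  simp only [negOp_translateL2, rNorm_translateL2, Function.comp_apply]
  rw [← rNorm_two (translateL2 y _), rNorm_translateL2, rNorm_two]

theorem proposition3p4 (q α p r : ℝ) (hq : 0 < q) (hα : 4 < α)
    (hr : r = α + 2) (hp : p = 2 * α * (α + 2) / (α + 4))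
    (x : ℕ → ℝ) (hx : Tendsto (fun n => |x n|) atTop atTop)
    (ψ : L2) (hψ : MemH1 ψ)
    (U : ℝ → L2) (hU : ContinuousInH1 U) (hUpr : mixedNorm p r U < ⊤)
    (hUsol : ∀ t, U t = duhamel 0 α ψ U t) :
    ∃ g : ℕ → ℝ → L2,
      (∀ n t, translateL2 (x n) (U t) =
        duhamel q α (translateL2 (x n) ψ) (fun s => translateL2 (x n) (U s)) t + g n t) ∧
      Tendsto (fun n => mixedNorm p r (g n)) atTop (𝓝 0) := by
  have hr6 : 6 < r := by linarith
  have hrα : α = r - 2 := by linarith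
  have h : r.HolderConjugate (r.conjExponent) := Real.HolderConjugate.conjExponent (by linarith)
  have hp' : p = 2 * (r - 2) * r / (r + 2) := by
    rw [hp, hr]; congr 1 <;> ring
  have hp0 : 0 < p := by
    have : 0 < r - 2 := by linarith
    have : 0 < r := by linarith
    rw [hp']; positivity
  have hmix : ∀ g : ℝ → L2, mixedNorm p r g = (∫⁻ t, rNorm r (g t) ^ p) ^ (1 / p) := fun g => by
    rw [← eLpNorm_enorm_ofReal_rpow hp0, ← ENNReal.rpow_mul, mul_one_div_cancel hp0.ne',
      ENNReal.rpow_one]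
    rfl
  obtain ⟨K, hK⟩ := IsFreeSolution.of_duhamel (by linarith) hU hUsol
  rw [hrα] at hK
  have hUp : ∫⁻ t, rNorm r (U t) ^ p ≠ ⊤ := fun h0 => by
    rw [hmix, h0, ENNReal.top_rpow_of_pos (by positivity)] at hUpr
    exact hUpr.ne rfl
  have hUp' : ∫⁻ t, rNorm r (reflectL2 (U t)) ^ p ≠ ⊤ := by
    simpa only [rNorm_reflectL2] using hUp
  refine ⟨fun n t => translateL2 (x n) (U t) -
    duhamel q α (translateL2 (x n) ψ) (fun s => translateL2 (x n) (U s)) t,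
    fun n t => (add_sub_cancel _ _).symm, ?_⟩
  simp only [hmix]
  -- The sign of $x^n$ may vary with $n$. Both the solution and its reflection are translated by
  -- $|x^n|$, and each error is dominated by the sum of the two integrals.
  have h1 := (tendsto_lintegral_rNorm_sub_duhamel_translate h hr6 hp' hq hK hUp).comp hx
  have h2 := (tendsto_lintegral_rNorm_sub_duhamel_translate h hr6 hp' hq hK.reflect hUp').comp hx
  have h3 := ((ENNReal.continuous_rpow_const (y := 1 / p)).tendsto 0).comp
    ((add_zero (0 : ℝ≥0∞)) ▸ h1.add h2)
  rw [ENNReal.zero_rpow_of_pos (by positivity)] at h3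
  refine tendsto_of_tendsto_of_tendsto_of_le_of_le tendsto_const_nhds h3 (fun _ => zero_le)
    fun n => ?_
  simp only [Function.comp_apply]
  gcongr
  rw [hrα]
  rcases le_total 0 (x n) with hn | hn
  · rw [abs_of_nonneg hn]
    exact le_self_add
  · rw [abs_of_nonpos hn]
    refine le_trans (le_of_eq ?_) le_add_self
    refine lintegral_congr fun t => ?_
    rw [(hK.translate (x n)).sub_duhamel_reflect hq]
    simp only [reflectL2_translateL2]
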